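/- Let $K=\mathbb C(u)$, let $L\supseteq K$ be a field extension (for example $L=K$, or $L=K(\mathsf A,\mathsf B)$ with independent variables $\mathsf A,\mathsf B$), and let $\mathsf A,\mathsf B\in L$. For $n\ge 1$ let $\mathcal E_n$ be the unital associative $L$-algebra with generators $T_1,\dots,T_{n-1},E_1,\dots,E_{n-1}$ (so $\mathcal E_1=L$) and relations $$T_iT_j=T_jT_i,\quad E_iT_j=T_jE_i\quad(|i-j|>1),$$ $$T_i^2=1+(u-1)E_i(1+T_i),\quad E_i^2=E_i,\quad E_iT_i=T_iE_i,\qquad E_iE_j=E_jE_i\quad(\text{all }i,j),$$ $$T_iT_jT_i=T_jT_iT_j,\quad E_iE_jT_i=T_iE_iE_j=E_jT_iE_j,\quad E_iT_jT_i=T_jT_iE_j\quad(|i-j|=1).$$ Put $\mathbb T_{i,0}=1$ and $\mathbb T_{i,k}=T_iT_{i-1}\cdots T_k$ for $1\le k\le i$, and $\check{\mathbb T}_{i,k}=T_{i-1}\cdots T_k$ (equal to $1$ for $k=i$). The $T_i$ are invertible. For $i<j$ put $E_{i,j}=T_i\cdots T_{j-2}E_{j-1}T_{j-2}^{-1}\cdots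 T_i^{-1}$ (so $E_{i,i+1}=E_i$), and for a set partition $I$ of $\{1,\dots,n\}$ let $E_I$ be the product of the (commuting) elements $E_{i,j}$ over all pairs $i<j$ lying in a common block of $I$. Write $n\in\mathrm{Supp}(I)$ if the block of $n$ has more than one element, $I\backslash n$ for the partition of $\{1,\dots,n-1\}$ obtained by removing $n$, and $\tau_{n,k}(I)$ for the partition obtained from $I$ by merging the blocks of $k$ and $n$ and then removing $n$. Then the homomorphisms $\mathcal E_n\to\mathcal E_{n+1}$, $T_i\mapsto T_i$, $E_i\mapsto E_i$, are injective, so that $\mathcal E_1\subset\mathcal E_2\subset\cdots$. For every $n\ge2$ there is exactly one $L$-linear map $\varrho_n:\mathcal E_n\to\mathcal E_{n-1}$ such that, for all $0\le k_j\le j$ ($1\le j\le n-1$) and all set partitions $I$ of $\{1,\dots,n\}$, $$\varrho_n(\mathbb T_{1,k_1}\cdots\mathbb T_{n-1,k_{n-1}}E_I)=\begin{cases}\mathbb T_{1,k_1}\cdots\mathbb T_{n-2,k_{n-2}}E_{I\backslash n}& k_{n-1}=0,\ n\notin\mathrm{Supp}(I),\\ \mathsf B\,\mathbb T_{1,k_1}\cdots\mathbb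 T_{n-2,k_{n-2}}E_{I\backslash n}& k_{n-1}=0,\ n\in\mathrm{Supp}(I),\\ \mathsf A\,\mathbb T_{1,k_1}\cdots\mathbb T_{n-2,k_{n-2}}\check{\mathbb T}_{n-1,k_{n-1}}E_{\tau_{n,k_{n-1}}(I)}& k_{n-1}\ne0.\end{cases}$$ Let $\varrho_1$ be the identity of $\mathcal E_1=L$, and $\rho_n=\varrho_1\circ\varrho_2\circ\cdots\circ\varrho_n:\mathcal E_n\to L$. Then the family $(\rho_n)_{n\ge1}$ is a Markov trace: for all $n\ge1$ and $X,Y\in\mathcal E_n$, 1. $\rho_n(1)=1$; 2. $\rho_n(XY)=\rho_n(YX)$; 3. $\rho_{n+1}(XT_n)=\rho_{n+1}(XE_nT_n)=\mathsf A\,\rho_n(X)$; 4. $\rho_{n+1}(XE_n)=\mathsf B\,\rho_n(X)$. -/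

import Mathlib

/-!  The algebra of braids and ties `E_n` on `n = m + 1` strands is written `BT u m`.
Strands are numbered by `Fin (m + 1)` and generators by `Fin m`, both from `0`: the index `a`
stands for the strand, or the generator `T`, `E`, that is usually numbered `a + 1`. -/

namespace BraidsTies

/-- The defining relations among the letters `T_i = Sum.inl i` and `E_i = Sum.inr i`. -/
inductive Rel {L : Type*} [CommRing L] (u : L) (m : ℕ) :
    FreeAlgebra L (Fin m ⊕ Fin m) → FreeAlgebra L (Fin m ⊕ Fin m) → Prop
  | TT_far (i j : Fin m) (h : 1 < |(i : ℤ) - (j : ℤ)|) :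
      Rel u m (.ι L (.inl i) * .ι L (.inl j)) (.ι L (.inl j) * .ι L (.inl i))
  | TTT (i j : Fin m) (h : |(i : ℤ) - (j : ℤ)| = 1) :
      Rel u m (.ι L (.inl i) * .ι L (.inl j) * .ι L (.inl i))
        (.ι L (.inl j) * .ι L (.inl i) * .ι L (.inl j))
  | T_sq (i : Fin m) :
      Rel u m (.ι L (.inl i) * .ι L (.inl i))
        (1 + (u - 1) • (.ι L (.inr i) * (1 + .ι L (.inl i))))
  | EE (i j : Fin m) :
      Rel u m (.ι L (.inr i) * .ι L (.inr j)) (.ι L (.inr j) * .ι L (.inr i))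
  | E_sq (i : Fin m) :
      Rel u m (.ι L (.inr i) * .ι L (.inr i)) (.ι L (.inr i))
  | ET (i : Fin m) :
      Rel u m (.ι L (.inr i) * .ι L (.inl i)) (.ι L (.inl i) * .ι L (.inr i))
  | ET_far (i j : Fin m) (h : 1 < |(i : ℤ) - (j : ℤ)|) :
      Rel u m (.ι L (.inr i) * .ι L (.inl j)) (.ι L (.inl j) * .ι L (.inr i))
  | EET (i j : Fin m) (h : |(i : ℤ) - (j : ℤ)| = 1) :
      Rel u m (.ι L (.inr i) * .ι L (.inr j) * .ι L (.inl i))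
        (.ι L (.inl i) * .ι L (.inr i) * .ι L (.inr j))
  | TEE (i j : Fin m) (h : |(i : ℤ) - (j : ℤ)| = 1) :
      Rel u m (.ι L (.inl i) * .ι L (.inr i) * .ι L (.inr j))
        (.ι L (.inr j) * .ι L (.inl i) * .ι L (.inr j))
  | ETT (i j : Fin m) (h : |(i : ℤ) - (j : ℤ)| = 1) :
      Rel u m (.ι L (.inr i) * .ι L (.inl j) * .ι L (.inl i))
        (.ι L (.inl j) * .ι L (.inl i) * .ι L (.inr j))

/-- The algebra of braids and ties on `m + 1` strands with parameter `u`, by generators and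
relations over `L`. When `L` is an extension of `K` and `u` comes from `K`, this is the
algebra over `K` with scalars extended to `L`. -/
abbrev BT {L : Type*} [CommRing L] (u : L) (m : ℕ) : Type _ := RingQuot (Rel u m)

section Generators

variable {L : Type*} [CommRing L] (u : L) {m : ℕ}

/-- The braid generator. -/
def T (i : Fin m) : BT u m := RingQuot.mkAlgHom L (Rel u m) (.ι L (.inl i))

/-- The tie generator. -/
def E (i : Fin m) : BT u m := RingQuot.mkAlgHom L (Rel u m) (.ι L (.inr i))

theorem T_sq (i : Fin m) : T u i * T u i = 1 + (u - 1) • (E u i * (1 + T u i)) := by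
  simpa [T, E] using RingQuot.mkAlgHom_rel L (Rel.T_sq (u := u) i)

theorem E_sq (i : Fin m) : E u i * E u i = E u i := by
  simpa [T, E] using RingQuot.mkAlgHom_rel L (Rel.E_sq (u := u) i)

theorem ET (i : Fin m) : E u i * T u i = T u i * E u i := by
  simpa [T, E] using RingQuot.mkAlgHom_rel L (Rel.ET (u := u) i)

/-- The map of the tower, from `m + 1` to `m + 2` strands: `T_i ↦ T_i`, `E_i ↦ E_i`. -/
def incl (m : ℕ) : BT u m →ₐ[L] BT u (m + 1) :=
  RingQuot.liftAlgHom L ⟨FreeAlgebra.lift L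
    (Sum.elim (fun i => T u i.castSucc) (fun i => E u i.castSucc)), by
    intro x y h
    cases h with
    | TT_far i j h =>
      simpa [T, E] using RingQuot.mkAlgHom_rel L (Rel.TT_far (u := u) i.castSucc j.castSucc h)
    | TTT i j h =>
      simpa [T, E] using RingQuot.mkAlgHom_rel L (Rel.TTT (u := u) i.castSucc j.castSucc h)
    | T_sq i =>
      simpa [T, E] using RingQuot.mkAlgHom_rel L (Rel.T_sq (u := u) i.castSucc)
    | EE i j =>
      simpa [T, E] using RingQuot.mkAlgHom_rel L (Rel.EE (u := u) i.castSucc j.castSucc)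
    | E_sq i =>
      simpa [T, E] using RingQuot.mkAlgHom_rel L (Rel.E_sq (u := u) i.castSucc)
    | ET i =>
      simpa [T, E] using RingQuot.mkAlgHom_rel L (Rel.ET (u := u) i.castSucc)
    | ET_far i j h =>
      simpa [T, E] using RingQuot.mkAlgHom_rel L (Rel.ET_far (u := u) i.castSucc j.castSucc h)
    | EET i j h =>
      simpa [T, E] using RingQuot.mkAlgHom_rel L (Rel.EET (u := u) i.castSucc j.castSucc h)
    | TEE i j h =>
      simpa [T, E] using RingQuot.mkAlgHom_rel L (Rel.TEE (u := u) i.castSucc j.castSucc h)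
    | ETT i j h =>
      simpa [T, E] using RingQuot.mkAlgHom_rel L (Rel.ETT (u := u) i.castSucc j.castSucc h)⟩

/-- On one strand there are no generators, and the algebra is the ring of scalars. -/
def oneStrand : BT u 0 ≃ₐ[L] L :=
  AlgEquiv.ofAlgHom
    (RingQuot.liftAlgHom L ⟨FreeAlgebra.lift L (Sum.elim Fin.elim0 Fin.elim0), by
      intro x y h
      cases h with
      | TT_far i | TTT i | T_sq i | EE i | E_sq i | ET i | ET_far i | EET i | TEE i | ETT i =>
        exact i.elim0⟩)
    (Algebra.ofId L (BT u 0))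
    (by ext)
    (by
      apply RingQuot.ringQuot_ext'
      apply FreeAlgebra.hom_ext
      funext i
      rcases i with i | i <;> exact i.elim0)

end Generators

section Basis

variable {L : Type*} [Field L] (u : L) {m : ℕ}

/-- The inverse of `T_i`; see the two lemmas that follow. -/
def Tinv (i : Fin m) : BT u m :=
  T u i + (u⁻¹ - 1) • E u i + (u⁻¹ - 1) • (E u i * T u i)

theorem T_mul_Tinv (hu : u ≠ 0) (i : Fin m) : T u i * Tinv u i = 1 := by
  have h1 : T u i * (E u i * T u i) = E u i + (u - 1) • (E u i + E u i * T u i) := by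
    rw [← mul_assoc, ← ET, mul_assoc, T_sq, mul_add, mul_smul_comm, ← mul_assoc, E_sq,
      mul_add, mul_one]
  have h2 : (u⁻¹ - 1) * (u - 1) = (1 - u) - (u⁻¹ - 1) := by field_simp
  rw [Tinv, mul_add, mul_add, mul_smul_comm, mul_smul_comm, h1, T_sq, ← ET, mul_add, mul_one,
    smul_add (u⁻¹ - 1), smul_smul, h2]
  module

theorem Tinv_mul_T (hu : u ≠ 0) (i : Fin m) : Tinv u i * T u i = 1 := by
  have h : Tinv u i * T u i = T u i * Tinv u i := by
    simp only [Tinv, add_mul, mul_add, smul_mul_assoc, mul_smul_comm, ET, mul_assoc]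
  rw [h, T_mul_Tinv u hu]

/-- `T_i T_{i-1} ⋯ T_k` in the usual numbering from `1`, for `1 ≤ k ≤ i + 1`; the product is
empty for `k = i + 1`. -/
def descT (m i k : ℕ) : BT u m :=
  (((List.finRange m).filter fun a : Fin m => k ≤ a.val + 1 ∧ a.val + 1 ≤ i).reverse.map (T u)).prod

/-- `𝕋_{i,k}`, which is `1` for `k = 0` and `T_i T_{i-1} ⋯ T_k` for `1 ≤ k ≤ i`. -/
def bigT (m i k : ℕ) : BT u m := if k = 0 then 1 else descT u m i k

/-- `𝕋_{1,k_1} 𝕋_{2,k_2} ⋯ 𝕋_{m,k_m}`. -/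
def word (m : ℕ) (k : ℕ → ℕ) : BT u m :=
  ((List.range m).map fun j => bigT u m (j + 1) (k (j + 1))).prod

/-- For `a ≤ b`, the element `T_a ⋯ T_{b-1} E_b T_{b-1}⁻¹ ⋯ T_a⁻¹` that ties the strands
`a` and `b + 1` (all numbers from `0`). -/
def tie (a b : Fin m) : BT u m :=
  (((List.finRange m).filter fun i => a ≤ i ∧ i < b).map (T u)).prod * E u b *
    (((List.finRange m).filter fun i => a ≤ i ∧ i < b).reverse.map (Tinv u)).prod

open Classical in
/-- `E_I` for a set partition `I` of the strands: the product of the elements that tie `x` and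
`y`, over all pairs `x < y` of strands in one block of `I`. Such a pair is written as
`x = a`, `y = b + 1` with `a ≤ b`. The factors commute; they are taken in lexicographic order. -/
noncomputable def partE (I : Setoid (Fin (m + 1))) : BT u m :=
  (((List.finRange m ×ˢ List.finRange m).filter fun p =>
    p.1 ≤ p.2 ∧ I p.1.castSucc p.2.succ).map fun p => tie u p.1 p.2).prod

end Basis

/-- The last strand lies in a block of `I` with at least two elements. -/
def LastInSupp {m : ℕ} (I : Setoid (Fin (m + 1))) : Prop :=
  ∃ x, x ≠ Fin.last m ∧ I x (Fin.last m)

/-- The partition of the first `m + 1` strands got by removing the last strand from `I`. -/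
def removeLast {m : ℕ} (I : Setoid (Fin (m + 2))) : Setoid (Fin (m + 1)) :=
  I.comap Fin.castSucc

/-- The partition `I` with the block of the strand numbered `k` (from `1`) and the block of the
last strand merged, and then the last strand removed. -/
def tau {m : ℕ} (k : ℕ) (I : Setoid (Fin (m + 2))) : Setoid (Fin (m + 1)) :=
  removeLast (I ⊔ Relation.EqvGen.setoid fun x y => (x : ℕ) + 1 = k ∧ y = Fin.last (m + 1))

section Traces

variable {L : Type*} [Field L] (u : L)

/-- `r` is the linear map from the algebra on `m + 2` strands to the algebra on `m + 1` strands
with the prescribed values on the basis `𝕋_{1,k_1} ⋯ 𝕋_{m+1,k_{m+1}} E_I`, where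
`0 ≤ k_j ≤ j`. -/
structure IsRelTrace (A B : L) (m : ℕ) (r : BT u (m + 1) →ₗ[L] BT u m) : Prop where
  notMem : ∀ (k : ℕ → ℕ) (I : Setoid (Fin (m + 2))), (∀ j, k j ≤ j) → k (m + 1) = 0 →
    ¬ LastInSupp I →
    r (word u (m + 1) k * partE u I) = word u m k * partE u (removeLast I)
  mem : ∀ (k : ℕ → ℕ) (I : Setoid (Fin (m + 2))), (∀ j, k j ≤ j) → k (m + 1) = 0 →
    LastInSupp I →
    r (word u (m + 1) k * partE u I) = B • (word u m k * partE u (removeLast I))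
  braid : ∀ (k : ℕ → ℕ) (I : Setoid (Fin (m + 2))), (∀ j, k j ≤ j) → k (m + 1) ≠ 0 →
    r (word u (m + 1) k * partE u I) =
      A • (word u m k * descT u m m (k (m + 1)) * partE u (tau (k (m + 1)) I))

variable {u}

/-- The composite of the maps `r`, from the algebra on `m + 1` strands down to the algebra on
one strand, which is `L`. -/
def composite (r : (m : ℕ) → BT u (m + 1) →ₗ[L] BT u m) : (m : ℕ) → BT u m →ₗ[L] L
  | 0 => (oneStrand u).toLinearMap
  | m + 1 => composite r m ∘ₗ r m

end Traces

end BraidsTies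

/-!
The trace property is proved for two consecutive relative traces at a time, and rests on a normal
form of the algebra. Everything uses only that `u ≠ 0`, so that the braid generators are invertible.

*Ties.* Moving an end of a tie by a braid generator conjugates the tie (`TieSystem.t_mul_pair`), so
every configuration of at most four strands can be conjugated to the first ones. Hence ties commute,
are idempotent and are transitive, the elements `E_I` satisfy `E_{I ⊔ J} = E_I E_J` (`partE_sup`),
and braid generators carry `E_I` to the `E` of the image partition (`T_mul_partE`).

*Basis.* With this calculus the span of the products `𝕋_{1,k_1} ⋯ 𝕋_{m,k_m} E_I` is closed under
right multiplication by the generators, so it is everything (`mem_span_word`). For each partition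
`J` of a set of labels the algebra acts on the arrangements of the labels (`action`): ties act as
projections according to `J`, and braid generators exchange labels, with a Hecke deformation on
labels that are tied. On the increasing arrangement, `E_I` is `1` or `0` according to `I ≤ J`, and
different words `𝕋_{1,k_1} ⋯ 𝕋_{m,k_m}` produce different arrangements; so the coefficients of a
linear relation have zero sums over `I ≤ J`, for all `J`, and vanish
(`linearIndependent_wordFamily`). This gives existence and uniqueness of the relative trace.

*Bimodule property.* The partitions that occur in the values of the relative trace `r` are images
of `I` under a map that identifies the last strand with another one (`tau_eq_map`,
`exists_removeLast_eq_map`). Images of partitions are compatible with the calculus of ties, and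
this makes `r` a map of bimodules over the smaller algebra (`IsRelTrace.incl_mul`,
`IsRelTrace.mul_incl`). In particular `r` is a retraction of the map of the tower, which is
therefore injective, and the last two properties of a Markov trace follow.

*Trace property.* It remains to see that two relative traces in succession do not distinguish `g Z`
from `Z g` for the last generators `g` (`IsRelTrace.comm_last`). The algebra is generated, as a
bimodule over the previous one, by `1`, `T`, `E`, `E T` with the last generators
(`BT_bimodule_induction`). Using this three times, one may assume that `Z = h y x h'`, where `y` is
one of these four elements, `h` and `h'` are such elements one step below, and `x` lies two steps
below. What remains are finitely many cases, which follow from the values of the relative trace on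
products with the last generators on both sides (`SandwichTable`, `exists_sandwich`).
-/

namespace BraidsTies

/-! ### Images of partitions -/

section Setoid

/-- The partition whose only block with more than one element is `{x, y}`. -/
def link {n : ℕ} (x y : Fin n) : Setoid (Fin n) :=
  Relation.EqvGen.setoid fun a b => a = x ∧ b = y

theorem link_le_iff {n : ℕ} {x y : Fin n} {I : Setoid (Fin n)} : link x y ≤ I ↔ I x y := by
  refine ⟨fun h => h (Relation.EqvGen.rel _ _ ⟨rfl, rfl⟩), fun h => ?_⟩
  refine Setoid.eqvGen_le ?_
  rintro a b ⟨rfl, rfl⟩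
  exact h

theorem setoidMap_le_iff {α β : Type*} {I : Setoid α} {f : α → β} {J : Setoid β} :
    I.map f ≤ J ↔ I ≤ J.comap f := by
  refine ⟨fun h => Setoid.le_comap_map.trans fun _ _ hxy => h hxy, fun h => ?_⟩
  refine Setoid.eqvGen_le ?_
  rintro _ _ ⟨a, b, hab, rfl, rfl⟩
  exact h hab

theorem setoidMap_rel {α β : Type*} {I : Setoid α} (f : α → β) {x y : α} (h : I x y) :
    I.map f (f x) (f y) :=
  setoidMap_le_iff.1 (le_refl (I.map f)) h

theorem setoidMap_sup {α β : Type*} (I J : Setoid α) (f : α → β) :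
    (I ⊔ J).map f = I.map f ⊔ J.map f := by
  refine le_antisymm (setoidMap_le_iff.2 (sup_le ?_ ?_)) (sup_le ?_ ?_)
  · exact setoidMap_le_iff.1 le_sup_left
  · exact setoidMap_le_iff.1 le_sup_right
  · exact setoidMap_le_iff.2 (le_sup_left.trans (setoidMap_le_iff.1 le_rfl))
  · exact setoidMap_le_iff.2 (le_sup_right.trans (setoidMap_le_iff.1 le_rfl))

theorem setoidMap_map {α β γ : Type*} (I : Setoid α) (f : α → β) (g : β → γ) :
    (I.map f).map g = I.map (g ∘ f) :=
  le_antisymm (setoidMap_le_iff.2 (setoidMap_le_iff.2 fun _ _ h => setoidMap_rel (g ∘ f) h))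
    (setoidMap_le_iff.2 fun _ _ h => setoidMap_rel g (setoidMap_rel f h))

theorem link_rel {n : ℕ} (x y : Fin n) : link x y x y := link_le_iff.1 le_rfl

theorem setoidMap_link {n k : ℕ} (x y : Fin n) (f : Fin n → Fin k) :
    (link x y).map f = link (f x) (f y) :=
  le_antisymm (setoidMap_le_iff.2 (link_le_iff.2 (link_rel (f x) (f y))))
    (link_le_iff.2 (setoidMap_rel f (link_rel x y)))

theorem setoidMap_id {α : Type*} (I : Setoid α) : I.map id = I :=
  le_antisymm (setoidMap_le_iff.2 le_rfl) (setoidMap_le_iff.1 (le_refl (I.map id)))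

end Setoid

/-! ### Ties of strands -/

section TieSystem

/-- Invertible `t i` and idempotents `e i` of a monoid, for `i < m`, that satisfy those relations
of the algebra of braids and ties that involve no sums, and the consequence `sq_comm` of the
quadratic relation. Indices are natural numbers, so that ties can be described by recursion. -/
structure TieSystem (R : Type*) [Monoid R] (m : ℕ) where
  t : ℕ → Rˣ
  e : ℕ → R
  t_far : ∀ i j, i + 1 < j → j < m → Commute (t i : R) (t j)
  braid : ∀ i, i + 1 < m → (t i : R) * t (i + 1) * t i = t (i + 1) * t i * t (i + 1)
  e_far : ∀ i j, i + 1 < j ∨ j + 1 < i → i < m → j < m → Commute (e i) (t j : R)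
  e_t : ∀ i, i < m → Commute (e i) (t i : R)
  e_sq : ∀ i, i < m → e i * e i = e i
  e_comm : ∀ i j, i < m → j < m → Commute (e i) (e j)
  sq_comm : ∀ i, i + 1 < m → Commute ((t i : R) * t i) (e (i + 1))
  e_tt : ∀ i, i + 1 < m → e (i + 1) * t i * t (i + 1) = t i * t (i + 1) * e i
  e_tt' : ∀ i, i + 1 < m → e i * t (i + 1) * t i = t (i + 1) * t i * e (i + 1)
  ee_t : ∀ i, i + 1 < m → e i * e (i + 1) * t i = t i * (e i * e (i + 1))

namespace TieSystem

variable {R : Type*} [Monoid R] {m : ℕ} (S : TieSystem R m)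

/-- The element that ties the strands `x` and `x + d + 1`. -/
def span : ℕ → ℕ → R
  | x, 0 => S.e x
  | x, d + 1 => S.t x * span (x + 1) d * ↑(S.t x)⁻¹

theorem span_succ (x d : ℕ) : S.span x (d + 1) = S.t x * S.span (x + 1) d * ↑(S.t x)⁻¹ := rfl

theorem t_mul_span (x d : ℕ) : S.t x * S.span (x + 1) d = S.span x (d + 1) * S.t x := by
  simp [span_succ]

theorem t_comm_of_far {i j : ℕ} (h : i + 1 < j ∨ j + 1 < i) (hi : i < m) (hj : j < m) :
    Commute (S.t i : R) (S.t j) := by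
  rcases h with h | h
  · exact S.t_far i j h hj
  · exact (S.t_far j i h hi).symm

theorem span_comm_of_far (d : ℕ) : ∀ x i, x + d < m → i < m → (i + 1 < x ∨ x + d + 1 < i) →
    Commute (S.span x d) (S.t i : R) := by
  induction d with
  | zero => intro x i hx hi h; exact S.e_far x i (by omega) hx hi
  | succ d ih =>
    intro x i hx hi h
    have h1 := ih (x + 1) i (by omega) hi (by omega)
    have h2 := S.t_comm_of_far (i := x) (j := i) (by omega) (by omega) hi
    rw [span_succ]
    exact (h2.mul_left h1).mul_left h2.units_inv_left

theorem sq_comm_span (d : ℕ) : ∀ x, x + 1 + d < m →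
    Commute ((S.t x : R) * S.t x) (S.span (x + 1) d) := by
  induction d with
  | zero => intro x hx; exact S.sq_comm x hx
  | succ d ih =>
    intro x hx
    have h1 := ih (x + 1) (by omega)
    have h2 := S.span_comm_of_far d (x + 2) x (by omega) (by omega) (by omega)
    have hb := S.braid x (by omega)
    have hb1 : (↑(S.t (x + 1))⁻¹ : R) * (S.t x * S.t x) * S.t (x + 1) =
        S.t x * (S.t (x + 1) * S.t (x + 1)) * ↑(S.t x)⁻¹ := by
      have hb2 : (S.t (x + 1))⁻¹ * (S.t x * S.t x) * S.t (x + 1) =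
        S.t x * (S.t (x + 1) * S.t (x + 1)) * (S.t x)⁻¹ := by
        have hb' : S.t x * S.t (x + 1) * S.t x = S.t (x + 1) * S.t x * S.t (x + 1) :=
          Units.ext hb
        have : (S.t (x + 1))⁻¹ * S.t x * S.t (x + 1) = S.t x * S.t (x + 1) * (S.t x)⁻¹ := by
          rw [eq_mul_inv_iff_mul_eq, mul_assoc, mul_assoc, inv_mul_eq_iff_eq_mul, ← mul_assoc,
            hb', mul_assoc]
        calc _ = ((S.t (x + 1))⁻¹ * S.t x * S.t (x + 1)) *
            ((S.t (x + 1))⁻¹ * S.t x * S.t (x + 1)) := by group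
          _ = _ := by rw [this]; group
      exact_mod_cast congrArg Units.val hb2
    have h3 : Commute ((↑(S.t (x + 1))⁻¹ : R) * (S.t x * S.t x) * S.t (x + 1))
        (S.span (x + 2) d) := by
      rw [hb1]
      exact (h2.symm.mul_left h1).mul_left h2.symm.units_inv_left
    rw [span_succ]
    have h4 := h3.eq
    calc _ = (S.t (x + 1) : R) * ((↑(S.t (x + 1))⁻¹ : R) * (S.t x * S.t x) * S.t (x + 1) *
          S.span (x + 2) d) * ↑(S.t (x + 1))⁻¹ := by
          simp [mul_assoc]
      _ = _ := by rw [h4]; simp [mul_assoc]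

/-- The squares `t x * t x` commute with ties, so moving an end of a tie by `t x` or
by its inverse has the same effect. -/
theorem t_mul_span_succ (x d : ℕ) (h : x + 1 + d < m) :
    S.t x * S.span x (d + 1) = S.span (x + 1) d * S.t x := by
  have := (S.sq_comm_span d x h).eq
  rw [span_succ, ← mul_assoc, ← mul_assoc, this]
  simp [mul_assoc]

/-- A tie commutes with the braid generators strictly between its ends. -/
theorem span_comm_inner (d : ℕ) : ∀ x i, x + d < m → x < i → i < x + d →
    Commute (S.span x d) (S.t i : R) := by
  induction d with
  | zero => intro x i hx hi h; omega
  | succ d ih =>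
    intro x i hx hi h
    rcases eq_or_ne i (x + 1) with rfl | hne
    · obtain ⟨d, rfl⟩ : ∃ d', d = d' + 1 := ⟨d - 1, by omega⟩
      have h2 := S.span_comm_of_far d (x + 2) x (by omega) (by omega) (by omega)
      have hb := S.braid x (by omega)
      have hb' : (↑(S.t (x + 1))⁻¹ : R) * ↑(S.t x)⁻¹ * S.t (x + 1) =
          S.t x * ↑(S.t (x + 1))⁻¹ * ↑(S.t x)⁻¹ := by
        have hb' : S.t x * S.t (x + 1) * S.t x = S.t (x + 1) * S.t x * S.t (x + 1) :=
          Units.ext hb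
        have : (S.t (x + 1))⁻¹ * (S.t x)⁻¹ * S.t (x + 1) =
            S.t x * (S.t (x + 1))⁻¹ * (S.t x)⁻¹ := by
          rw [eq_mul_inv_iff_mul_eq, eq_mul_inv_iff_mul_eq, mul_assoc, mul_assoc, ← mul_inv_rev,
            inv_mul_eq_iff_eq_mul, ← mul_assoc, ← hb', mul_assoc]
        exact_mod_cast congrArg Units.val this
      rw [span_succ, span_succ, Commute, SemiconjBy]
      calc _ = (S.t x : R) * S.t (x + 1) * S.span (x + 2) d *
            (↑(S.t (x + 1))⁻¹ * ↑(S.t x)⁻¹ * S.t (x + 1)) := by simp only [mul_assoc]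
        _ = (S.t x : R) * S.t (x + 1) * (S.span (x + 2) d * S.t x) *
            ↑(S.t (x + 1))⁻¹ * ↑(S.t x)⁻¹ := by rw [hb']; simp only [mul_assoc]
        _ = (S.t x * S.t (x + 1) * S.t x) * S.span (x + 2) d *
            ↑(S.t (x + 1))⁻¹ * ↑(S.t x)⁻¹ := by rw [h2.eq]; simp only [mul_assoc]
        _ = _ := by rw [hb]; simp only [mul_assoc]
    · have h1 := ih (x + 1) i (by omega) (by omega) (by omega)
      have h2 := S.t_comm_of_far (i := x) (j := i) (by omega) (by omega) (by omega)
      rw [span_succ]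
      exact (h2.mul_left h1).mul_left h2.units_inv_left

theorem t_mul_span_right (d : ℕ) : ∀ x, x + d + 1 < m →
    S.t (x + d + 1) * S.span x d = S.span x (d + 1) * S.t (x + d + 1) := by
  induction d with
  | zero =>
    intro x hx
    have h1 := S.e_tt x hx
    have h2 : (↑(S.t x)⁻¹ : R) * S.e (x + 1) * S.t x = S.t x * S.e (x + 1) * ↑(S.t x)⁻¹ := by
      have := S.t_mul_span_succ x 0 (by omega)
      change _ = S.e (x + 1) * S.t x at this
      rw [mul_assoc, ← this, Units.inv_mul_cancel_left]; rfl
    change (S.t (x + 1) : R) * S.e x = S.t x * S.e (x + 1) * ↑(S.t x)⁻¹ * S.t (x + 1)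
    rw [← h2, mul_assoc, mul_assoc, ← mul_assoc (S.e (x + 1)), h1, mul_assoc,
      Units.inv_mul_cancel_left]
  | succ d ih =>
    intro x hx
    have h1 := ih (x + 1) (by omega)
    have h2 := S.t_comm_of_far (i := x) (j := x + (d + 1) + 1) (by omega) (by omega) (by omega)
    rw [show x + 1 + d + 1 = x + (d + 1) + 1 by omega] at h1
    rw [span_succ, span_succ (d := d + 1), ← mul_assoc, ← mul_assoc, ← h2.eq,
      mul_assoc (S.t x : R), h1, mul_assoc, mul_assoc, mul_assoc, mul_assoc,
      h2.symm.units_inv_right.eq]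

theorem t_mul_span_left (d : ℕ) : ∀ x, x + d + 1 < m →
    S.t (x + d + 1) * S.span x (d + 1) = S.span x d * S.t (x + d + 1) := by
  induction d with
  | zero =>
    intro x hx
    have h1 := S.e_tt' x hx
    change (S.t (x + 1) : R) * (S.t x * S.e (x + 1) * ↑(S.t x)⁻¹) = S.e x * S.t (x + 1)
    rw [← mul_assoc, ← mul_assoc, ← h1, Units.mul_inv_cancel_right]
  | succ d ih =>
    intro x hx
    have h1 := ih (x + 1) (by omega)
    have h2 := S.t_comm_of_far (i := x) (j := x + (d + 1) + 1) (by omega) (by omega) (by omega)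
    rw [show x + 1 + d + 1 = x + (d + 1) + 1 by omega] at h1
    rw [span_succ (d := d), span_succ (d := d + 1), ← mul_assoc, ← mul_assoc, ← h2.eq,
      mul_assoc (S.t x : R), h1, mul_assoc, mul_assoc, mul_assoc, mul_assoc,
      h2.symm.units_inv_right.eq]

/-- The element that ties the strands `x` and `y`; it is `1` if they are equal. -/
def pair (x y : Fin (m + 1)) : R :=
  if (x : ℕ) < y then S.span x (y - x - 1) else if (y : ℕ) < x then S.span y (x - y - 1) else 1

theorem pair_self (x : Fin (m + 1)) : S.pair x x = 1 := by simp [pair]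

theorem pair_symm (x y : Fin (m + 1)) : S.pair x y = S.pair y x := by
  unfold pair; split_ifs <;> first | rfl | omega

theorem pair_of_add {x y : Fin (m + 1)} (d : ℕ) (h : (y : ℕ) = x + d + 1) :
    S.pair x y = S.span x d := by
  rw [pair, if_pos (by omega)]; congr 1; omega

theorem pair_castSucc_succ (i : Fin m) : S.pair i.castSucc i.succ = S.e i :=
  S.pair_of_add 0 (by simp)

theorem val_swap (i : Fin m) (x : Fin (m + 1)) :
    (Equiv.swap i.castSucc i.succ x : ℕ) =
      if (x : ℕ) = i then (i : ℕ) + 1 else if (x : ℕ) = i + 1 then (i : ℕ) else x := by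
  simp only [Equiv.swap_apply_def, Fin.ext_iff]
  split_ifs <;> simp_all

/-- Conjugation by `t i` moves the ends of ties by the transposition of `i` and `i + 1`. -/
theorem t_mul_pair (i : Fin m) (x y : Fin (m + 1)) :
    S.t i * S.pair x y =
      S.pair (Equiv.swap i.castSucc i.succ x) (Equiv.swap i.castSucc i.succ y) * S.t i := by
  wlog h : (x : ℕ) < y generalizing x y
  · rcases eq_or_ne x y with rfl | hne
    · simp [pair_self]
    · rw [S.pair_symm x y, S.pair_symm _ (Equiv.swap i.castSucc i.succ y)]
      exact this y x (by have := Fin.val_ne_of_ne hne; omega)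
  have hx := val_swap i x
  have hy := val_swap i y
  set x' := Equiv.swap i.castSucc i.succ x
  set y' := Equiv.swap i.castSucc i.succ y
  have hi := i.isLt
  have hym := y.isLt
  obtain ⟨d, hd⟩ : ∃ d, (y : ℕ) = x + d + 1 := ⟨y - x - 1, by omega⟩
  rw [S.pair_of_add d hd]
  have hfix : (x' : ℕ) = x → (y' : ℕ) = y → Commute (S.span x d) (S.t i : R) →
      S.t i * S.span x d = S.pair x' y' * S.t i := by
    intro h1 h2 hc
    rw [S.pair_of_add d (by omega), h1, hc.eq]
  by_cases c1 : (i : ℕ) + 1 < x ∨ (y : ℕ) < i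
  · refine hfix (by split_ifs at hx <;> omega) (by split_ifs at hy <;> omega)
      (S.span_comm_of_far d x i (by omega) hi (by omega))
  by_cases c2 : (x : ℕ) < i ∧ (i : ℕ) + 1 < y
  · refine hfix (by split_ifs at hx <;> omega) (by split_ifs at hy <;> omega)
      (S.span_comm_inner d x i (by omega) (by omega) (by omega))
  by_cases c3 : (i : ℕ) + 1 = x
  · rw [S.pair_of_add (d + 1) (by split_ifs at hx hy <;> omega),
      show (x' : ℕ) = i by split_ifs at hx <;> omega, ← c3]
    exact S.t_mul_span i d
  by_cases c4 : (y : ℕ) = i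
  · rw [S.pair_of_add (d + 1) (by split_ifs at hx hy <;> omega),
      show (x' : ℕ) = x by split_ifs at hx <;> omega, show (i : ℕ) = x + d + 1 by omega]
    exact S.t_mul_span_right d x (by omega)
  by_cases c5 : (x : ℕ) = i
  · rcases Nat.eq_zero_or_pos d with rfl | hdpos
    · rw [S.pair_symm, S.pair_of_add 0 (by split_ifs at hx hy <;> omega),
        show (y' : ℕ) = x by split_ifs at hy <;> omega, c5]
      exact (S.e_t i hi).eq.symm
    · obtain ⟨d, rfl⟩ : ∃ d', d = d' + 1 := ⟨d - 1, by omega⟩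
      rw [S.pair_of_add d (by split_ifs at hx hy <;> omega),
        show (x' : ℕ) = x + 1 by (split_ifs at hx; omega), ← c5]
      exact S.t_mul_span_succ x d (by omega)
  · obtain ⟨d, rfl⟩ : ∃ d', d = d' + 1 := ⟨d - 1, by omega⟩
    rw [S.pair_of_add d (by split_ifs at hx hy <;> omega),
      show (x' : ℕ) = x by split_ifs at hx <;> omega, show (i : ℕ) = x + d + 1 by omega]
    exact S.t_mul_span_left d x (by omega)

/-- The braid group acts on ties through the symmetric group, which is generated by the
transpositions of neighbours. -/
theorem exists_conj (σ : Equiv.Perm (Fin (m + 1))) :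
    ∃ g : Rˣ, ∀ x y, g * S.pair x y = S.pair (σ x) (σ y) * g := by
  have h : σ ∈ Submonoid.closure
      (Set.range fun i : Fin m => Equiv.swap i.castSucc i.succ) := by
    rw [Equiv.Perm.mclosure_swap_castSucc_succ]; trivial
  induction h using Submonoid.closure_induction with
  | mem τ h => obtain ⟨i, rfl⟩ := h; exact ⟨S.t i, S.t_mul_pair i⟩
  | one => exact ⟨1, by simp⟩
  | mul σ τ _ _ h1 h2 =>
    obtain ⟨g, hg⟩ := h1
    obtain ⟨k, hk⟩ := h2
    exact ⟨g * k, fun x y => by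
      rw [Units.val_mul, mul_assoc, hk, ← mul_assoc, hg, mul_assoc]; rfl⟩

/-- Ties among finitely many strands are simultaneously conjugate to ties among the first strands.
-/
theorem exists_conj_castLE {k : ℕ} (f : Fin k → Fin (m + 1)) (hf : Function.Injective f) :
    ∃ hk : k ≤ m + 1, ∃ g : Rˣ, ∀ i j, S.pair (f i) (f j) =
      ↑g⁻¹ * S.pair (Fin.castLE hk i) (Fin.castLE hk j) * g := by
  have hk : k ≤ m + 1 := by simpa using Fintype.card_le_of_injective f hf
  obtain ⟨σ, hσ⟩ := Equiv.Perm.exists_extending_pair f (Fin.castLE hk) hf (Fin.castLE_injective hk)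
  obtain ⟨g, hg⟩ := S.exists_conj σ
  refine ⟨hk, g, fun i j => ?_⟩
  rw [mul_assoc, ← hσ, ← hσ, ← hg, Units.inv_mul_cancel_left]

theorem commute_conj {g : Rˣ} {a b : R} (h : Commute a b) :
    Commute (↑g⁻¹ * a * g) (↑g⁻¹ * b * g) := by
  have := h.eq
  rw [Commute, SemiconjBy]
  simp only [mul_assoc, Units.mul_inv_cancel_left]
  rw [← mul_assoc a, this, mul_assoc]

theorem pair_comm_of_inj {x y z : Fin (m + 1)} (hxy : x ≠ y) (hyz : y ≠ z) (hxz : x ≠ z) :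
    Commute (S.pair x y) (S.pair y z) := by
  have hf : Function.Injective ![x, y, z] := by
    intro i j h; fin_cases i <;> fin_cases j <;> simp_all
  obtain ⟨hk, g, hg⟩ := S.exists_conj_castLE _ hf
  have h1 := hg 0 1
  have h2 := hg 1 2
  change S.pair x y = _ at h1
  change S.pair y z = _ at h2
  rw [S.pair_of_add (x := Fin.castLE hk _) 0 (by simp)] at h1 h2
  rw [h1, h2]
  exact commute_conj (S.e_comm 0 1 (by omega) (by omega))

theorem pair_comm (x y z w : Fin (m + 1)) : Commute (S.pair x y) (S.pair z w) := by
  rcases eq_or_ne x y with rfl | hxy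
  · rw [S.pair_self]; exact Commute.one_left _
  rcases eq_or_ne z w with rfl | hzw
  · rw [S.pair_self]; exact Commute.one_right _
  have key : ∀ x y z : Fin (m + 1), x ≠ y → y ≠ z → Commute (S.pair x y) (S.pair y z) := by
    intro x y z hxy hyz
    rcases eq_or_ne x z with rfl | hxz
    · rw [S.pair_symm]
    · exact S.pair_comm_of_inj hxy hyz hxz
  rcases eq_or_ne y z with rfl | hyz
  · exact key x y w hxy hzw
  rcases eq_or_ne y w with rfl | hyw
  · rw [S.pair_symm z y]; exact key x y z hxy hyz
  rcases eq_or_ne x z with rfl | hxz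
  · rw [S.pair_symm x y]; exact key y x w hxy.symm hzw
  rcases eq_or_ne x w with rfl | hxw
  · rw [S.pair_symm x y, S.pair_symm z x]; exact key y x z hxy.symm hzw.symm
  have hf : Function.Injective ![x, y, z, w] := by
    intro i j h; fin_cases i <;> fin_cases j <;> simp_all
  obtain ⟨hk, g, hg⟩ := S.exists_conj_castLE _ hf
  have h1 := hg 0 1
  have h2 := hg 2 3
  change S.pair x y = _ at h1
  change S.pair z w = _ at h2
  rw [S.pair_of_add (x := Fin.castLE hk _) 0 (by simp)] at h1 h2
  rw [h1, h2]
  exact commute_conj (S.e_comm 0 2 (by omega) (by omega))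

theorem pair_sq (x y : Fin (m + 1)) : S.pair x y * S.pair x y = S.pair x y := by
  rcases eq_or_ne x y with rfl | hxy
  · rw [S.pair_self, one_mul]
  have hf : Function.Injective ![x, y] := by
    intro i j h; fin_cases i <;> fin_cases j <;> simp_all
  obtain ⟨hk, g, hg⟩ := S.exists_conj_castLE _ hf
  have h1 := hg 0 1
  change S.pair x y = _ at h1
  rw [S.pair_of_add (x := Fin.castLE hk _) 0 (by simp)] at h1
  change S.pair x y = ↑g⁻¹ * S.e 0 * g at h1
  rw [h1]
  simp only [mul_assoc, Units.mul_inv_cancel_left]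
  rw [← mul_assoc (S.e 0), S.e_sq 0 (by omega)]

/-- Tying `x` to `y` and `y` to `z` also ties `x` to `z`. -/
theorem pair_trans (x y z : Fin (m + 1)) :
    S.pair x y * S.pair y z * S.pair x z = S.pair x y * S.pair y z := by
  rcases eq_or_ne x y with rfl | hxy
  · rw [mul_assoc, S.pair_sq]
  rcases eq_or_ne y z with rfl | hyz
  · rw [S.pair_self, mul_one, S.pair_sq]
  rcases eq_or_ne x z with rfl | hxz
  · rw [S.pair_self, mul_one]
  have hf : Function.Injective ![x, y, z] := by
    intro i j h; fin_cases i <;> fin_cases j <;> simp_all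
  obtain ⟨hk, g, hg⟩ := S.exists_conj_castLE _ hf
  have h1 := hg 0 1
  have h2 := hg 1 2
  have h3 := hg 0 2
  change S.pair x y = _ at h1
  change S.pair y z = _ at h2
  change S.pair x z = _ at h3
  rw [S.pair_of_add (x := Fin.castLE hk _) 0 (by simp)] at h1 h2
  rw [S.pair_of_add (x := Fin.castLE hk _) 1 (by simp)] at h3
  change S.pair x y = ↑g⁻¹ * S.e 0 * g at h1
  change S.pair y z = ↑g⁻¹ * S.e 1 * g at h2
  change S.pair x z = ↑g⁻¹ * (S.t 0 * S.e 1 * ↑(S.t 0)⁻¹) * g at h3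
  have h4 : S.e 0 * S.e 1 * (S.t 0 * S.e 1 * ↑(S.t 0)⁻¹) = S.e 0 * S.e 1 := by
    have h := S.ee_t 0 (by omega)
    rw [zero_add] at h
    rw [← mul_assoc, ← mul_assoc, h, mul_assoc (S.t 0 : R), mul_assoc (S.e 0),
      S.e_sq 1 (by omega), ← h, Units.mul_inv_cancel_right]
  rw [h1, h2, h3]
  simp only [mul_assoc, Units.mul_inv_cancel_left]
  simp only [mul_assoc] at h4
  have h5 := congrArg (fun z : R => ↑g⁻¹ * (z * g)) h4
  simpa only [mul_assoc] using h5

/-- The strands that `Y` does not distinguish: those whose ties are absorbed by `Y`. -/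
def stab (Y : R) : Setoid (Fin (m + 1)) where
  r x y := Y * S.pair x y = Y
  iseqv := by
    refine ⟨fun x => by rw [S.pair_self, mul_one], fun {x y} h => by rw [S.pair_symm, h], ?_⟩
    intro x y z h1 h2
    have h3 := congrArg (Y * ·) (S.pair_trans x y z)
    simp only [← mul_assoc, h1, h2] at h3
    exact h3

open Classical in
/-- The product of the ties of the pairs `a ≤ b` of indices for which the strands `a` and `b + 1`
are in one block of `I`. -/
noncomputable def part (I : Setoid (Fin (m + 1))) : R :=
  (((List.finRange m ×ˢ List.finRange m).filter fun p =>
    p.1 ≤ p.2 ∧ I p.1.castSucc p.2.succ).map fun p => S.pair p.1.castSucc p.2.succ).prod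

theorem mul_list_prod_of_absorb {ι : Type*} (f : ι → R) (Y : R) (l : List ι)
    (h : ∀ a ∈ l, Y * f a = Y) : Y * (l.map f).prod = Y := by
  induction l with
  | nil => simp
  | cons a l ih =>
    rw [List.map_cons, List.prod_cons, ← mul_assoc, h a (by simp),
      ih fun b hb => h b (by simp [hb])]

theorem list_prod_mul_of_absorb {ι : Type*} (f : ι → R) (Y : R) (l : List ι)
    (h : ∀ a ∈ l, f a * Y = Y) : (l.map f).prod * Y = Y := by
  induction l with
  | nil => simp
  | cons a l ih =>
    rw [List.map_cons, List.prod_cons, mul_assoc, ih fun b hb => h b (by simp [hb]),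
      h a (by simp)]

theorem mul_part_of_absorb (I : Setoid (Fin (m + 1))) (Y : R)
    (h : ∀ x y, I x y → Y * S.pair x y = Y) : Y * S.part I = Y := by
  classical
  refine mul_list_prod_of_absorb _ _ _ fun p hp => ?_
  simp only [List.mem_filter, decide_eq_true_eq] at hp
  exact h _ _ hp.2.2

theorem part_mul_of_absorb (I : Setoid (Fin (m + 1))) (Y : R)
    (h : ∀ x y, I x y → S.pair x y * Y = Y) : S.part I * Y = Y := by
  classical
  refine list_prod_mul_of_absorb _ _ _ fun p hp => ?_
  simp only [List.mem_filter, decide_eq_true_eq] at hp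
  exact h _ _ hp.2.2

theorem pair_comm_part (x y : Fin (m + 1)) (I : Setoid (Fin (m + 1))) :
    Commute (S.pair x y) (S.part I) := by
  refine Commute.list_prod_right _ _ fun a ha => ?_
  obtain ⟨p, _, rfl⟩ := List.mem_map.1 ha
  exact S.pair_comm _ _ _ _

theorem part_comm (I J : Setoid (Fin (m + 1))) : Commute (S.part I) (S.part J) := by
  refine Commute.list_prod_left _ _ fun a ha => ?_
  obtain ⟨p, _, rfl⟩ := List.mem_map.1 ha
  exact S.pair_comm_part _ _ _

theorem part_mul_pair {I : Setoid (Fin (m + 1))} {x y : Fin (m + 1)} (h : I x y) :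
    S.part I * S.pair x y = S.part I := by
  classical
  wlog hlt : x < y generalizing x y
  · rcases eq_or_ne x y with rfl | hne
    · rw [S.pair_self, mul_one]
    · rw [S.pair_symm]; exact this (I.symm h) (lt_of_le_of_ne (not_lt.1 hlt) hne.symm)
  obtain ⟨a, rfl⟩ : ∃ a : Fin m, a.castSucc = x :=
    ⟨⟨x, by have := y.isLt; have : (x : ℕ) < y := hlt; omega⟩, rfl⟩
  obtain ⟨b, rfl⟩ : ∃ b : Fin m, b.succ = y :=
    ⟨⟨y - 1, by have := y.isLt; have : (a : ℕ) < y := hlt; omega⟩, by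
      have : (a : ℕ) < y := hlt
      ext; simp; omega⟩
  have hab : a ≤ b := by
    have : (a : ℕ) < b + 1 := by simpa using hlt
    exact Fin.le_def.2 (by omega)
  have hmem : (a, b) ∈ (List.finRange m ×ˢ List.finRange m).filter fun p =>
      p.1 ≤ p.2 ∧ I p.1.castSucc p.2.succ := by
    simp [List.mem_filter, hab, h]
  obtain ⟨l1, l2, hl⟩ := List.append_of_mem hmem
  have hc : Commute (S.pair a.castSucc b.succ)
      (l2.map fun p => S.pair p.1.castSucc p.2.succ).prod := by
    refine Commute.list_prod_right _ _ fun c hc => ?_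
    obtain ⟨p, _, rfl⟩ := List.mem_map.1 hc
    exact S.pair_comm _ _ _ _
  rw [part, hl, List.map_append, List.map_cons, List.prod_append, List.prod_cons,
    mul_assoc, mul_assoc, ← hc.eq, ← mul_assoc (S.pair _ _), S.pair_sq]

theorem pair_mul_part {I : Setoid (Fin (m + 1))} {x y : Fin (m + 1)} (h : I x y) :
    S.pair x y * S.part I = S.part I := by
  rw [(S.pair_comm_part x y I).eq, S.part_mul_pair h]

theorem le_stab_part (I : Setoid (Fin (m + 1))) : I ≤ S.stab (S.part I) :=
  fun _ _ h => S.part_mul_pair h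

/-- The element `E_I` is absorbed by `Y` as soon as its ties are. With `le_stab_part`, this
characterizes `E_I` without reference to the order of its factors. -/
theorem mul_part_of_le_stab {I : Setoid (Fin (m + 1))} {Y : R} (h : I ≤ S.stab Y) :
    Y * S.part I = Y :=
  S.mul_part_of_absorb I Y fun _ _ hxy => h hxy

/-- The product of `E_I` and `E_J` absorbs the ties of `I` and of `J`, hence those of `I ⊔ J`. -/
theorem part_sup (I J : Setoid (Fin (m + 1))) : S.part (I ⊔ J) = S.part I * S.part J := by
  have h1 : S.part (I ⊔ J) * (S.part I * S.part J) = S.part (I ⊔ J) := by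
    rw [← mul_assoc, S.mul_part_of_le_stab (le_sup_left.trans (S.le_stab_part _)),
      S.mul_part_of_le_stab (le_sup_right.trans (S.le_stab_part _))]
  have h2 : S.part I * S.part J * S.part (I ⊔ J) = S.part I * S.part J := by
    refine S.mul_part_of_le_stab (sup_le (fun x y h => ?_) fun x y h => ?_)
    · rw [(S.part_comm I J).eq]
      change _ * _ * _ = _
      rw [mul_assoc, S.part_mul_pair h]
    · change _ * _ * _ = _
      rw [mul_assoc, S.part_mul_pair h]
  rw [← h1, ((S.part_comm (I ⊔ J) I).mul_right (S.part_comm (I ⊔ J) J)).eq, h2]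

theorem part_bot : S.part (⊥ : Setoid (Fin (m + 1))) = 1 := by
  have := S.mul_part_of_le_stab (I := ⊥) (Y := 1) bot_le
  rwa [one_mul] at this

theorem part_link (x y : Fin (m + 1)) : S.part (link x y) = S.pair x y := by
  have h1 : S.pair x y * S.part (link x y) = S.pair x y :=
    S.mul_part_of_le_stab (link_le_iff.2 (S.pair_sq x y))
  rw [← S.pair_mul_part (link_le_iff.1 le_rfl), h1]

/-- If `Y` carries ties to ties along `f`, it carries the product of the ties of a partition to
that of the image partition. -/
theorem part_map_of_semiconj {R' : Type*} [Monoid R'] {m' : ℕ} (S' : TieSystem R' m')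
    (φ : R →* R') (f : Fin (m + 1) → Fin (m' + 1)) (Y : R')
    (h : ∀ x y, Y * φ (S.pair x y) = S'.pair (f x) (f y) * Y) (I : Setoid (Fin (m + 1))) :
    Y * φ (S.part I) = S'.part (I.map f) * Y := by
  have h1 : ∀ x y, I.map f x y → S'.pair x y * (Y * φ (S.part I)) = Y * φ (S.part I) := by
    have : I.map f ≤ (show Setoid (Fin (m' + 1)) from
        { r := fun x y => S'.pair x y * (Y * φ (S.part I)) = Y * φ (S.part I)
          iseqv := by
            refine ⟨fun x => by rw [S'.pair_self, one_mul],
              fun {x y} h => by rw [S'.pair_symm, h], ?_⟩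
            intro x y z h1 h2
            have h3 : S'.pair x y * S'.pair y z * S'.pair x z * (Y * φ (S.part I)) = _ :=
              congrArg (· * (Y * φ (S.part I))) (S'.pair_trans x y z)
            beta_reduce at h3
            rw [((S'.pair_comm x y x z).mul_left (S'.pair_comm y z x z)).eq] at h3
            rwa [mul_assoc, mul_assoc, h2, h1] at h3 }) := by
      refine setoidMap_le_iff.2 fun x y hxy => ?_
      change S'.pair (f x) (f y) * (Y * φ (S.part I)) = Y * φ (S.part I)
      rw [← mul_assoc, ← h, mul_assoc, ← map_mul, S.pair_mul_part hxy]
    exact fun x y hxy => this hxy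
  have h2 : ∀ x y, I x y →
      S'.part (I.map f) * Y * φ (S.pair x y) = S'.part (I.map f) * Y := by
    intro x y hxy
    rw [mul_assoc, h, ← mul_assoc, S'.part_mul_pair (setoidMap_le_iff.1 (le_refl (I.map f)) hxy)]
  have h3 := S'.part_mul_of_absorb _ _ h1
  have h4 : S'.part (I.map f) * Y * φ (S.part I) = S'.part (I.map f) * Y := by
    classical
    change S'.part (I.map f) * Y * φ (List.prod _) = _
    rw [map_list_prod, List.map_map]
    refine mul_list_prod_of_absorb _ _ _ fun p hp => ?_
    simp only [List.mem_filter, decide_eq_true_eq] at hp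
    exact h2 _ _ hp.2.2
  rw [← h3, ← mul_assoc, h4]

theorem t_mul_part (i : Fin m) (I : Setoid (Fin (m + 1))) :
    S.t i * S.part I = S.part (I.map (Equiv.swap i.castSucc i.succ)) * S.t i :=
  S.part_map_of_semiconj S (MonoidHom.id R) _ _ (S.t_mul_pair i) I

theorem part_mul_t (i : Fin m) (I : Setoid (Fin (m + 1))) :
    S.part I * S.t i = S.t i * S.part (I.map (Equiv.swap i.castSucc i.succ)) := by
  rw [t_mul_part, setoidMap_map]
  have : (Equiv.swap i.castSucc i.succ : Fin (m + 1) → Fin (m + 1)) ∘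
      Equiv.swap i.castSucc i.succ = id := by ext x; simp
  rw [this, setoidMap_id]

end TieSystem
end TieSystem

/-! ### The ties of the algebra of braids and ties -/

section Relations

variable {L : Type*} [Field L] (u : L) {m : ℕ}

theorem T_comm_of_far {i j : Fin m} (h : (i : ℕ) + 1 < j) : T u i * T u j = T u j * T u i := by
  simpa [T, E] using RingQuot.mkAlgHom_rel L (Rel.TT_far (u := u) i j
    (by rw [lt_abs]; right; omega))

theorem T_braid {i j : Fin m} (h : (i : ℕ) + 1 = j) :
    T u i * T u j * T u i = T u j * T u i * T u j := by
  simpa [T, E] using RingQuot.mkAlgHom_rel L (Rel.TTT (u := u) i j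
    (by rw [← h]; simp))

theorem E_comm (i j : Fin m) : E u i * E u j = E u j * E u i := by
  simpa [T, E] using RingQuot.mkAlgHom_rel L (Rel.EE (u := u) i j)

theorem ET_comm_of_far {i j : Fin m} (h : (i : ℕ) + 1 < j ∨ (j : ℕ) + 1 < i) :
    E u i * T u j = T u j * E u i := by
  simpa [T, E] using RingQuot.mkAlgHom_rel L (Rel.ET_far (u := u) i j
    (by rw [lt_abs]; omega))

theorem abs_sub_eq_one {i j : ℕ} (h : i + 1 = j ∨ j + 1 = i) : |(i : ℤ) - (j : ℤ)| = 1 := by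
  rcases h with rfl | rfl <;> simp

theorem EET {i j : Fin m} (h : (i : ℕ) + 1 = j ∨ (j : ℕ) + 1 = i) :
    E u i * E u j * T u i = T u i * E u i * E u j := by
  simpa [T, E] using RingQuot.mkAlgHom_rel L (Rel.EET (u := u) i j (abs_sub_eq_one h))

theorem TEE {i j : Fin m} (h : (i : ℕ) + 1 = j ∨ (j : ℕ) + 1 = i) :
    T u i * E u i * E u j = E u j * T u i * E u j := by
  simpa [T, E] using RingQuot.mkAlgHom_rel L (Rel.TEE (u := u) i j (abs_sub_eq_one h))

theorem ETT {i j : Fin m} (h : (i : ℕ) + 1 = j ∨ (j : ℕ) + 1 = i) :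
    E u i * T u j * T u i = T u j * T u i * E u j := by
  simpa [T, E] using RingQuot.mkAlgHom_rel L (Rel.ETT (u := u) i j (abs_sub_eq_one h))

theorem T_sq_comm_E {i j : Fin m} (h : (i : ℕ) + 1 = j ∨ (j : ℕ) + 1 = i) :
    T u i * T u i * E u j = E u j * (T u i * T u i) := by
  have h3 : E u i * T u i * E u j = E u j * (E u i * T u i) := by
    rw [← mul_assoc, ← E_comm u i j, EET u h, ET]
  rw [T_sq]
  simp only [mul_add, add_mul, mul_one, one_mul, smul_mul_assoc, mul_smul_comm, h3, E_comm u i j]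

variable {u}

/-- The braid generators as units, with index a natural number; out of range they are `1`. -/
def unitT (hu : u ≠ 0) (m i : ℕ) : (BT u m)ˣ :=
  if h : i < m then ⟨T u ⟨i, h⟩, Tinv u ⟨i, h⟩, T_mul_Tinv u hu _, Tinv_mul_T u hu _⟩ else 1

theorem val_unitT (hu : u ≠ 0) {i : ℕ} (h : i < m) :
    (unitT hu m i : BT u m) = T u ⟨i, h⟩ := by simp [unitT, h]

theorem val_inv_unitT (hu : u ≠ 0) {i : ℕ} (h : i < m) :
    (↑(unitT hu m i)⁻¹ : BT u m) = Tinv u ⟨i, h⟩ := by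
  simp [unitT, h]

variable (u) in
/-- The tie generators with index a natural number; out of range they are `1`. -/
def natE (m i : ℕ) : BT u m := if h : i < m then E u ⟨i, h⟩ else 1

theorem natE_eq {i : ℕ} (h : i < m) : natE u m i = E u ⟨i, h⟩ := by simp [natE, h]

/-- The ties of the algebra of braids and ties. -/
def ties (hu : u ≠ 0) (m : ℕ) : TieSystem (BT u m) m where
  t := unitT hu m
  e := natE u m
  t_far i j h hj := by
    rw [val_unitT hu hj, val_unitT hu (by omega)]
    exact T_comm_of_far u h
  braid i h := by
    rw [val_unitT hu h, val_unitT hu (by omega)]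
    exact T_braid u rfl
  e_far i j h hi hj := by
    rw [natE_eq hi, val_unitT hu hj]
    exact ET_comm_of_far u h
  e_t i hi := by
    rw [natE_eq hi, val_unitT hu hi]
    exact ET u _
  e_sq i hi := by rw [natE_eq hi, E_sq]
  e_comm i j hi hj := by rw [natE_eq hi, natE_eq hj]; exact E_comm u _ _
  sq_comm i h := by
    rw [natE_eq h, val_unitT hu (by omega)]
    exact T_sq_comm_E u (Or.inl rfl)
  e_tt i h := by
    rw [natE_eq h, natE_eq (by omega : i < m), val_unitT hu h, val_unitT hu (by omega)]
    exact ETT u (Or.inr rfl)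
  e_tt' i h := by
    rw [natE_eq h, natE_eq (by omega : i < m), val_unitT hu h, val_unitT hu (by omega)]
    exact ETT u (Or.inl rfl)
  ee_t i h := by
    rw [natE_eq h, natE_eq (by omega : i < m), val_unitT hu (by omega), EET u (Or.inl rfl),
      mul_assoc]

theorem ties_t (hu : u ≠ 0) (i : Fin m) : ((ties hu m).t i : BT u m) = T u i :=
  val_unitT hu i.isLt

theorem ties_e (hu : u ≠ 0) (i : Fin m) : (ties hu m).e i = E u i := natE_eq i.isLt

end Relations

section Lists

variable {m : ℕ}

/-- The elements of `Fin m` from `a` to `b - 1`, in increasing order. -/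
def seg (m a b : ℕ) : List (Fin m) := (List.finRange m).filter fun i => a ≤ i.val ∧ i.val < b

theorem mem_seg {a b : ℕ} {i : Fin m} : i ∈ seg m a b ↔ a ≤ i.val ∧ i.val < b := by
  simp [seg]

theorem sortedLT_seg (a b : ℕ) : (seg m a b).SortedLT :=
  ((List.sortedLT_finRange m).pairwise.filter _).sortedLT

theorem seg_cons {a b : ℕ} (h : a < b) (ha : a < m) : seg m a b = ⟨a, ha⟩ :: seg m (a + 1) b := by
  refine (sortedLT_seg a b).eq_of_mem_iff ?_ ?_
  · refine List.Pairwise.sortedLT (List.pairwise_cons.2 ⟨fun i hi => ?_, (sortedLT_seg _ _).pairwise⟩)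
    have := mem_seg.1 hi
    exact Fin.lt_def.2 (by simp; omega)
  · intro i
    simp only [mem_seg, List.mem_cons, Fin.ext_iff]
    omega

theorem seg_concat {a b : ℕ} (h : a ≤ b) (hb : b < m) :
    seg m a (b + 1) = seg m a b ++ [⟨b, hb⟩] := by
  refine (sortedLT_seg a _).eq_of_mem_iff ?_ ?_
  · refine List.Pairwise.sortedLT (List.pairwise_append.2
      ⟨(sortedLT_seg _ _).pairwise, by simp, fun i hi j hj => ?_⟩)
    have := mem_seg.1 hi
    rw [List.mem_singleton] at hj
    subst hj
    exact Fin.lt_def.2 (by simp; omega)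
  · intro i
    simp only [mem_seg, List.mem_append, List.mem_singleton, Fin.ext_iff]
    omega

theorem seg_nil {a b : ℕ} (h : b ≤ a) : seg m a b = [] := by
  rw [List.eq_nil_iff_forall_not_mem]
  intro i hi
  have := mem_seg.1 hi
  omega

end Lists

section Partitions

variable {L : Type*} [Field L] {u : L} {m : ℕ}

theorem tie_eq_span (hu : u ≠ 0) (d : ℕ) : ∀ (a b : Fin m), (b : ℕ) = a + d →
    tie u a b = (ties hu m).span a d := by
  have hseg : ∀ a b : Fin m, ((List.finRange m).filter fun i => a ≤ i ∧ i < b) = seg m a b :=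
    fun a b => rfl
  induction d with
  | zero =>
    intro a b h
    obtain rfl : b = a := Fin.ext h
    rw [tie, hseg, seg_nil le_rfl]
    simp only [List.map_nil, List.prod_nil, List.reverse_nil, one_mul, mul_one]
    exact (ties_e hu b).symm
  | succ d ih =>
    intro a b h
    have hb := b.isLt
    have h1 := ih ⟨a + 1, by omega⟩ b (by simp; omega)
    rw [TieSystem.span_succ, ← h1, tie, tie, hseg, hseg, seg_cons (by omega) a.isLt]
    simp only [List.map_cons, List.prod_cons, List.reverse_cons, List.map_append, List.map_nil,
      List.prod_append, List.prod_nil, mul_one, mul_assoc]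
    rw [ties_t]
    congr
    exact (val_inv_unitT hu a.isLt).symm

theorem tie_eq_pair (hu : u ≠ 0) {a b : Fin m} (h : a ≤ b) :
    tie u a b = (ties hu m).pair a.castSucc b.succ := by
  have : (a : ℕ) ≤ b := h
  rw [tie_eq_span hu (b - a) a b (by omega), (ties hu m).pair_of_add (b - a) (by simp; omega)]
  rfl

theorem partE_eq_part (hu : u ≠ 0) (I : Setoid (Fin (m + 1))) :
    partE u I = (ties hu m).part I := by
  rw [partE, TieSystem.part]
  congr 1
  refine List.map_congr_left fun p hp => ?_
  simp only [List.mem_filter, decide_eq_true_eq] at hp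
  exact tie_eq_pair hu hp.2.1

theorem partE_sup (hu : u ≠ 0) (I J : Setoid (Fin (m + 1))) :
    partE u (I ⊔ J) = partE u I * partE u J := by
  simp only [partE_eq_part hu, TieSystem.part_sup]

theorem partE_bot (hu : u ≠ 0) : partE u (⊥ : Setoid (Fin (m + 1))) = 1 := by
  rw [partE_eq_part hu, TieSystem.part_bot]

theorem partE_link (hu : u ≠ 0) (i : Fin m) : partE u (link i.castSucc i.succ) = E u i := by
  rw [partE_eq_part hu, TieSystem.part_link, TieSystem.pair_castSucc_succ, ties_e]

/-- The transposition of the strands `i` and `i + 1`. -/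
abbrev adj (i : Fin m) : Fin (m + 1) → Fin (m + 1) := Equiv.swap i.castSucc i.succ

theorem T_mul_partE (hu : u ≠ 0) (i : Fin m) (I : Setoid (Fin (m + 1))) :
    T u i * partE u I = partE u (I.map (adj i)) * T u i := by
  rw [partE_eq_part hu, partE_eq_part hu, ← ties_t hu, TieSystem.t_mul_part]

theorem partE_mul_T (hu : u ≠ 0) (i : Fin m) (I : Setoid (Fin (m + 1))) :
    partE u I * T u i = T u i * partE u (I.map (adj i)) := by
  rw [partE_eq_part hu, partE_eq_part hu, ← ties_t hu, TieSystem.part_mul_t]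

theorem incl_T (i : Fin m) : incl u m (T u i) = T u i.castSucc := by
  simp [incl, T]

theorem incl_E (i : Fin m) : incl u m (E u i) = E u i.castSucc := by
  simp [incl, E]

theorem map_incl_ties_t (hu : u ≠ 0) {x : ℕ} (hx : x < m) :
    Units.map (incl u m : BT u m →* BT u (m + 1)) ((ties hu m).t x) = (ties hu (m + 1)).t x := by
  ext
  have h1 := ties_t hu (⟨x, hx⟩ : Fin m)
  have h2 := ties_t hu (⟨x, by omega⟩ : Fin (m + 1))
  exact (congrArg (incl u m) h1).trans ((incl_T _).trans h2.symm)

theorem incl_span (hu : u ≠ 0) (d : ℕ) : ∀ x, x + d < m →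
    incl u m ((ties hu m).span x d) = (ties hu (m + 1)).span x d := by
  induction d with
  | zero =>
    intro x hx
    have h1 := ties_e hu ⟨x, hx⟩
    have h2 := ties_e hu (⟨x, by omega⟩ : Fin (m + 1))
    change incl u m ((ties hu m).e x) = (ties hu (m + 1)).e x
    exact (congrArg _ h1).trans ((incl_E _).trans h2.symm)
  | succ d ih =>
    intro x hx
    rw [TieSystem.span_succ, TieSystem.span_succ, map_mul, map_mul, ih (x + 1) (by omega),
      ← map_incl_ties_t hu (by omega : x < m)]
    rfl

theorem incl_pair (hu : u ≠ 0) (x y : Fin (m + 1)) :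
    incl u m ((ties hu m).pair x y) = (ties hu (m + 1)).pair x.castSucc y.castSucc := by
  simp only [TieSystem.pair, Fin.val_castSucc]
  split_ifs
  · exact incl_span hu _ _ (by omega)
  · exact incl_span hu _ _ (by omega)
  · exact map_one _

theorem incl_partE (hu : u ≠ 0) (I : Setoid (Fin (m + 1))) :
    incl u m (partE u I) = partE u (I.map Fin.castSucc) := by
  have := (ties hu m).part_map_of_semiconj (ties hu (m + 1)) (incl u m : BT u m →* BT u (m + 1))
    Fin.castSucc 1 (fun x y => by rw [one_mul, mul_one]; exact incl_pair hu x y) I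
  rw [partE_eq_part hu, partE_eq_part hu]
  simpa using this

end Partitions

/-! ### Descending products -/

section Words

variable {L : Type*} [Field L] {u : L} {m : ℕ}

theorem descT_eq (i a : ℕ) : descT u m i (a + 1) = ((seg m a i).reverse.map (T u)).prod := by
  rw [descT, seg]
  congr 4
  funext x
  simp only [decide_eq_decide]
  omega

theorem descT_of_le {i a : ℕ} (h : i ≤ a) : descT u m i (a + 1) = 1 := by
  rw [descT_eq, seg_nil h]; rfl

theorem descT_right {i a : ℕ} (h : a < i) (ha : a < m) :
    descT u m i (a + 1) = descT u m i (a + 2) * T u ⟨a, ha⟩ := by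
  rw [descT_eq, descT_eq, seg_cons h ha]
  simp

theorem descT_left {i a : ℕ} (h : a ≤ i) (hi : i < m) :
    descT u m (i + 1) (a + 1) = T u ⟨i, hi⟩ * descT u m i (a + 1) := by
  rw [descT_eq, descT_eq, seg_concat h hi]
  simp

theorem descT_comm_T {i a : ℕ} (j : Fin m) (h : (j : ℕ) + 1 < a ∨ i < j) :
    descT u m i (a + 1) * T u j = T u j * descT u m i (a + 1) := by
  rw [descT_eq]
  refine Commute.list_prod_left _ _ fun x hx => ?_
  obtain ⟨l, hl, rfl⟩ := List.mem_map.1 hx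
  have := mem_seg.1 (List.mem_reverse.1 hl)
  rcases h with h | h
  · exact (T_comm_of_far u (by omega)).symm
  · exact T_comm_of_far u (by omega)

/-- A braid generator that is not at the end of the descending product passes through it, with
its index lowered by one. -/
theorem descT_mul_T_inner {i a : ℕ} (hi : i ≤ m) (j : ℕ) (hj : a < j + 1) (hji : j + 1 < i) :
    descT u m i (a + 1) * T u ⟨j + 1, by omega⟩ = T u ⟨j, by omega⟩ * descT u m i (a + 1) := by
  induction i with
  | zero => omega
  | succ i ih =>
    rw [descT_left (by omega) (by omega)]
    rcases eq_or_ne (j + 1) i with rfl | hne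
    · have h1 := descT_comm_T (u := u) (i := j) (a := a) (⟨j + 1, by omega⟩ : Fin m)
        (Or.inr (by simp))
      have h2 := T_braid u (m := m) (i := ⟨j, by omega⟩) (j := ⟨j + 1, by omega⟩) rfl
      rw [descT_left (by omega) (by omega), mul_assoc, mul_assoc, h1, ← mul_assoc, ← mul_assoc,
        ← h2, mul_assoc, mul_assoc]
    · rw [mul_assoc, ih (by omega) (by omega), ← mul_assoc, ← mul_assoc]
      congr 1
      exact (T_comm_of_far u (by simp; omega)).symm

/-- The cycle by which the descending product `T_{i-1} ⋯ T_a` acts on the strands: the strand `x`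
goes to `x + 1` for `a ≤ x < i`, and `i` goes to `a`. -/
def cyc (m i a : ℕ) (hi : i ≤ m) (x : Fin (m + 1)) : Fin (m + 1) :=
  ⟨if (x : ℕ) < a then x else if (x : ℕ) < i then x + 1 else if (x : ℕ) = i then a else x, by
    have := x.isLt
    split_ifs <;> omega⟩

theorem val_adj (i : Fin m) (x : Fin (m + 1)) : (adj i x : ℕ) =
    if (x : ℕ) = i then (i : ℕ) + 1 else if (x : ℕ) = i + 1 then (i : ℕ) else x :=
  TieSystem.val_swap i x

/-- A partition passes through a descending product by the cycle that belongs to it. -/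
theorem partE_mul_descT (hu : u ≠ 0) {i : ℕ} (hi : i ≤ m) (d : ℕ) : ∀ a, a + d = i →
    ∀ I : Setoid (Fin (m + 1)), partE u I * descT u m i (a + 1) =
      descT u m i (a + 1) * partE u (I.map (cyc m i a hi)) := by
  induction d with
  | zero =>
    rintro a rfl I
    have : cyc m (a + 0) a hi = id := by
      funext x
      apply Fin.ext
      simp only [cyc, id]
      split_ifs <;> omega
    rw [descT_of_le (by omega), this, setoidMap_id, mul_one, one_mul]
  | succ d ih =>
    intro a ha I
    have hcyc : adj (⟨a, by omega⟩ : Fin m) ∘ cyc m i (a + 1) hi = cyc m i a hi := by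
      funext x
      apply Fin.ext
      simp only [Function.comp, val_adj, cyc]
      split_ifs <;> omega
    rw [descT_right (by omega) (by omega), ← mul_assoc, ih (a + 1) (by omega) I, mul_assoc,
      partE_mul_T hu, setoidMap_map, hcyc, mul_assoc]

theorem partE_mul_descT' (hu : u ≠ 0) {i a : ℕ} (hi : i ≤ m) (ha : a ≤ i)
    (I : Setoid (Fin (m + 1))) : partE u I * descT u m i (a + 1) =
      descT u m i (a + 1) * partE u (I.map (cyc m i a hi)) :=
  partE_mul_descT hu hi (i - a) a (by omega) I

theorem incl_descT (a : ℕ) {i : ℕ} (hi : i ≤ m) :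
    incl u m (descT u m i (a + 1)) = descT u (m + 1) i (a + 1) := by
  induction i with
  | zero => rw [descT_of_le (Nat.zero_le a), descT_of_le (Nat.zero_le a), map_one]
  | succ i ih =>
    rcases le_or_gt a i with h | h
    · rw [descT_left h (by omega), descT_left h (by omega), map_mul, ih (by omega), incl_T]
      rfl
    · rw [descT_of_le h, descT_of_le h, map_one]

theorem bigT_zero (i : ℕ) : bigT u m i 0 = 1 := rfl

theorem bigT_succ (i a : ℕ) : bigT u m i (a + 1) = descT u m i (a + 1) := rfl

variable (u m) in
/-- The product of the first `j` factors of `word u m k`. -/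
def wordTo (j : ℕ) (k : ℕ → ℕ) : BT u m :=
  ((List.range j).map fun i => bigT u m (i + 1) (k (i + 1))).prod

theorem word_eq_wordTo (k : ℕ → ℕ) : word u m k = wordTo u m m k := rfl

theorem wordTo_succ (j : ℕ) (k : ℕ → ℕ) :
    wordTo u m (j + 1) k = wordTo u m j k * bigT u m (j + 1) (k (j + 1)) := by
  simp [wordTo, List.range_succ]

theorem wordTo_congr {j : ℕ} {k k' : ℕ → ℕ} (h : ∀ i, i < j → k (i + 1) = k' (i + 1)) :
    wordTo u m j k = wordTo u m j k' := by
  rw [wordTo, wordTo]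
  congr 1
  refine List.map_congr_left fun i hi => ?_
  rw [h i (List.mem_range.1 hi)]

theorem incl_wordTo {j : ℕ} (hj : j ≤ m) (k : ℕ → ℕ) :
    incl u m (wordTo u m j k) = wordTo u (m + 1) j k := by
  induction j with
  | zero => simp [wordTo]
  | succ j ih =>
    rw [wordTo_succ, wordTo_succ, map_mul, ih (by omega)]
    congr 1
    rcases k (j + 1) with _ | a
    · simp [bigT_zero]
    · rw [bigT_succ, bigT_succ, incl_descT a hj]

theorem word_succ (k : ℕ → ℕ) :
    word u (m + 1) k = incl u m (word u m k) * bigT u (m + 1) (m + 1) (k (m + 1)) := by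
  rw [word_eq_wordTo, word_eq_wordTo, wordTo_succ, incl_wordTo le_rfl]

end Words

/-! ### The spanning set of words and partitions -/

section Spanning

variable {L : Type*} [Field L] {u : L} {m : ℕ}

/-- An induction principle for the algebra of braids and ties. -/
theorem BT_induction {p : BT u m → Prop} (hs : ∀ c : L, p (algebraMap L _ c))
    (hT : ∀ i, p (T u i)) (hE : ∀ i, p (E u i)) (hadd : ∀ x y, p x → p y → p (x + y))
    (hmul : ∀ x y, p x → p y → p (x * y)) (x : BT u m) : p x := by
  obtain ⟨y, rfl⟩ := RingQuot.mkAlgHom_surjective L (Rel u m) x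
  induction y using FreeAlgebra.induction with
  | grade0 c => rw [AlgHom.commutes]; exact hs c
  | grade1 i => rcases i with i | i; exacts [hT i, hE i]
  | mul x y hx hy => rw [map_mul]; exact hmul _ _ hx hy
  | add x y hx hy => rw [map_add]; exact hadd _ _ hx hy

variable (u m) in
/-- The span of the products `𝕋_{1,k_1} ⋯ 𝕋_{j,k_j} E_I`. -/
def prefixSpan (j : ℕ) : Submodule L (BT u m) :=
  Submodule.span L {x | ∃ (k : ℕ → ℕ) (I : Setoid (Fin (m + 1))), (∀ i, k i ≤ i) ∧
    x = wordTo u m j k * partE u I}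

theorem wordTo_mem (hu : u ≠ 0) (j : ℕ) {k : ℕ → ℕ} (hk : ∀ i, k i ≤ i) :
    wordTo u m j k ∈ prefixSpan u m j :=
  Submodule.subset_span ⟨k, ⊥, hk, by rw [partE_bot hu, mul_one]⟩

theorem mul_partE_mem (hu : u ≠ 0) {j : ℕ} {x : BT u m} (hx : x ∈ prefixSpan u m j)
    (I : Setoid (Fin (m + 1))) : x * partE u I ∈ prefixSpan u m j := by
  induction hx using Submodule.span_induction with
  | mem x hx =>
    obtain ⟨k, J, hk, rfl⟩ := hx
    rw [mul_assoc, ← partE_sup hu]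
    exact Submodule.subset_span ⟨k, _, hk, rfl⟩
  | zero => rw [zero_mul]; exact zero_mem _
  | add x y _ _ hx hy => rw [add_mul]; exact add_mem hx hy
  | smul c x _ hx => rw [smul_mul_assoc]; exact Submodule.smul_mem _ _ hx

theorem mul_descT_mem (hu : u ≠ 0) {j a : ℕ} {x : BT u m} (hx : x ∈ prefixSpan u m j)
    (hj : j < m) (ha : a ≤ j + 1) :
    x * descT u m (j + 1) (a + 1) ∈ prefixSpan u m (j + 1) := by
  induction hx using Submodule.span_induction with
  | mem x hx =>
    obtain ⟨k, J, hk, rfl⟩ := hx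
    rw [mul_assoc, partE_mul_descT' hu hj ha, ← mul_assoc]
    obtain ⟨b, hb, hbeq⟩ : ∃ b, b ≤ j + 1 ∧
        descT u m (j + 1) (a + 1) = bigT u m (j + 1) b := by
      rcases eq_or_lt_of_le ha with rfl | h
      · exact ⟨0, by omega, by rw [descT_of_le le_rfl, bigT_zero]⟩
      · exact ⟨a + 1, by omega, rfl⟩
    refine Submodule.subset_span ⟨Function.update k (j + 1) b, J.map (cyc m (j + 1) a hj),
      fun i => ?_, ?_⟩
    · rcases eq_or_ne i (j + 1) with rfl | h
      · simpa using hb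
      · simpa [h] using hk i
    · rw [wordTo_succ, hbeq, Function.update_self]
      congr 2
      refine wordTo_congr fun i hi => ?_
      rw [Function.update_of_ne (by omega)]
  | zero => rw [zero_mul]; exact zero_mem _
  | add x y _ _ hx hy => rw [add_mul]; exact add_mem hx hy
  | smul c x _ hx => rw [smul_mul_assoc]; exact Submodule.smul_mem _ _ hx

theorem mem_succ (hu : u ≠ 0) {j : ℕ} {x : BT u m} (hx : x ∈ prefixSpan u m j) (hj : j < m) :
    x ∈ prefixSpan u m (j + 1) := by
  have := mul_descT_mem hu (a := j + 1) hx hj le_rfl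
  rwa [descT_of_le le_rfl, mul_one] at this

/-- By induction on `j`: the generator is moved through the last factor, where it is absorbed,
commutes, or has its index lowered; the remaining case, that it repeats the last letter, is the
quadratic relation. -/
theorem mul_T_mem (hu : u ≠ 0) (j : ℕ) (hj : j ≤ m) : ∀ (i : Fin m), (i : ℕ) < j →
    ∀ x ∈ prefixSpan u m j, x * T u i ∈ prefixSpan u m j := by
  induction j with
  | zero => intro i hi; omega
  | succ j ih =>
    intro i hi x hx
    induction hx using Submodule.span_induction with
    | zero => rw [zero_mul]; exact zero_mem _
    | add x y _ _ hx hy => rw [add_mul]; exact add_mem hx hy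
    | smul c x _ hx => rw [smul_mul_assoc]; exact Submodule.smul_mem _ _ hx
    | mem x hx =>
      obtain ⟨k, I, hk, rfl⟩ := hx
      rw [mul_assoc, partE_mul_T hu, ← mul_assoc, wordTo_succ]
      refine mul_partE_mem hu ?_ _
      have hy := wordTo_mem (m := m) hu j hk
      have hT : ∀ l : Fin m, (l : ℕ) < j → wordTo u m j k * T u l ∈ prefixSpan u m j :=
        fun l hl => ih (by omega) l hl _ hy
      set y := wordTo u m j k
      have hkj := hk (j + 1)
      generalize k (j + 1) = b at hkj ⊢
      rcases b with _ | a
      · rw [bigT_zero, mul_one]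
        rcases eq_or_ne (i : ℕ) j with h | h
        · have := mul_descT_mem hu (a := j) hy hj (by omega)
          rw [descT_left le_rfl (by omega), descT_of_le le_rfl, mul_one] at this
          rwa [show i = ⟨j, by omega⟩ from Fin.ext h]
        · exact mem_succ hu (hT i (by omega)) hj
      · rw [bigT_succ]
        rcases lt_trichotomy (i : ℕ) a with h | h | h
        · rcases eq_or_ne ((i : ℕ) + 1) a with rfl | hne
          · rw [mul_assoc, ← descT_right (by omega) i.isLt]
            exact mul_descT_mem hu hy hj (by omega)
          · rw [mul_assoc, descT_comm_T i (by omega), ← mul_assoc]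
            exact mul_descT_mem hu (hT i (by omega)) hj (by omega)
        · subst h
          have h1 := mul_descT_mem hu (a := (i : ℕ) + 1) hy hj (by omega)
          have h2 := mul_descT_mem hu (a := (i : ℕ)) hy hj (by omega)
          have h3 := mul_partE_mem hu h1 (link i.castSucc i.succ)
          have h4 := mul_partE_mem hu h2 (link i.castSucc i.succ)
          rw [partE_link hu] at h3 h4
          rw [descT_right (by omega) i.isLt] at h4 ⊢
          have h5 : y * (descT u m (j + 1) (i + 2) * T u i) * T u i =
              y * descT u m (j + 1) (i + 2) + (u - 1) • (y * descT u m (j + 1) (i + 2) * E u i +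
                y * (descT u m (j + 1) (i + 2) * T u i) * E u i) := by
            rw [mul_assoc, mul_assoc, T_sq]
            simp only [mul_add, mul_one, mul_smul_comm, ET, mul_assoc]
          exact h5 ▸ add_mem h1 (Submodule.smul_mem _ _ (add_mem h3 h4))
        · obtain ⟨l, hl⟩ : ∃ l, (i : ℕ) = l + 1 := ⟨i - 1, by omega⟩
          rw [show i = ⟨l + 1, by omega⟩ from Fin.ext hl, mul_assoc,
            descT_mul_T_inner hj l (by omega) (by omega), ← mul_assoc]
          exact mul_descT_mem hu (hT _ (by simp; omega)) hj (by omega)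

/-- The products `𝕋_{1,k_1} ⋯ 𝕋_{m,k_m} E_I` span the algebra of braids and ties. -/
theorem mem_span_word (hu : u ≠ 0) (x : BT u m) :
    x ∈ Submodule.span L {x | ∃ (k : ℕ → ℕ) (I : Setoid (Fin (m + 1))), (∀ i, k i ≤ i) ∧
      x = word u m k * partE u I} := by
  have key : ∀ x : BT u m, ∀ y ∈ prefixSpan u m m, y * x ∈ prefixSpan u m m := by
    intro x
    induction x using BT_induction with
    | hs c =>
      intro y hy
      rw [← Algebra.commutes, ← Algebra.smul_def]
      exact Submodule.smul_mem _ _ hy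
    | hT i => exact mul_T_mem hu m le_rfl i i.isLt
    | hE i =>
      intro y hy
      rw [← partE_link hu]
      exact mul_partE_mem hu hy _
    | hadd x x' h h' => intro y hy; rw [mul_add]; exact add_mem (h y hy) (h' y hy)
    | hmul x x' h h' => intro y hy; rw [← mul_assoc]; exact h' _ (h y hy)
  have h1 : (1 : BT u m) ∈ prefixSpan u m m := by
    have : wordTo u m m (fun _ => 0) = 1 := by simp [wordTo, bigT_zero]
    rw [← this]
    exact wordTo_mem hu m fun _ => Nat.zero_le _
  have := key x 1 h1
  rwa [one_mul] at this

theorem word_induction (hu : u ≠ 0) {p : BT u m → Prop}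
    (hw : ∀ (k : ℕ → ℕ) (I : Setoid (Fin (m + 1))), (∀ i, k i ≤ i) → p (word u m k * partE u I))
    (h0 : p 0) (hadd : ∀ x y, p x → p y → p (x + y)) (hsmul : ∀ (c : L) x, p x → p (c • x))
    (x : BT u m) : p x := by
  induction mem_span_word hu x using Submodule.span_induction with
  | mem x hx => obtain ⟨k, I, hk, rfl⟩ := hx; exact hw k I hk
  | zero => exact h0
  | add x y _ _ hx hy => exact hadd x y hx hy
  | smul c x _ hx => exact hsmul c x hx

end Spanning

/-! ### Operators on arrangements of labels -/

section Representation

variable {L : Type*} [Field L] (u : L) {n : ℕ} (J : Setoid (Fin n))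

open Classical in
/-- The coefficient of the exchanged arrangement when the labels `a`, `b` meet: it is `1`, except
for tied labels in decreasing order. -/
noncomputable def exchangeCoeff (a b : Fin n) : L := if J a b ∧ b < a then u else 1

open Classical in
/-- The coefficient of the unchanged arrangement when the labels `a`, `b` meet. -/
noncomputable def stayCoeff (a b : Fin n) : L := if J a b ∧ b < a then u - 1 else 0

open Classical in
/-- `1` if the labels `a`, `b` are tied, and `0` otherwise. -/
noncomputable def tiedCoeff (a b : Fin n) : L := if J a b then 1 else 0

/-- The arrangement `f` of the labels as a basis vector. -/
noncomputable def arr (L : Type*) [Field L] {n : ℕ} (f : Equiv.Perm (Fin n)) :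
    Equiv.Perm (Fin n) →₀ L :=
  Finsupp.single f 1

/-- The action of a braid generator at the positions `p` and `q`: the labels at these positions
are exchanged; on labels tied by `J` this is deformed as in the regular representation of the
Hecke algebra. -/
noncomputable def opT (p q : Fin n) : Module.End L (Equiv.Perm (Fin n) →₀ L) :=
  Finsupp.linearCombination L fun f =>
    exchangeCoeff u J (f p) (f q) • arr L (f * Equiv.swap p q) +
      stayCoeff u J (f p) (f q) • arr L f

/-- The action of the tie between the positions `p` and `q`: the projection to the arrangements in
which these positions carry labels tied by `J`. -/
noncomputable def opTie (L : Type*) [Field L] {n : ℕ} (J : Setoid (Fin n)) (p q : Fin n) :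
    Module.End L (Equiv.Perm (Fin n) →₀ L) :=
  Finsupp.linearCombination L fun f => (tiedCoeff J (f p) (f q) : L) • arr L f

theorem opT_arr (p q : Fin n) (f : Equiv.Perm (Fin n)) :
    opT u J p q (arr L f) = exchangeCoeff u J (f p) (f q) • arr L (f * Equiv.swap p q) +
      stayCoeff u J (f p) (f q) • arr L f := by
  simp [opT, arr]

theorem opTie_arr (p q : Fin n) (f : Equiv.Perm (Fin n)) :
    opTie L J p q (arr L f) = (tiedCoeff J (f p) (f q) : L) • arr L f := by
  simp [opTie, arr]

theorem end_ext {φ ψ : Module.End L (Equiv.Perm (Fin n) →₀ L)}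
    (h : ∀ f, φ (arr L f) = ψ (arr L f)) : φ = ψ := by
  refine Finsupp.lhom_ext' fun f => LinearMap.ext_ring ?_
  exact h f

theorem tiedCoeff_symm (a b : Fin n) : (tiedCoeff J a b : L) = tiedCoeff J b a := by
  have : J a b ↔ J b a := ⟨J.symm, J.symm⟩
  by_cases h : J a b
  · simp [tiedCoeff, h, this.1 h]
  · simp [tiedCoeff, h, mt this.2 h]

theorem opTie_symm (p q : Fin n) : opTie L J p q = opTie L J q p :=
  end_ext fun f => by rw [opTie_arr, opTie_arr, tiedCoeff_symm]

theorem opTie_comm (p q r s : Fin n) :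
    opTie L J p q * opTie L J r s = opTie L J r s * opTie L J p q :=
  end_ext fun f => by
    simp only [Module.End.mul_apply, opTie_arr, map_smul, smul_smul, mul_comm]

theorem opTie_sq (p q : Fin n) : opTie L J p q * opTie L J p q = opTie L J p q :=
  end_ext fun f => by
    simp only [Module.End.mul_apply, opTie_arr, map_smul, smul_smul, tiedCoeff]
    split_ifs <;> simp

theorem opTie_trans (p q r : Fin n) :
    opTie L J p q * opTie L J q r = opTie L J p r * opTie L J q r :=
  end_ext fun f => by
    simp only [Module.End.mul_apply, opTie_arr, map_smul, smul_smul, tiedCoeff]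
    by_cases h1 : J (f q) (f r)
    · have : J (f p) (f q) ↔ J (f p) (f r) :=
        ⟨fun h => J.trans h h1, fun h => J.trans h (J.symm h1)⟩
      by_cases h2 : J (f p) (f q)
      · simp [h1, h2, this.1 h2]
      · simp [h1, h2, mt this.2 h2]
    · simp [h1]

theorem opTie_trans' (p q r : Fin n) :
    opTie L J p q * opTie L J q r = opTie L J p q * opTie L J p r := by
  rw [opTie_comm, opTie_symm J q r, opTie_symm J p q, opTie_trans, opTie_comm, opTie_symm J r p]

theorem opT_mul_opTie (p q x y : Fin n) :
    opT u J p q * opTie L J x y =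
      opTie L J (Equiv.swap p q x) (Equiv.swap p q y) * opT u J p q :=
  end_ext fun f => by
    simp only [Module.End.mul_apply, opTie_arr, opT_arr, map_smul, map_add, smul_smul, smul_add,
      Equiv.Perm.mul_apply, Equiv.swap_apply_self]
    have key : (tiedCoeff J (f x) (f y) : L) * stayCoeff u J (f p) (f q) =
        stayCoeff u J (f p) (f q) *
          tiedCoeff J (f (Equiv.swap p q x)) (f (Equiv.swap p q y)) := by
      by_cases h : J (f p) (f q)
      · have hs : ∀ z, J (f (Equiv.swap p q z)) (f z) := by
          intro z
          rw [Equiv.swap_apply_def]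
          split_ifs with h1 h2
          · exact h1 ▸ J.symm h
          · exact h2 ▸ h
          · exact J.refl _
        have : J (f x) (f y) ↔ J (f (Equiv.swap p q x)) (f (Equiv.swap p q y)) :=
          ⟨fun h => J.trans (hs x) (J.trans h (J.symm (hs y))),
            fun h => J.trans (J.symm (hs x)) (J.trans h (hs y))⟩
        have : (tiedCoeff J (f x) (f y) : L) =
            tiedCoeff J (f (Equiv.swap p q x)) (f (Equiv.swap p q y)) := by
          by_cases h2 : J (f x) (f y)
          · simp [tiedCoeff, h2, this.1 h2]
          · simp [tiedCoeff, h2, mt this.2 h2]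
        rw [this, mul_comm]
      · simp [stayCoeff, h]
    rw [key, mul_comm (exchangeCoeff u J _ _)]

theorem opT_sq {p q : Fin n} (hpq : p ≠ q) :
    opT u J p q * opT u J p q = 1 + (u - 1) • (opTie L J p q * (1 + opT u J p q)) :=
  end_ext fun f => by
    have hf : f p ≠ f q := f.injective.ne hpq
    simp only [Module.End.mul_apply, opTie_arr, opT_arr, map_smul, map_add, smul_smul, smul_add,
      Equiv.Perm.mul_apply, LinearMap.add_apply, LinearMap.smul_apply, Module.End.one_apply,
      Equiv.swap_apply_left, Equiv.swap_apply_right, mul_assoc, Equiv.swap_mul_self, mul_one]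
    have h1 : exchangeCoeff u J (f p) (f q) * exchangeCoeff u J (f q) (f p) +
        stayCoeff u J (f p) (f q) * stayCoeff u J (f p) (f q) =
        1 + (u - 1) * (tiedCoeff J (f p) (f q) +
          stayCoeff u J (f p) (f q) * tiedCoeff J (f p) (f q)) := by
      simp only [exchangeCoeff, stayCoeff, tiedCoeff]
      by_cases hJ : J (f p) (f q)
      · have hJ' := J.symm hJ
        rcases lt_or_gt_of_ne hf with h | h
        · simp [hJ, hJ', h, not_lt_of_gt h]
        · simp [hJ, hJ', h, not_lt_of_gt h]; try ring
      · have hJ' : ¬ J (f q) (f p) := fun h => hJ (J.symm h)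
        simp [hJ, hJ']
    have h2 : exchangeCoeff u J (f p) (f q) * stayCoeff u J (f q) (f p) +
        stayCoeff u J (f p) (f q) * exchangeCoeff u J (f p) (f q) =
        (u - 1) * (exchangeCoeff u J (f p) (f q) * tiedCoeff J (f q) (f p)) := by
      simp only [exchangeCoeff, stayCoeff, tiedCoeff]
      by_cases hJ : J (f p) (f q)
      · have hJ' := J.symm hJ
        rcases lt_or_gt_of_ne hf with h | h
        · simp [hJ, hJ', h, not_lt_of_gt h]
        · simp [hJ, hJ', h, not_lt_of_gt h]; try ring
      · have hJ' : ¬ J (f q) (f p) := fun h => hJ (J.symm h)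
        simp [hJ, hJ']
    linear_combination (norm := module) h1 • arr L f + h2 • arr L (f * Equiv.swap p q)

theorem opT_comm {p q r s : Fin n} (h1 : p ≠ r) (h2 : p ≠ s) (h3 : q ≠ r) (h4 : q ≠ s) :
    opT u J p q * opT u J r s = opT u J r s * opT u J p q :=
  end_ext fun f => by
    have hc : Equiv.swap p q * Equiv.swap r s = Equiv.swap r s * Equiv.swap p q :=
      (Equiv.Perm.Disjoint.commute (by
        intro x
        by_cases hp : x = p
        · right; subst hp; exact Equiv.swap_apply_of_ne_of_ne h1 h2
        by_cases hq : x = q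
        · right; subst hq; exact Equiv.swap_apply_of_ne_of_ne h3 h4
        left; exact Equiv.swap_apply_of_ne_of_ne hp hq)).eq
    simp only [Module.End.mul_apply, opT_arr, map_smul, map_add, smul_smul, smul_add,
      Equiv.Perm.mul_apply, Equiv.swap_apply_of_ne_of_ne h1 h2,
      Equiv.swap_apply_of_ne_of_ne h3 h4, Equiv.swap_apply_of_ne_of_ne h1.symm h3.symm,
      Equiv.swap_apply_of_ne_of_ne h2.symm h4.symm, mul_assoc, hc]
    module

/-- The braid relation for the operators `opT`, on the coefficients at those arrangements that are
reached in more than one way. -/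
theorem braid_coeff {a b c : Fin n} (hab : a ≠ b) (hbc : b ≠ c) (hac : a ≠ c) :
    exchangeCoeff u J a b * exchangeCoeff u J b a * stayCoeff u J a c +
        stayCoeff u J a b * stayCoeff u J b c * stayCoeff u J a b =
      exchangeCoeff u J b c * exchangeCoeff u J c b * stayCoeff u J a c +
        stayCoeff u J b c * stayCoeff u J a b * stayCoeff u J b c ∧
    exchangeCoeff u J a b * stayCoeff u J a c * stayCoeff u J b a +
        stayCoeff u J a b * stayCoeff u J b c * exchangeCoeff u J a b =
      stayCoeff u J b c * exchangeCoeff u J a b * stayCoeff u J a c ∧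
    stayCoeff u J a b * exchangeCoeff u J b c * stayCoeff u J a c =
      exchangeCoeff u J b c * stayCoeff u J a c * stayCoeff u J c b +
        stayCoeff u J b c * stayCoeff u J a b * exchangeCoeff u J b c := by
  simp only [exchangeCoeff, stayCoeff]
  by_cases h1 : J a b
  · by_cases h2 : J b c
    · have h3 : J a c := J.trans h1 h2
      have h1' := J.symm h1
      have h2' := J.symm h2
      rcases lt_or_gt_of_ne hab with o1 | o1 <;> rcases lt_or_gt_of_ne hbc with o2 | o2 <;>
        rcases lt_or_gt_of_ne hac with o3 | o3 <;>
        first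
          | (exfalso; simp only [Fin.lt_def] at o1 o2 o3; omega)
          | (refine ⟨?_, ?_, ?_⟩ <;> simp only [h1, h2, h3, h1', h2', o1, o2, o3,
              not_lt_of_gt o1, not_lt_of_gt o2, not_lt_of_gt o3, true_and, if_true, if_false] <;>
              ring)
    · have h3 : ¬ J a c := fun h => h2 (J.trans (J.symm h1) h)
      have h2' : ¬ J c b := fun h => h2 (J.symm h)
      simp [h2, h3, h2']
  · by_cases h2 : J b c
    · have h3 : ¬ J a c := fun h => h1 (J.trans h (J.symm h2))
      have h1' : ¬ J b a := fun h => h1 (J.symm h)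
      simp [h1, h3, h1']
    · have h1' : ¬ J b a := fun h => h1 (J.symm h)
      have h2' : ¬ J c b := fun h => h2 (J.symm h)
      simp [h1, h2, h1', h2']

theorem opT_braid {p q r : Fin n} (hpq : p ≠ q) (hqr : q ≠ r) (hpr : p ≠ r) :
    opT u J p q * opT u J q r * opT u J p q = opT u J q r * opT u J p q * opT u J q r :=
  end_ext fun f => by
    have hs : Equiv.swap p q * (Equiv.swap q r * Equiv.swap p q) =
        Equiv.swap q r * (Equiv.swap p q * Equiv.swap q r) := by
      have h1 := Equiv.swap_mul_swap_mul_swap hpq hpr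
      have h2 := Equiv.swap_mul_swap_mul_swap hqr.symm hpr.symm
      rw [Equiv.swap_comm r q, Equiv.swap_comm q p, Equiv.swap_comm p r] at h2
      rw [← mul_assoc, ← mul_assoc, h1, h2]
    obtain ⟨k1, k2, k3⟩ := braid_coeff u J (f.injective.ne hpq) (f.injective.ne hqr)
      (f.injective.ne hpr)
    simp only [Module.End.mul_apply, opT_arr, map_smul, map_add, smul_smul, smul_add,
      Equiv.Perm.mul_apply, Equiv.swap_apply_left, Equiv.swap_apply_right,
      Equiv.swap_apply_of_ne_of_ne hpq hpr, Equiv.swap_apply_of_ne_of_ne hpr.symm hqr.symm,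
      mul_assoc, hs, Equiv.swap_mul_self, mul_one]
    linear_combination (norm := module) k1 • arr L f + k2 • arr L (f * Equiv.swap p q) +
      k3 • arr L (f * Equiv.swap q r)

end Representation

/-! ### The action on arrangements -/

section Action

variable {L : Type*} [Field L] (u : L) {m : ℕ} (J : Setoid (Fin (m + 1)))

theorem castSucc_ne_succ {i j : Fin m} (h : (i : ℕ) ≠ j + 1) : i.castSucc ≠ j.succ := by
  simpa [Fin.ext_iff] using h

theorem eq_succ_of_abs {i j : Fin m} (h : |(i : ℤ) - (j : ℤ)| = 1) :
    (i : ℕ) + 1 = j ∨ (j : ℕ) + 1 = i := by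
  rw [abs_eq zero_le_one] at h; omega

theorem far_of_abs {i j : Fin m} (h : 1 < |(i : ℤ) - (j : ℤ)|) :
    (i : ℕ) + 1 < j ∨ (j : ℕ) + 1 < i := by
  rw [lt_abs] at h; omega

/-- The transport of a tie by a braid generator next to it. -/
theorem opT_mul_opTie_adj {i j : Fin m} (h : (i : ℕ) + 1 = j ∨ (j : ℕ) + 1 = i) :
    ∃ p q r : Fin (m + 1),
      opT u J i.castSucc i.succ * opTie L J q r = opTie L J p r * opT u J i.castSucc i.succ ∧
      opT u J j.castSucc j.succ * opTie L J p r = opTie L J p q * opT u J j.castSucc j.succ ∧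
      opT u J i.castSucc i.succ * opTie L J p q = opTie L J p q * opT u J i.castSucc i.succ ∧
      opTie L J i.castSucc i.succ = opTie L J p q ∧ opTie L J j.castSucc j.succ = opTie L J q r := by
  rcases h with h | h
  · have hq : j.castSucc = i.succ := Fin.ext (by simp [h])
    have h1 : i.castSucc ≠ i.succ := castSucc_ne_succ (by omega)
    have h2 : i.succ ≠ j.succ := by simp [Fin.ext_iff]; omega
    have h3 : i.castSucc ≠ j.succ := castSucc_ne_succ (by omega)
    refine ⟨i.castSucc, i.succ, j.succ, ?_, ?_, ?_, rfl, by rw [hq]⟩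
    · rw [opT_mul_opTie, Equiv.swap_apply_right, Equiv.swap_apply_of_ne_of_ne h3.symm h2.symm]
    · rw [opT_mul_opTie, Equiv.swap_apply_right, hq, Equiv.swap_apply_of_ne_of_ne h1 h3]
    · rw [opT_mul_opTie, Equiv.swap_apply_right, Equiv.swap_apply_left, opTie_symm]
  · have hq : i.castSucc = j.succ := Fin.ext (by simp [h])
    have h1 : j.castSucc ≠ j.succ := castSucc_ne_succ (by omega)
    have h2 : j.succ ≠ i.succ := by simp [Fin.ext_iff]; omega
    have h3 : j.castSucc ≠ i.succ := castSucc_ne_succ (by omega)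
    refine ⟨i.succ, j.succ, j.castSucc, ?_, ?_, ?_, ?_, ?_⟩
    · rw [hq, opT_mul_opTie, Equiv.swap_apply_left, Equiv.swap_apply_of_ne_of_ne h1 h3]
    · rw [opT_mul_opTie, Equiv.swap_apply_left, Equiv.swap_apply_of_ne_of_ne h3.symm h2.symm]
    · rw [hq, opT_mul_opTie, Equiv.swap_apply_left, Equiv.swap_apply_right, opTie_symm]
    · rw [hq, opTie_symm]
    · rw [opTie_symm]

/-- The algebra of braids and ties acts on the arrangements of labels, whose ties are the
partition `J`. -/
noncomputable def action : BT u m →ₐ[L] Module.End L (Equiv.Perm (Fin (m + 1)) →₀ L) :=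
  RingQuot.liftAlgHom L ⟨FreeAlgebra.lift L
    (Sum.elim (fun i => opT u J i.castSucc i.succ) (fun i => opTie L J i.castSucc i.succ)), by
    intro x y h
    cases h with
    | TT_far i j h =>
      have := far_of_abs h
      simp only [map_mul, FreeAlgebra.lift_ι_apply, Sum.elim_inl]
      refine opT_comm u J ?_ ?_ ?_ ?_ <;> simp [Fin.ext_iff] <;> omega
    | TTT i j h =>
      simp only [map_mul, FreeAlgebra.lift_ι_apply, Sum.elim_inl]
      rcases eq_succ_of_abs h with h | h
      · rw [show j.castSucc = i.succ from Fin.ext (by simp [h])]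
        refine opT_braid u J ?_ ?_ ?_ <;> simp [Fin.ext_iff] <;> omega
      · rw [show i.castSucc = j.succ from Fin.ext (by simp [h])]
        refine (opT_braid u J ?_ ?_ ?_).symm <;> simp [Fin.ext_iff] <;> omega
    | T_sq i =>
      simp only [map_mul, map_add, map_one, map_smul, FreeAlgebra.lift_ι_apply, Sum.elim_inl,
        Sum.elim_inr]
      exact opT_sq u J (castSucc_ne_succ (by omega))
    | EE i j =>
      simp only [map_mul, FreeAlgebra.lift_ι_apply, Sum.elim_inr]
      exact opTie_comm J _ _ _ _
    | E_sq i =>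
      simp only [map_mul, FreeAlgebra.lift_ι_apply, Sum.elim_inr]
      exact opTie_sq J _ _
    | ET i =>
      simp only [map_mul, FreeAlgebra.lift_ι_apply, Sum.elim_inl, Sum.elim_inr]
      rw [opT_mul_opTie, Equiv.swap_apply_left, Equiv.swap_apply_right, opTie_symm]
    | ET_far i j h =>
      have := far_of_abs h
      simp only [map_mul, FreeAlgebra.lift_ι_apply, Sum.elim_inl, Sum.elim_inr]
      rw [opT_mul_opTie, Equiv.swap_apply_of_ne_of_ne, Equiv.swap_apply_of_ne_of_ne] <;>
        simp [Fin.ext_iff] <;> omega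
    | EET i j h =>
      obtain ⟨p, q, r, h1, -, h3, h4, h5⟩ := opT_mul_opTie_adj u J (eq_succ_of_abs h)
      simp only [map_mul, FreeAlgebra.lift_ι_apply, Sum.elim_inl, Sum.elim_inr]
      rw [h4, h5, h3, mul_assoc _ _ (opTie L J q r), h1, ← mul_assoc, opTie_trans']
    | TEE i j h =>
      obtain ⟨p, q, r, h1, -, h3, h4, h5⟩ := opT_mul_opTie_adj u J (eq_succ_of_abs h)
      simp only [map_mul, FreeAlgebra.lift_ι_apply, Sum.elim_inl, Sum.elim_inr]
      rw [h4, h5, h3, mul_assoc _ _ (opTie L J q r), mul_assoc _ _ (opTie L J q r), h1,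
        ← mul_assoc, ← mul_assoc, opTie_symm J p q, opTie_trans]
    | ETT i j h =>
      obtain ⟨p, q, r, h1, h2, -, h4, h5⟩ := opT_mul_opTie_adj u J (eq_succ_of_abs h)
      simp only [map_mul, FreeAlgebra.lift_ι_apply, Sum.elim_inl, Sum.elim_inr]
      rw [h4, h5, mul_assoc _ _ (opTie L J q r), h1, ← mul_assoc, h2]⟩

theorem action_T (i : Fin m) : action u J (T u i) = opT u J i.castSucc i.succ := by
  simp [action, T]

theorem action_E (i : Fin m) : action u J (E u i) = opTie L J i.castSucc i.succ := by
  simp [action, E]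

end Action

/-! ### Linear independence, and the relative trace -/

section Independence

variable {L : Type*} [Field L] {u : L} {m : ℕ} (J : Setoid (Fin (m + 1)))

theorem action_span (hu : u ≠ 0) (d : ℕ) : ∀ (x y : Fin (m + 1)), (y : ℕ) = x + d + 1 →
    action u J ((ties hu m).span x d) = opTie L J x y := by
  induction d with
  | zero =>
    intro x y h
    have hy := y.isLt
    change action u J ((ties hu m).e (⟨x, by omega⟩ : Fin m)) = _
    rw [ties_e, action_E]
    congr 1
    exact Fin.ext h.symm
  | succ d ih =>
    intro x y h
    have hy := y.isLt
    have h1 := ih ⟨x + 1, by omega⟩ y (by simp; omega)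
    have h2 : action u J ((ties hu m).t x : BT u m) =
        opT u J x ⟨x + 1, by omega⟩ := by
      change action u J ((ties hu m).t (⟨x, by omega⟩ : Fin m) : BT u m) = _
      rw [ties_t, action_T]
      rfl
    have h3 : (⟨x + 1, by omega⟩ : Fin (m + 1)) ≠ y := by simp [Fin.ext_iff]; omega
    have h4 : x ≠ y := by simp [Fin.ext_iff]; omega
    rw [TieSystem.span_succ, map_mul, map_mul, h2]
    change _ * action u J ((ties hu m).span ((⟨x + 1, by omega⟩ : Fin (m + 1)) : ℕ) d) * _ = _
    rw [h1, opT_mul_opTie, Equiv.swap_apply_right, Equiv.swap_apply_of_ne_of_ne h4.symm h3.symm,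
      mul_assoc, ← h2, ← map_mul, Units.mul_inv, map_one, mul_one]

theorem action_pair (hu : u ≠ 0) (x y : Fin (m + 1)) :
    action u J ((ties hu m).pair x y) = opTie L J x y := by
  unfold TieSystem.pair
  split_ifs with h1 h2
  · exact action_span J hu _ x y (by omega)
  · rw [opTie_symm]; exact action_span J hu _ y x (by omega)
  · obtain rfl : x = y := Fin.ext (by omega)
    rw [map_one]
    refine end_ext fun f => ?_
    rw [opTie_arr]
    simp [tiedCoeff]

/-- The element `E_I` fixes an arrangement whose labels at tied positions are tied. -/
theorem action_partE_of_le (hu : u ≠ 0) {I : Setoid (Fin (m + 1))} (f : Equiv.Perm (Fin (m + 1)))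
    (h : ∀ x y, I x y → J (f x) (f y)) : action u J (partE u I) (arr L f) = arr L f := by
  classical
  have key : ∀ l : List (Fin m × Fin m), (∀ p ∈ l, I p.1.castSucc p.2.succ) →
      action u J ((l.map fun p => (ties hu m).pair p.1.castSucc p.2.succ).prod) (arr L f) =
        arr L f := by
    intro l hl
    induction l with
    | nil => simp
    | cons p l ih =>
      rw [List.map_cons, List.prod_cons, map_mul, Module.End.mul_apply,
        ih fun q hq => hl q (by simp [hq]), action_pair, opTie_arr, tiedCoeff,
        if_pos (h _ _ (hl p (by simp))), one_smul]
  rw [partE_eq_part hu]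
  refine key _ fun p hp => ?_
  simp only [List.mem_filter, decide_eq_true_eq] at hp
  exact hp.2.2

theorem action_partE_of_not (hu : u ≠ 0) {I : Setoid (Fin (m + 1))} (f : Equiv.Perm (Fin (m + 1)))
    {x y : Fin (m + 1)} (hI : I x y) (hJ : ¬ J (f x) (f y)) :
    action u J (partE u I) (arr L f) = 0 := by
  rw [partE_eq_part hu, ← (ties hu m).part_mul_pair hI, map_mul, Module.End.mul_apply,
    action_pair, opTie_arr, tiedCoeff, if_neg hJ, zero_smul, map_zero]

/-- As long as the labels involved increase, braid generators act by exchange alone, and a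
descending product acts as its cycle. -/
theorem action_descT {f : Equiv.Perm (Fin (m + 1))} {a : ℕ} (i : ℕ) (hai : a ≤ i) (hi : i ≤ m)
    (hf : ∀ p q : Fin (m + 1), p < q → (q : ℕ) ≤ i → f p < f q) :
    ∃ g : Equiv.Perm (Fin (m + 1)), action u J (descT u m i (a + 1)) (arr L f) = arr L g ∧
      ∀ p, g p = f (cyc m i a hi p) := by
  induction i, hai using Nat.le_induction with
  | base =>
    refine ⟨f, by rw [descT_of_le le_rfl]; simp, fun p => ?_⟩
    congr 1
    apply Fin.ext
    simp only [cyc]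
    split_ifs <;> omega
  | succ i hai ih =>
    obtain ⟨g, hg, hgf⟩ := ih (by omega) fun p q hpq hq => hf p q hpq (by omega)
    have hlt : g (⟨i, by omega⟩ : Fin m).castSucc < g (⟨i, by omega⟩ : Fin m).succ := by
      rw [hgf, hgf]
      refine hf _ _ ?_ ?_
      · simp only [cyc, Fin.lt_def, Fin.val_castSucc, Fin.val_succ]
        split_ifs <;> omega
      · simp only [cyc, Fin.val_succ]
        split_ifs <;> omega
    refine ⟨g * Equiv.swap (⟨i, by omega⟩ : Fin m).castSucc (⟨i, by omega⟩ : Fin m).succ, ?_, ?_⟩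
    · rw [descT_left hai (by omega), map_mul, Module.End.mul_apply, hg, action_T, opT_arr,
        exchangeCoeff, stayCoeff, if_neg fun h => not_lt_of_gt hlt h.2,
        if_neg fun h => not_lt_of_gt hlt h.2, one_smul, zero_smul, add_zero]
    · intro p
      rw [Equiv.Perm.mul_apply, hgf]
      congr 1
      apply Fin.ext
      have := val_adj (⟨i, by omega⟩ : Fin m) p
      simp only [cyc, this]
      split_ifs <;> omega

theorem exists_bigT_eq_descT {i k : ℕ} (hk : k ≤ i) :
    ∃ a, a ≤ i ∧ bigT u m i k = descT u m i (a + 1) ∧ k = if a = i then 0 else a + 1 := by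
  rcases k with _ | a
  · exact ⟨i, le_rfl, by rw [descT_of_le le_rfl, bigT_zero], by simp⟩
  · exact ⟨a, by omega, rfl, by rw [if_neg (by omega)]⟩

/-- On an arrangement that increases at the positions up to `j`, a word acts by moving labels, and
the resulting arrangement determines the indices of the word. -/
theorem action_wordTo (j : ℕ) (hj : j ≤ m) (k : ℕ → ℕ) (hk : ∀ i, k i ≤ i)
    (f : Equiv.Perm (Fin (m + 1)))
    (hf : ∀ p q : Fin (m + 1), p < q → (q : ℕ) ≤ j → f p < f q) :
    ∃ g : Equiv.Perm (Fin (m + 1)), action u J (wordTo u m j k) (arr L f) = arr L g ∧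
      (∀ p : Fin (m + 1), j < (p : ℕ) → g p = f p) ∧
      ∀ k' : ℕ → ℕ, (∀ i, k' i ≤ i) → action u J (wordTo u m j k') (arr L f) = arr L g →
        ∀ i, i < j → k (i + 1) = k' (i + 1) := by
  induction j generalizing k f with
  | zero => exact ⟨f, by simp [wordTo], fun _ _ => rfl, fun _ _ _ i hi => by omega⟩
  | succ j ih =>
    have step : ∀ k : ℕ → ℕ, (∀ i, k i ≤ i) → ∃ (a : ℕ) (f' : Equiv.Perm (Fin (m + 1))),
        a ≤ j + 1 ∧ (k (j + 1) = if a = j + 1 then 0 else a + 1) ∧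
        action u J (bigT u m (j + 1) (k (j + 1))) (arr L f) = arr L f' ∧
        (∀ p, f' p = f (cyc m (j + 1) a hj p)) ∧
        ∀ p q : Fin (m + 1), p < q → (q : ℕ) ≤ j → f' p < f' q := by
      intro k hk
      obtain ⟨a, ha, hb, hka⟩ := exists_bigT_eq_descT (u := u) (m := m) (hk (j + 1))
      obtain ⟨f', hf', hff'⟩ := action_descT (u := u) J (j + 1) ha hj hf
      refine ⟨a, f', ha, hka, by rw [hb, hf'], hff', fun p q hpq hq => ?_⟩
      rw [hff', hff']
      have : (p : ℕ) < q := hpq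
      refine hf _ _ ?_ ?_
      · simp only [cyc, Fin.lt_def]
        split_ifs <;> omega
      · simp only [cyc]
        split_ifs <;> omega
    obtain ⟨a, f₁, ha, hka, hf₁, hcyc, hinc⟩ := step k hk
    obtain ⟨g, hg, hfix, huniq⟩ := ih (by omega) k hk f₁ hinc
    refine ⟨g, ?_, ?_, ?_⟩
    · rw [wordTo_succ, map_mul, Module.End.mul_apply, hf₁, hg]
    · intro p hp
      rw [hfix p (by omega), hcyc]
      congr 1
      apply Fin.ext
      simp only [cyc]
      split_ifs <;> omega
    · intro k' hk' hact
      obtain ⟨a', f₂, ha', hka', hf₂, hcyc', hinc'⟩ := step k' hk'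
      rw [wordTo_succ, map_mul, Module.End.mul_apply, hf₂] at hact
      obtain ⟨g', hg', hfix', -⟩ := ih (by omega) k' hk' f₂ hinc'
      obtain rfl : g' = g := Finsupp.single_left_injective one_ne_zero (hg'.symm.trans hact)
      -- the label at position `j + 1` determines the last factor
      have haa : a = a' := by
        have h1 := hfix ⟨j + 1, by omega⟩ (by simp)
        have h2 := hfix' ⟨j + 1, by omega⟩ (by simp)
        rw [hcyc] at h1
        rw [hcyc', h1] at h2
        have h3 := congrArg Fin.val (f.injective h2)
        simp only [cyc] at h3
        split_ifs at h3 <;> omega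
      have hff : f₁ = f₂ := by
        ext p
        rw [hcyc, hcyc', haa]
      intro i hi
      rcases eq_or_ne i j with rfl | hne
      · rw [hka, hka', haa]
      · exact huniq k' hk' (hff ▸ hact) i (by omega)

/-- Indices `k_1, …, k_m` with `k_j ≤ j`, and a partition. -/
abbrev WordIndex (m : ℕ) : Type := ((j : Fin m) → Fin (j + 2)) × Setoid (Fin (m + 1))

/-- The sequence `k` of a word, extended by `0`. -/
def extend (k : (j : Fin m) → Fin (j + 2)) : ℕ → ℕ
  | 0 => 0
  | i + 1 => if h : i < m then k ⟨i, h⟩ else 0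

theorem extend_le (k : (j : Fin m) → Fin (j + 2)) (i : ℕ) : extend k i ≤ i := by
  rcases i with _ | i
  · exact le_rfl
  · rw [extend]
    split_ifs with h
    · exact Nat.lt_succ_iff.1 (k ⟨i, h⟩).isLt
    · exact Nat.zero_le _

theorem exists_extend {k : ℕ → ℕ} (hk : ∀ i, k i ≤ i) :
    ∃ k' : (j : Fin m) → Fin (j + 2), ∀ i, i < m → extend k' (i + 1) = k (i + 1) := by
  refine ⟨fun j => ⟨k (j + 1), Nat.lt_succ_iff.2 (hk _)⟩, fun i hi => ?_⟩
  simp [extend, hi]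

theorem word_extend {k : ℕ → ℕ} (hk : ∀ i, k i ≤ i) :
    ∃ k' : (j : Fin m) → Fin (j + 2), (∀ i, i < m → extend k' (i + 1) = k (i + 1)) ∧
      word u m (extend k') = word u m k := by
  obtain ⟨k', hk'⟩ := exists_extend (m := m) hk
  exact ⟨k', hk', wordTo_congr hk'⟩

variable (u m) in
/-- The products `𝕋_{1,k_1} ⋯ 𝕋_{m,k_m} E_I` as a family. -/
noncomputable def wordFamily (p : WordIndex m) : BT u m := word u m (extend p.1) * partE u p.2

theorem extend_injective {k k' : (j : Fin m) → Fin (j + 2)}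
    (h : ∀ i, i < m → extend k (i + 1) = extend k' (i + 1)) : k = k' := by
  funext j
  have := h j j.isLt
  simp only [extend, j.isLt, dif_pos] at this
  exact Fin.ext this

/-- The coefficient of the action with parameter `J` at the arrangement produced by a word `k` is
the sum of the coefficients of `(k, I)` over `I ≤ J`; these sums determine the single coefficients.
-/
theorem linearIndependent_wordFamily (hu : u ≠ 0) : LinearIndependent L (wordFamily u m) := by
  classical
  have : Finite (Setoid (Fin (m + 1))) :=
    Finite.of_injective (fun s => (s.r : Fin (m + 1) → Fin (m + 1) → Prop))
      fun s t h => Setoid.ext fun a b => by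
        have := congrFun (congrFun h a) b
        exact iff_of_eq this
  have := Fintype.ofFinite (Setoid (Fin (m + 1)))
  rw [Fintype.linearIndependent_iff]
  intro c hc
  have hid : ∀ p q : Fin (m + 1), p < q → (q : ℕ) ≤ m →
      (1 : Equiv.Perm (Fin (m + 1))) p < (1 : Equiv.Perm (Fin (m + 1))) q := fun p q h _ => h
  have key : ∀ (k : (j : Fin m) → Fin (j + 2)) (J : Setoid (Fin (m + 1))),
      ∑ I ∈ Finset.univ.filter (· ≤ J), c (k, I) = 0 := by
    intro k J
    choose π hπ _ hπk using fun k : (j : Fin m) → Fin (j + 2) =>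
      action_wordTo (u := u) J m le_rfl (extend k) (extend_le k) 1 hid
    have h1 := congrArg (fun x => action u J x (arr L 1) (π k)) hc
    simp only [map_sum, map_smul, LinearMap.sum_apply, LinearMap.smul_apply, map_zero,
      LinearMap.zero_apply, Finsupp.coe_finsetSum, Finset.sum_apply, Finsupp.smul_apply,
      Finsupp.zero_apply, smul_eq_mul] at h1
    have h2 : ∀ p : WordIndex m, action u J (wordFamily u m p) (arr L 1) (π k) =
        if p.2 ≤ J ∧ p.1 = k then 1 else 0 := by
      rintro ⟨k', I⟩
      rw [wordFamily, map_mul, Module.End.mul_apply]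
      by_cases hI : I ≤ J
      · rw [action_partE_of_le J hu 1 fun x y hxy => hI hxy, word_eq_wordTo, hπ k', arr,
          Finsupp.single_apply]
        by_cases hk : k' = k
        · simp [hI, hk]
        · rw [if_neg, if_neg fun h => hk h.2]
          intro h
          exact hk (extend_injective (hπk k' _ (extend_le k) (h ▸ hπ k)))
      · obtain ⟨x, y, hxy, hJ⟩ : ∃ x y, I x y ∧ ¬ J x y := by
          by_contra! hcon
          exact hI fun {x y} h => hcon x y h
        rw [action_partE_of_not J hu 1 hxy hJ, map_zero, if_neg fun h => hI h.1]
        rfl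
    simp only [h2, mul_ite, mul_one, mul_zero] at h1
    rw [Fintype.sum_prod_type, Finset.sum_eq_single k] at h1
    · simpa [Finset.sum_filter] using h1
    · intro k' _ hk'
      simp [hk']
    · simp
  have hzero : ∀ (k : (j : Fin m) → Fin (j + 2)) (J : Setoid (Fin (m + 1))), c (k, J) = 0 := by
    intro k J
    refine WellFoundedLT.induction (motive := fun J => c (k, J) = 0) J fun J ih => ?_
    have h := key k J
    rw [Finset.sum_eq_single J] at h
    · exact h
    · exact fun I hI hne => ih I (lt_of_le_of_ne (Finset.mem_filter.1 hI).2 hne)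
    · intro hJ
      exact absurd (by simp) hJ
  exact fun p => hzero p.1 p.2

/-- The products `𝕋_{1,k_1} ⋯ 𝕋_{m,k_m} E_I` as a basis. -/
noncomputable def wordBasis (hu : u ≠ 0) (m : ℕ) : Module.Basis (WordIndex m) L (BT u m) :=
  Module.Basis.mk (linearIndependent_wordFamily (m := m) hu) (by
    intro x _
    refine Submodule.span_mono ?_ (mem_span_word hu x)
    rintro _ ⟨k, I, hk, rfl⟩
    obtain ⟨k', -, hk'⟩ := word_extend (u := u) (m := m) hk
    exact ⟨(k', I), by rw [wordFamily, hk']⟩)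

theorem wordBasis_apply (hu : u ≠ 0) (p : WordIndex m) :
    wordBasis hu m p = word u m (extend p.1) * partE u p.2 := by
  rw [wordBasis, Module.Basis.mk_apply, wordFamily]

theorem existsUnique_isRelTrace (hu : u ≠ 0) (A B : L) (m : ℕ) :
    ∃! r : BT u (m + 1) →ₗ[L] BT u m, IsRelTrace u A B m r := by
  classical
  have huniq : ∀ r r' : BT u (m + 1) →ₗ[L] BT u m, IsRelTrace u A B m r →
      IsRelTrace u A B m r' → r = r' := by
    intro r r' h h'
    ext x
    induction x using word_induction hu with
    | hw k I hk =>
      by_cases h0 : k (m + 1) = 0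
      · by_cases hs : LastInSupp I
        · rw [h.mem k I hk h0 hs, h'.mem k I hk h0 hs]
        · rw [h.notMem k I hk h0 hs, h'.notMem k I hk h0 hs]
      · rw [h.braid k I hk h0, h'.braid k I hk h0]
    | h0 => simp
    | hadd x y hx hy => rw [map_add, map_add, hx, hy]
    | hsmul c x hx => rw [map_smul, map_smul, hx]
  let r : BT u (m + 1) →ₗ[L] BT u m := (wordBasis hu (m + 1)).constr L fun p =>
    if extend p.1 (m + 1) = 0 then
      (if LastInSupp p.2 then B else 1) • (word u m (extend p.1) * partE u (removeLast p.2))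
    else A • (word u m (extend p.1) * descT u m m (extend p.1 (m + 1)) *
      partE u (tau (extend p.1 (m + 1)) p.2))
  have hr : ∀ (k : ℕ → ℕ) (I : Setoid (Fin (m + 2))), (∀ j, k j ≤ j) →
      r (word u (m + 1) k * partE u I) = if k (m + 1) = 0 then
      (if LastInSupp I then B else 1) • (word u m k * partE u (removeLast I))
      else A • (word u m k * descT u m m (k (m + 1)) * partE u (tau (k (m + 1)) I)) := by
    intro k I hk
    obtain ⟨k', hk', hw⟩ := word_extend (u := u) (m := m + 1) hk
    have hw' : word u m (extend k') = word u m k := wordTo_congr fun i hi => hk' i (by omega)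
    have h1 := (wordBasis hu (m + 1)).constr_basis L (fun p =>
      if extend p.1 (m + 1) = 0 then
      (if LastInSupp p.2 then B else 1) • (word u m (extend p.1) * partE u (removeLast p.2))
      else A • (word u m (extend p.1) * descT u m m (extend p.1 (m + 1)) *
        partE u (tau (extend p.1 (m + 1)) p.2))) (k', I)
    rw [wordBasis_apply] at h1
    simp only [hw, hw', hk' m (by omega)] at h1
    exact h1
  refine ⟨r, ⟨?_, ?_, ?_⟩, fun r' hr' => huniq _ _ hr' ⟨?_, ?_, ?_⟩⟩
  all_goals first
    | (intro k I hk h0 hs; rw [hr k I hk, if_pos h0]; simp [hs])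
    | (intro k I hk h0; rw [hr k I hk, if_neg h0])

end Independence

/-! ### Identifying the last strand with another strand -/

section Collapse

variable {m : ℕ}

/-- The map of strands that identifies the last strand with the strand `j`. -/
def collapse (j : Fin (m + 1)) (x : Fin (m + 2)) : Fin (m + 1) :=
  if h : (x : ℕ) < m + 1 then ⟨x, h⟩ else j

theorem val_collapse (j : Fin (m + 1)) (x : Fin (m + 2)) :
    (collapse j x : ℕ) = if (x : ℕ) < m + 1 then (x : ℕ) else j := by
  unfold collapse; split_ifs <;> rfl

theorem collapse_castSucc (j x : Fin (m + 1)) : collapse j x.castSucc = x := by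
  apply Fin.ext; rw [val_collapse, Fin.val_castSucc, if_pos x.isLt]

theorem collapse_last (j : Fin (m + 1)) : collapse j (Fin.last (m + 1)) = j := by
  apply Fin.ext; rw [val_collapse]; simp

theorem map_castSucc_map_collapse (J : Setoid (Fin (m + 1))) (j : Fin (m + 1)) :
    (J.map Fin.castSucc).map (collapse j) = J := by
  rw [setoidMap_map]
  have : collapse j ∘ Fin.castSucc = id := funext fun x => collapse_castSucc j x
  rw [this, setoidMap_id]

theorem removeLast_le_map (I : Setoid (Fin (m + 2))) (j : Fin (m + 1)) :
    removeLast I ≤ I.map (collapse j) := by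
  intro x y h
  have := setoidMap_rel (collapse j) (show I x.castSucc y.castSucc from h)
  rwa [collapse_castSucc, collapse_castSucc] at this

theorem removeLast_eq_map_of_rel {I : Setoid (Fin (m + 2))} {j : Fin (m + 1)}
    (h : I j.castSucc (Fin.last (m + 1))) : removeLast I = I.map (collapse j) := by
  refine le_antisymm (removeLast_le_map I j) (setoidMap_le_iff.2 fun x y hxy => ?_)
  have key : ∀ z, I (collapse j z).castSucc z := by
    intro z
    refine Fin.lastCases ?_ (fun z => ?_) z
    · rw [collapse_last]; exact h
    · rw [collapse_castSucc]
  exact I.trans (key x) (I.trans hxy (I.symm (key y)))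

theorem removeLast_eq_map_of_not {I : Setoid (Fin (m + 2))} (h : ¬ LastInSupp I)
    (j : Fin (m + 1)) : removeLast I = I.map (collapse j) := by
  refine le_antisymm (removeLast_le_map I j) (setoidMap_le_iff.2 fun x y hxy => ?_)
  rcases eq_or_ne x y with rfl | hne
  · exact Setoid.refl' (Setoid.comap (collapse j) (removeLast I)) x
  have hx : x ≠ Fin.last (m + 1) := by
    rintro rfl; exact h ⟨y, hne.symm, I.symm hxy⟩
  have hy : y ≠ Fin.last (m + 1) := by
    rintro rfl; exact h ⟨x, hne, hxy⟩
  obtain ⟨x, rfl⟩ := Fin.exists_castSucc_eq.2 hx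
  obtain ⟨y, rfl⟩ := Fin.exists_castSucc_eq.2 hy
  change I (collapse j x.castSucc).castSucc (collapse j y.castSucc).castSucc
  rwa [collapse_castSucc, collapse_castSucc]

/-- Removing the last strand is identifying it with some other strand: one of its block, or any
strand if the block is a singleton. -/
theorem exists_removeLast_eq_map (I : Setoid (Fin (m + 2))) : ∃ j : Fin (m + 1),
    (∀ J : Setoid (Fin (m + 2)), I ≤ J → (LastInSupp J → LastInSupp I) →
      removeLast J = J.map (collapse j)) := by
  by_cases h : LastInSupp I
  · obtain ⟨x, hx, hI⟩ := h
    obtain ⟨j, rfl⟩ := Fin.exists_castSucc_eq.2 hx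
    exact ⟨j, fun J hJ _ => removeLast_eq_map_of_rel (hJ hI)⟩
  · exact ⟨0, fun J _ hJ => removeLast_eq_map_of_not (fun h' => h (hJ h')) 0⟩

/-- Merging the blocks of a strand and of the last strand, and removing the last strand, is taking
the image under `collapse`. -/
theorem tau_eq_map (j : Fin (m + 1)) (I : Setoid (Fin (m + 2))) :
    tau (j + 1) I = I.map (collapse j) := by
  have hlink : (Relation.EqvGen.setoid fun x y : Fin (m + 2) =>
      (x : ℕ) + 1 = (j : ℕ) + 1 ∧ y = Fin.last (m + 1)) = link j.castSucc (Fin.last (m + 1)) := by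
    rw [link]
    congr 1
    funext x y
    simp [Fin.ext_iff]
  rw [tau, hlink, removeLast_eq_map_of_rel (j := j)
    ((le_sup_right : link j.castSucc (Fin.last (m + 1)) ≤ _) (link_rel _ _)),
    setoidMap_sup, setoidMap_link, collapse_castSucc, collapse_last]
  exact sup_eq_left.2 (link_le_iff.2 (Setoid.refl' _ _))

theorem lastInSupp_sup {I : Setoid (Fin (m + 2))} {J : Setoid (Fin (m + 1))} :
    LastInSupp (I ⊔ J.map Fin.castSucc) ↔ LastInSupp I := by
  constructor
  · intro h
    by_contra hI
    obtain ⟨x, hx, hxl⟩ := h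
    -- the partition into the last strand and the remaining ones
    let K : Setoid (Fin (m + 2)) := Setoid.ker fun x => x = Fin.last (m + 1)
    have hK : I ⊔ J.map Fin.castSucc ≤ K := by
      refine sup_le (fun a b hab => ?_) (setoidMap_le_iff.2 fun a b _ => ?_)
      · by_cases ha : a = Fin.last (m + 1) <;> by_cases hb : b = Fin.last (m + 1)
        · simp [K, ha, hb]
        · exact absurd ⟨b, hb, I.symm (ha ▸ hab)⟩ hI
        · exact absurd ⟨a, ha, hb ▸ hab⟩ hI
        · change (a = _) = (b = _)
          simp [ha, hb]
      · change (a.castSucc = _) = (b.castSucc = _)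
        simp [Fin.castSucc_ne_last]
    have : (x = Fin.last (m + 1)) = (Fin.last (m + 1) = Fin.last (m + 1)) := hK hxl
    exact hx (by rw [this])
  · rintro ⟨x, hx, h⟩
    exact ⟨x, hx, (le_sup_left : I ≤ I ⊔ _) h⟩

/-- Ties that avoid the last strand can be added before or after removing it. -/
theorem removeLast_sup (I : Setoid (Fin (m + 2))) (J : Setoid (Fin (m + 1))) :
    removeLast (I ⊔ J.map Fin.castSucc) = removeLast I ⊔ J := by
  obtain ⟨j, hj⟩ := exists_removeLast_eq_map I
  rw [hj _ le_sup_left lastInSupp_sup.1, hj I le_rfl id, setoidMap_sup,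
    map_castSucc_map_collapse]

theorem adj_adj {n : ℕ} (i : Fin n) (x : Fin (n + 1)) : adj i (adj i x) = x := by simp

theorem map_adj {n : ℕ} (i : Fin n) (I : Setoid (Fin (n + 1))) :
    I.map (adj i) = I.comap (adj i) := by
  refine le_antisymm (setoidMap_le_iff.2 fun x y h => ?_) fun x y h => ?_
  · change I (adj i (adj i x)) (adj i (adj i y))
    rwa [adj_adj, adj_adj]
  · have := setoidMap_rel (adj i) (show I (adj i x) (adj i y) from h)
    rwa [adj_adj, adj_adj] at this

theorem adj_castSucc_castSucc (i : Fin m) (x : Fin (m + 1)) :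
    adj i.castSucc x.castSucc = (adj i x).castSucc := by
  apply Fin.ext
  simp only [val_adj, Fin.val_castSucc]

theorem adj_castSucc_last (i : Fin m) :
    adj i.castSucc (Fin.last (m + 1)) = Fin.last (m + 1) := by
  apply Fin.ext
  have := i.isLt
  rw [val_adj]
  simp only [Fin.val_castSucc, Fin.val_last]
  split_ifs <;> omega

theorem removeLast_map_adj (i : Fin m) (I : Setoid (Fin (m + 2))) :
    removeLast (I.map (adj i.castSucc)) = (removeLast I).map (adj i) := by
  rw [map_adj, map_adj]
  ext x y
  change I (adj i.castSucc x.castSucc) (adj i.castSucc y.castSucc) ↔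
    I (adj i x).castSucc (adj i y).castSucc
  rw [adj_castSucc_castSucc, adj_castSucc_castSucc]

theorem lastInSupp_map_adj (i : Fin m) (I : Setoid (Fin (m + 2))) :
    LastInSupp (I.map (adj i.castSucc)) ↔ LastInSupp I := by
  rw [map_adj]
  constructor
  · rintro ⟨x, hx, h⟩
    change I (adj i.castSucc x) (adj i.castSucc (Fin.last (m + 1))) at h
    rw [adj_castSucc_last] at h
    refine ⟨_, fun hx' => hx ?_, h⟩
    rw [← adj_adj i.castSucc x, hx', adj_castSucc_last]
  · rintro ⟨x, hx, h⟩
    refine ⟨adj i.castSucc x, fun hx' => hx ?_, ?_⟩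
    · rw [← adj_adj i.castSucc x, hx', adj_castSucc_last]
    · change I (adj i.castSucc _) (adj i.castSucc (Fin.last (m + 1)))
      rwa [adj_castSucc_last, adj_adj]

/-- Images under two maps agree modulo ties between their values. -/
theorem sup_map_congr {α β : Type*} (I : Setoid α) {K : Setoid β} {f g : α → β}
    (h : ∀ x, K (f x) (g x)) : K ⊔ I.map f = K ⊔ I.map g := by
  have key : ∀ {f g : α → β}, (∀ x, K (f x) (g x)) → K ⊔ I.map f ≤ K ⊔ I.map g := by
    intro f g h
    refine sup_le le_sup_left (setoidMap_le_iff.2 fun x y hxy => ?_)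
    have h1 : ∀ x, (K ⊔ I.map g) (f x) (g x) := fun x => (le_sup_left : K ≤ _) (h x)
    have h2 : (K ⊔ I.map g) (g x) (g y) :=
      (le_sup_right : I.map g ≤ _) (setoidMap_rel g hxy)
    change (K ⊔ I.map g) (f x) (f y)
    exact Setoid.trans' _ (h1 x) (Setoid.trans' _ h2 (Setoid.symm' _ (h1 y)))
  exact le_antisymm (key h) (key fun x => K.symm (h x))

end Collapse

/-! ### The relative trace as a map of bimodules -/

section RelTrace

variable {L : Type*} [Field L] {u : L} {m : ℕ}

open Classical in
/-- The factor by which a relative trace multiplies `E_I`. -/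
noncomputable def suppCoeff (B : L) (I : Setoid (Fin (m + 1))) : L := if LastInSupp I then B else 1

/-- The algebra on `m + 2` strands is spanned, as a left module over the algebra on `m + 1` strands,
by the elements `E_I` and `𝕋_{m+1,a+1} E_I`. -/
theorem BT_succ_induction (hu : u ≠ 0) {p : BT u (m + 1) → Prop}
    (h0 : ∀ (w : BT u m) (I : Setoid (Fin (m + 2))), p (incl u m w * partE u I))
    (h1 : ∀ (w : BT u m) (a : ℕ) (I : Setoid (Fin (m + 2))), a ≤ m →
      p (incl u m w * descT u (m + 1) (m + 1) (a + 1) * partE u I))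
    (hadd : ∀ x y, p x → p y → p (x + y)) (hsmul : ∀ (c : L) x, p x → p (c • x))
    (x : BT u (m + 1)) : p x := by
  refine word_induction hu (fun k I hk => ?_) ?_ hadd hsmul x
  · rw [word_succ]
    have := hk (m + 1)
    generalize k (m + 1) = b at this
    rcases b with _ | a
    · rw [bigT_zero, mul_one]; exact h0 _ _
    · exact h1 _ a I (by omega)
  · have := h0 0 ⊥
    rwa [map_zero, zero_mul] at this

variable {A B : L} {r : BT u (m + 1) →ₗ[L] BT u m}

namespace IsRelTrace

/-- The rule for words without a last factor, for arbitrary elements of the smaller algebra. -/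
theorem apply_partE (hr : IsRelTrace u A B m r) (hu : u ≠ 0) (w : BT u m)
    (I : Setoid (Fin (m + 2))) :
    r (incl u m w * partE u I) = suppCoeff B I • (w * partE u (removeLast I)) := by
  classical
  induction w using word_induction hu with
  | hw k J hk =>
    have hk' : ∀ j, Function.update k (m + 1) 0 j ≤ j := by
      intro j
      rcases eq_or_ne j (m + 1) with rfl | hne
      · simp
      · simpa [hne] using hk j
    have hw : word u m (Function.update k (m + 1) 0) = word u m k :=
      wordTo_congr fun i hi => by rw [Function.update_of_ne (by omega)]
    have h1 : incl u m (word u m k * partE u J) * partE u I =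
        word u (m + 1) (Function.update k (m + 1) 0) * partE u (I ⊔ J.map Fin.castSucc) := by
      rw [word_succ, hw, Function.update_self, bigT_zero, mul_one, map_mul, incl_partE hu,
        mul_assoc, sup_comm, partE_sup hu]
    have h2 : word u m k * partE u J * partE u (removeLast I) =
        word u m k * partE u (removeLast (I ⊔ J.map Fin.castSucc)) := by
      rw [removeLast_sup, mul_assoc, sup_comm, partE_sup hu]
    rw [h1, h2, suppCoeff]
    by_cases hs : LastInSupp I
    · rw [hr.mem _ _ hk' (by simp) (lastInSupp_sup.2 hs), if_pos hs, hw]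
    · rw [hr.notMem _ _ hk' (by simp) (mt lastInSupp_sup.1 hs), if_neg hs, hw, one_smul]
  | h0 => simp
  | hadd x y hx hy => simp only [map_add, add_mul, hx, hy, smul_add]
  | hsmul c x hx => simp only [map_smul, smul_mul_assoc, hx, smul_comm c]

/-- The rule for words with a last factor, for arbitrary elements of the smaller algebra. -/
theorem apply_descT (hr : IsRelTrace u A B m r) (hu : u ≠ 0) (w : BT u m) {a : ℕ} (ha : a < m + 1)
    (I : Setoid (Fin (m + 2))) :
    r (incl u m w * descT u (m + 1) (m + 1) (a + 1) * partE u I) =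
      A • (w * descT u m m (a + 1) * partE u (I.map (collapse ⟨a, ha⟩))) := by
  classical
  induction w using word_induction hu with
  | hw k J hk =>
    have hk' : ∀ j, Function.update k (m + 1) (a + 1) j ≤ j := by
      intro j
      rcases eq_or_ne j (m + 1) with rfl | hne
      · simpa using ha
      · simpa [hne] using hk j
    have hw : word u m (Function.update k (m + 1) (a + 1)) = word u m k :=
      wordTo_congr fun i hi => by rw [Function.update_of_ne (by omega)]
    have h1 : incl u m (word u m k * partE u J) * descT u (m + 1) (m + 1) (a + 1) * partE u I =
        word u (m + 1) (Function.update k (m + 1) (a + 1)) *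
          partE u ((J.map Fin.castSucc).map (cyc (m + 1) (m + 1) a le_rfl) ⊔ I) := by
      rw [word_succ, hw, Function.update_self, bigT_succ, map_mul, incl_partE hu,
        mul_assoc (incl u m (word u m k)), partE_mul_descT' hu le_rfl ha.le, partE_sup hu]
      simp only [mul_assoc]
    have hcyc : (collapse ⟨a, ha⟩ ∘ cyc (m + 1) (m + 1) a le_rfl) ∘ Fin.castSucc =
        cyc m m a le_rfl := by
      funext x
      apply Fin.ext
      have := x.isLt
      simp only [Function.comp, val_collapse, cyc, Fin.val_castSucc]
      split_ifs <;> omega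
    have h2 := hr.braid _ ((J.map Fin.castSucc).map (cyc (m + 1) (m + 1) a le_rfl) ⊔ I) hk'
      (by simp)
    rw [h1, h2, hw, Function.update_self]
    have h3 := tau_eq_map ⟨a, ha⟩
      ((J.map Fin.castSucc).map (cyc (m + 1) (m + 1) a le_rfl) ⊔ I)
    simp only at h3
    rw [h3, setoidMap_sup, setoidMap_map, setoidMap_map, hcyc, partE_sup hu,
      mul_assoc (word u m k) (partE u J), partE_mul_descT' hu le_rfl (by omega)]
    simp only [mul_assoc]
  | h0 => simp
  | hadd x y hx hy => simp only [map_add, add_mul, hx, hy, smul_add]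
  | hsmul c x hx => simp only [map_smul, smul_mul_assoc, hx, smul_comm c]

theorem incl_mul (hr : IsRelTrace u A B m r) (hu : u ≠ 0) (x : BT u m) (Z : BT u (m + 1)) :
    r (incl u m x * Z) = x * r Z := by
  induction Z using BT_succ_induction hu with
  | h0 w I =>
    rw [← mul_assoc, ← map_mul, hr.apply_partE hu, hr.apply_partE hu, mul_smul_comm, mul_assoc]
  | h1 w a I ha =>
    rw [← mul_assoc, ← mul_assoc, ← map_mul, hr.apply_descT hu _ (Nat.lt_succ_iff.2 ha),
      hr.apply_descT hu _ (Nat.lt_succ_iff.2 ha), mul_smul_comm]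
    simp only [mul_assoc]
  | hadd y z hy hz => rw [mul_add, map_add, map_add, hy, hz, mul_add]
  | hsmul c y hy => rw [mul_smul_comm, map_smul, map_smul, hy, mul_smul_comm]

theorem mul_incl_partE (hr : IsRelTrace u A B m r) (hu : u ≠ 0) (Z : BT u (m + 1))
    (J : Setoid (Fin (m + 1))) : r (Z * incl u m (partE u J)) = r Z * partE u J := by
  induction Z using BT_succ_induction hu with
  | h0 w I =>
    rw [incl_partE hu, mul_assoc, ← partE_sup hu, hr.apply_partE hu, hr.apply_partE hu,
      removeLast_sup, suppCoeff, suppCoeff, lastInSupp_sup, partE_sup hu, smul_mul_assoc,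
      mul_assoc]
  | h1 w a I ha =>
    rw [incl_partE hu, mul_assoc, ← partE_sup hu, hr.apply_descT hu _ (Nat.lt_succ_iff.2 ha),
      hr.apply_descT hu _ (Nat.lt_succ_iff.2 ha), setoidMap_sup, map_castSucc_map_collapse,
      partE_sup hu, smul_mul_assoc, mul_assoc _ _ (partE u J)]
  | hadd y z hy hz => rw [add_mul, map_add, map_add, hy, hz, add_mul]
  | hsmul c y hy => rw [smul_mul_assoc, map_smul, map_smul, hy, smul_mul_assoc]

/-- Moving `T_j` through the last factor has the same four cases before and after applying `r`. The
two quadratic relations have different ties in general, but these agree once the strands `j` and `j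
+ 1` are tied, as they are in the terms concerned. -/
theorem mul_incl_T (hr : IsRelTrace u A B m r) (hu : u ≠ 0) (j : Fin m) (Z : BT u (m + 1)) :
    r (Z * incl u m (T u j)) = r Z * T u j := by
  have hjm := j.isLt
  induction Z using BT_succ_induction hu with
  | h0 w I =>
    rw [mul_assoc, incl_T, partE_mul_T hu, ← mul_assoc, ← incl_T, ← map_mul, hr.apply_partE hu,
      hr.apply_partE hu, removeLast_map_adj, suppCoeff, suppCoeff, lastInSupp_map_adj,
      smul_mul_assoc, mul_assoc _ _ (T u j), partE_mul_T hu, mul_assoc]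
  | h1 w a I ha =>
    have ha' : a < m + 1 := Nat.lt_succ_iff.2 ha
    rw [hr.apply_descT hu _ ha', smul_mul_assoc, mul_assoc _ _ (T u j), partE_mul_T hu,
      mul_assoc _ _ (incl u m _), incl_T, partE_mul_T hu, ← mul_assoc, ← mul_assoc,
      mul_assoc _ _ (T u _), mul_assoc _ _ (T u _)]
    have hcomm : (j : ℕ) ≠ a → (j : ℕ) + 1 ≠ a →
        ((I.map (adj j.castSucc)).map (collapse ⟨a, ha'⟩)) =
          (I.map (collapse ⟨a, ha'⟩)).map (adj j) := by
      intro h1 h2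
      rw [setoidMap_map, setoidMap_map]
      congr 1
      funext x
      apply Fin.ext
      simp only [Function.comp, val_collapse, val_adj, Fin.val_castSucc]
      split_ifs <;> omega
    rcases lt_trichotomy (j : ℕ) a with h | h | h
    · rcases eq_or_ne ((j : ℕ) + 1) a with rfl | hne
      · have h1 := descT_right (u := u) (m := m + 1) (i := m + 1) (a := j) (by omega) (by omega)
        have h2 := descT_right (u := u) (m := m) (i := m) (a := j) (by omega) (by omega)
        change descT u (m + 1) (m + 1) (j + 1) = descT u (m + 1) (m + 1) (j + 1 + 1) * T u j.castSucc
          at h1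
        change descT u m m (j + 1) = descT u m m (j + 1 + 1) * T u j at h2
        rw [← h1, ← h2, hr.apply_descT hu _ (by omega), setoidMap_map, setoidMap_map]
        congr 4
        funext x
        apply Fin.ext
        simp only [Function.comp, val_collapse, val_adj, Fin.val_castSucc]
        split_ifs <;> omega
      · rw [descT_comm_T j.castSucc (Or.inl (by simp; omega)), descT_comm_T j (Or.inl (by omega)),
          ← mul_assoc, ← incl_T, ← map_mul, hr.apply_descT hu _ ha', ← mul_assoc,
          hcomm (by omega) hne]
    · subst h
      have h1 := descT_right (u := u) (m := m + 1) (i := m + 1) (a := j) (by omega) (by omega)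
      have h2 := descT_right (u := u) (m := m) (i := m) (a := j) (by omega) (by omega)
      change descT u (m + 1) (m + 1) (j + 1) = descT u (m + 1) (m + 1) (j + 1 + 1) * T u j.castSucc
        at h1
      change descT u m m (j + 1) = descT u m m (j + 1 + 1) * T u j at h2
      have hq : ∀ {n : ℕ} (i : Fin n) (d x : BT u n),
          d * T u i = x → x * T u i = d + (u - 1) • (d * E u i + x * E u i) := by
        rintro n i d x rfl
        rw [mul_assoc, T_sq]
        simp only [mul_add, mul_one, mul_smul_comm, ET, mul_assoc]
      rw [hq _ _ _ h1.symm, hq _ _ _ h2.symm, ← partE_link hu, ← partE_link hu]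
      simp only [mul_add, add_mul, mul_smul_comm, smul_mul_assoc, map_add, map_smul, smul_add]
      rw [← mul_assoc _ _ (partE u (link _ _)), ← mul_assoc _ _ (partE u (link _ _)),
        mul_assoc _ (partE u (link _ _)), mul_assoc _ (partE u (link _ _)), ← partE_sup hu,
        hr.apply_descT hu _ (by omega), hr.apply_descT hu _ (by omega),
        hr.apply_descT hu _ (by omega),
        ← mul_assoc _ _ (partE u (link _ _)), ← mul_assoc _ _ (partE u (link _ _)),
        mul_assoc _ (partE u (link _ _)), mul_assoc _ (partE u (link _ _)), ← partE_sup hu]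
      have hs : collapse (m := m) ⟨j + 1, by omega⟩ ∘ adj j.castSucc =
          adj j ∘ collapse ⟨j, ha'⟩ := by
        funext x
        apply Fin.ext
        simp only [Function.comp, val_collapse, val_adj, Fin.val_castSucc]
        split_ifs <;> omega
      have hl : ∀ i : Fin (m + 1), link (collapse (m := m) i j.castSucc.castSucc)
          (collapse i j.castSucc.succ) = link j.castSucc j.succ := by
        intro i
        rw [collapse_castSucc, ← Fin.castSucc_succ, collapse_castSucc]
      -- by `hs`, the two maps differ only at the last strand, where the values `j` and `j + 1` are linked
      have hK : link j.castSucc j.succ ⊔ (I.map (adj j.castSucc)).map (collapse ⟨j, ha'⟩) =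
          link j.castSucc j.succ ⊔ (I.map (collapse ⟨j, ha'⟩)).map (adj j) := by
        rw [setoidMap_map, setoidMap_map, ← hs]
        refine sup_map_congr _ fun x => ?_
        refine Fin.lastCases ?_ (fun y => ?_) x
        · simp only [Function.comp]
          rw [adj_castSucc_last, collapse_last, collapse_last]
          exact link_rel _ _
        · simp only [Function.comp]
          rw [adj_castSucc_castSucc, collapse_castSucc, collapse_castSucc]
      rw [setoidMap_sup, setoidMap_sup, setoidMap_link, setoidMap_link, hl, hl, hK,
        setoidMap_map I _ (collapse ⟨j + 1, _⟩), hs, ← setoidMap_map]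
      simp only [smul_comm A]
    · obtain ⟨l, hl⟩ : ∃ l, (j : ℕ) = l + 1 := ⟨j - 1, by omega⟩
      have hlm : l + 1 < m := by omega
      obtain rfl : j = ⟨l + 1, hlm⟩ := Fin.ext hl
      have h1 := descT_mul_T_inner (u := u) (m := m + 1) (i := m + 1) (a := a) le_rfl l
        (by simp at h; omega) (by omega)
      have h2 := descT_mul_T_inner (u := u) (m := m) (i := m) (a := a) le_rfl l
        (by simp at h; omega) (by omega)
      change _ * T u (Fin.castSucc (⟨l + 1, by omega⟩ : Fin m)) =
        T u (Fin.castSucc (⟨l, by omega⟩ : Fin m)) * _ at h1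
      rw [h1, h2, ← mul_assoc, ← incl_T, ← map_mul, hr.apply_descT hu _ ha', ← mul_assoc,
        hcomm (by omega) (by simp at h ⊢; omega)]
  | hadd y z hy hz => rw [add_mul, map_add, map_add, hy, hz, add_mul]
  | hsmul c y hy => rw [smul_mul_assoc, map_smul, map_smul, hy, smul_mul_assoc]

theorem mul_incl (hr : IsRelTrace u A B m r) (hu : u ≠ 0) (x : BT u m) :
    ∀ Z : BT u (m + 1), r (Z * incl u m x) = r Z * x := by
  induction x using BT_induction with
  | hs c =>
    intro Z
    rw [AlgHom.commutes, ← Algebra.commutes, ← Algebra.smul_def, map_smul, ← Algebra.commutes,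
      ← Algebra.smul_def]
  | hT j => exact hr.mul_incl_T hu j
  | hE j =>
    intro Z
    rw [← partE_link hu, hr.mul_incl_partE hu]
  | hadd x y hx hy => intro Z; rw [map_add, mul_add, map_add, hx, hy, mul_add]
  | hmul x y hx hy => intro Z; rw [map_mul (incl u m), ← mul_assoc, hy, hx, mul_assoc]

theorem apply_incl (hr : IsRelTrace u A B m r) (hu : u ≠ 0) (x : BT u m) :
    r (incl u m x) = x := by
  have h1 := hr.apply_partE hu x ⊥
  have h2 : ¬ LastInSupp (⊥ : Setoid (Fin (m + 2))) := fun ⟨y, hy, h⟩ => hy h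
  have h3 : removeLast (⊥ : Setoid (Fin (m + 2))) = ⊥ := by
    refine le_bot_iff.1 fun x y h => ?_
    exact Fin.castSucc_injective _ (show x.castSucc = y.castSucc from h)
  rwa [partE_bot hu, mul_one, suppCoeff, if_neg h2, one_smul, h3, partE_bot hu, mul_one] at h1

theorem apply_one (hr : IsRelTrace u A B m r) (hu : u ≠ 0) : r 1 = 1 := by
  rw [← map_one (incl u m), hr.apply_incl hu]

theorem map_link_last (m : ℕ) :
    (link (Fin.last m).castSucc (Fin.last m).succ).map (collapse (Fin.last m)) = ⊥ := by
  rw [setoidMap_link, collapse_castSucc, Fin.succ_last, collapse_last]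
  exact le_bot_iff.1 (link_le_iff.2 rfl)

theorem apply_E (hr : IsRelTrace u A B m r) (hu : u ≠ 0) :
    r (E u (Fin.last m)) = B • 1 := by
  have h1 := hr.apply_partE hu 1 (link (Fin.last m).castSucc (Fin.last m).succ)
  have h0 := link_rel (Fin.last m).castSucc (Fin.last m).succ
  have h2 : LastInSupp (link (Fin.last m).castSucc (Fin.last m).succ) :=
    ⟨_, Fin.castSucc_ne_last _, h0⟩
  rwa [map_one, one_mul, partE_link hu, suppCoeff, if_pos h2, removeLast_eq_map_of_rel h0,
    map_link_last, partE_bot hu, mul_one] at h1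

theorem apply_T_mul_partE (hr : IsRelTrace u A B m r) (hu : u ≠ 0) (I : Setoid (Fin (m + 2))) :
    r (T u (Fin.last m) * partE u I) = A • partE u (I.map (collapse (Fin.last m))) := by
  have h1 := hr.apply_descT hu 1 (Nat.lt_succ_self m) I
  rw [map_one, one_mul, one_mul, descT_of_le le_rfl, one_mul, descT_left le_rfl (by omega),
    descT_of_le le_rfl, mul_one] at h1
  exact h1

theorem apply_T (hr : IsRelTrace u A B m r) (hu : u ≠ 0) : r (T u (Fin.last m)) = A • 1 := by
  have h1 := hr.apply_T_mul_partE hu ⊥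
  have h2 : (⊥ : Setoid (Fin (m + 2))).map (collapse (Fin.last m)) = ⊥ :=
    le_bot_iff.1 (setoidMap_le_iff.2 bot_le)
  rwa [h2, partE_bot hu, partE_bot hu, mul_one] at h1

theorem apply_ET (hr : IsRelTrace u A B m r) (hu : u ≠ 0) :
    r (E u (Fin.last m) * T u (Fin.last m)) = A • 1 := by
  have h1 := hr.apply_T_mul_partE hu (link (Fin.last m).castSucc (Fin.last m).succ)
  rwa [map_link_last, partE_bot hu, partE_link hu, ← ET] at h1

end IsRelTrace

end RelTrace

/-! ### Generators as a bimodule over the previous algebra -/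

section Bimodule

variable {L : Type*} [Field L] {u : L} {m : ℕ}

theorem eq_map_sup_link {I : Setoid (Fin (m + 2))} {j : Fin (m + 1)}
    (h : I j.castSucc (Fin.last (m + 1))) :
    I = (removeLast I).map Fin.castSucc ⊔ link j.castSucc (Fin.last (m + 1)) := by
  refine le_antisymm (fun x y hxy => ?_)
    (sup_le (setoidMap_le_iff.2 le_rfl) (link_le_iff.2 h))
  set K := (removeLast I).map Fin.castSucc ⊔ link j.castSucc (Fin.last (m + 1))
  have key : ∀ z, K (collapse j z).castSucc z := by
    intro z
    refine Fin.lastCases ?_ (fun z => ?_) z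
    · rw [collapse_last]
      exact (le_sup_right : link j.castSucc (Fin.last (m + 1)) ≤ K) (link_rel _ _)
    · rw [collapse_castSucc]
  have h1 : removeLast I (collapse j x) (collapse j y) := by
    rw [removeLast_eq_map_of_rel h]
    exact setoidMap_rel _ hxy
  have h2 : K (collapse j x).castSucc (collapse j y).castSucc :=
    (le_sup_left : (removeLast I).map Fin.castSucc ≤ K) (setoidMap_rel _ h1)
  exact K.trans (K.symm (key x)) (K.trans h2 (key y))

theorem eq_map_of_not {I : Setoid (Fin (m + 2))} (h : ¬ LastInSupp I) :
    I = (removeLast I).map Fin.castSucc := by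
  refine le_antisymm (fun x y hxy => ?_) (setoidMap_le_iff.2 le_rfl)
  rcases eq_or_ne x y with rfl | hne
  · exact Setoid.refl' _ x
  have hx : x ≠ Fin.last (m + 1) := by
    rintro rfl; exact h ⟨y, hne.symm, I.symm hxy⟩
  have hy : y ≠ Fin.last (m + 1) := by
    rintro rfl; exact h ⟨x, hne, hxy⟩
  obtain ⟨x, rfl⟩ := Fin.exists_castSucc_eq.2 hx
  obtain ⟨y, rfl⟩ := Fin.exists_castSucc_eq.2 hy
  exact setoidMap_rel Fin.castSucc (show removeLast I x y from hxy)

/-- The ties of the last strand are conjugates of the last tie generator by elements that do not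
involve the last strand. -/
theorem exists_span_eq_conj (hu : u ≠ 0) (d : ℕ) : ∀ x, x + d = m →
    ∃ g g' : BT u m, (ties hu (m + 1)).span x d =
      incl u m g * E u (Fin.last m) * incl u m g' := by
  induction d with
  | zero =>
    rintro x rfl
    refine ⟨1, 1, ?_⟩
    rw [map_one, one_mul, mul_one]
    exact ties_e hu (Fin.last _)
  | succ d ih =>
    intro x hx
    obtain ⟨g, g', hg⟩ := ih (x + 1) (by omega)
    refine ⟨(ties hu m).t x * g, g' * ↑((ties hu m).t x)⁻¹, ?_⟩
    rw [TieSystem.span_succ, hg, ← map_incl_ties_t hu (by omega : x < m), map_mul, map_mul]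
    simp only [mul_assoc]
    rfl

theorem list_prod_mul_partE (hu : u ≠ 0) (l : List (Fin m)) (I : Setoid (Fin (m + 1))) :
    ∃ I' : Setoid (Fin (m + 1)), (l.map (T u)).prod * partE u I =
      partE u I' * (l.map (T u)).prod := by
  induction l generalizing I with
  | nil => exact ⟨I, by simp⟩
  | cons i l ih =>
    obtain ⟨I', hI'⟩ := ih I
    exact ⟨_, by rw [List.map_cons, List.prod_cons, mul_assoc, hI', ← mul_assoc, T_mul_partE hu,
      mul_assoc]⟩

/-- The algebra on `m + 2` strands is spanned, as a bimodule over the algebra on `m + 1` strands,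
by `1`, `T`, `E` and `E T`, with the last generators. -/
theorem BT_bimodule_induction (hu : u ≠ 0) {p : BT u (m + 1) → Prop}
    (hp : ∀ (a b : BT u m) (y : BT u (m + 1)),
      (y = 1 ∨ y = T u (Fin.last m) ∨ y = E u (Fin.last m) ∨
        y = E u (Fin.last m) * T u (Fin.last m)) → p (incl u m a * y * incl u m b))
    (hadd : ∀ x y, p x → p y → p (x + y)) (hsmul : ∀ (c : L) x, p x → p (c • x))
    (x : BT u (m + 1)) : p x := by
  have hpart : ∀ I : Setoid (Fin (m + 2)), (∃ a : BT u m, partE u I = incl u m a) ∨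
      ∃ (j : Fin (m + 1)) (a : BT u m), partE u I =
        incl u m a * (ties hu (m + 1)).pair j.castSucc (Fin.last (m + 1)) := by
    intro I
    by_cases h : LastInSupp I
    · obtain ⟨x, hx, h⟩ := h
      obtain ⟨j, rfl⟩ := Fin.exists_castSucc_eq.2 hx
      right
      refine ⟨j, partE u (removeLast I), ?_⟩
      rw [incl_partE hu, ← TieSystem.part_link, ← partE_eq_part hu, ← partE_sup hu,
        ← eq_map_sup_link h]
    · left
      exact ⟨partE u (removeLast I), by rw [incl_partE hu, ← eq_map_of_not h]⟩
  induction x using BT_succ_induction hu with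
  | hadd x y hx hy => exact hadd x y hx hy
  | hsmul c x hx => exact hsmul c x hx
  | h0 w I =>
    rcases hpart I with ⟨a, ha⟩ | ⟨j, a, ha⟩
    · have := hp (w * a) 1 1 (Or.inl rfl)
      rwa [map_mul, ← ha, map_one, mul_one, mul_one] at this
    · have hj := j.isLt
      obtain ⟨g, g', hg⟩ := exists_span_eq_conj (u := u) (m := m) hu (m - j) j (by omega)
      have h1 : (ties hu (m + 1)).pair j.castSucc (Fin.last (m + 1)) =
          (ties hu (m + 1)).span j (m - j) :=
        TieSystem.pair_of_add _ (m - j) (by simp; omega)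
      have := hp (w * a * g) g' _ (Or.inr (Or.inr (Or.inl rfl)))
      rwa [map_mul, map_mul, mul_assoc _ (incl u m g), mul_assoc _ (incl u m g * _), ← hg, ← h1,
        mul_assoc, ← ha] at this
  | h1 w a I ha =>
    have hD : descT u (m + 1) (m + 1) (a + 1) =
        T u (Fin.last m) * incl u m (descT u m m (a + 1)) := by
      rw [descT_left ha (by omega), incl_descT a le_rfl]
      rfl
    obtain ⟨I', hI'⟩ := list_prod_mul_partE hu (seg (m + 1) a (m + 1)).reverse I
    rw [← descT_eq] at hI'
    rw [mul_assoc, hI', hD]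
    rcases hpart I' with ⟨b, hb⟩ | ⟨j, b, hb⟩
    · have := hp (w * b) (descT u m m (a + 1)) _ (Or.inr (Or.inl rfl))
      rwa [map_mul, ← hb, mul_assoc, mul_assoc] at this
    · by_cases hj : j = Fin.last m
      · subst hj
        have h1 : (ties hu (m + 1)).pair (Fin.last m).castSucc (Fin.last (m + 1)) =
            E u (Fin.last m) := by
          rw [← Fin.succ_last, TieSystem.pair_castSucc_succ, ties_e]
        have := hp (w * b) (descT u m m (a + 1)) _ (Or.inr (Or.inr (Or.inr rfl)))
        rw [map_mul] at this
        rw [hb, h1]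
        simpa only [mul_assoc] using this
      · have h1 : (ties hu (m + 1)).pair j.castSucc (Fin.last (m + 1)) * T u (Fin.last m) =
            T u (Fin.last m) * incl u m ((ties hu m).pair j (Fin.last m)) := by
          have h2 := (ties hu (m + 1)).t_mul_pair (Fin.last m) j.castSucc (Fin.last m).castSucc
          have hjm : (j : ℕ) ≠ m := fun h => hj (Fin.ext h)
          rw [Equiv.swap_apply_left, Equiv.swap_apply_of_ne_of_ne, ties_t] at h2
          · rw [incl_pair, h2, Fin.succ_last]
          · simpa [Fin.ext_iff] using hjm
          · exact castSucc_ne_succ (by simp; omega)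
        have := hp (w * b) ((ties hu m).pair j (Fin.last m) * descT u m m (a + 1)) _
          (Or.inr (Or.inl rfl))
        rw [map_mul, map_mul, mul_assoc _ (T u _), ← mul_assoc (T u _), ← h1] at this
        rw [hb]
        simpa only [mul_assoc] using this

theorem incl_incl_comm_T (x : BT u m) :
    incl u (m + 1) (incl u m x) * T u (Fin.last (m + 1)) =
      T u (Fin.last (m + 1)) * incl u (m + 1) (incl u m x) := by
  induction x using BT_induction with
  | hs c => simp only [AlgHom.commutes]; exact Algebra.commutes _ _
  | hT i =>
    rw [incl_T, incl_T]
    exact T_comm_of_far u (by simp)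
  | hE i =>
    rw [incl_E, incl_E]
    exact ET_comm_of_far u (Or.inl (by simp))
  | hadd x y hx hy => simp only [map_add, add_mul, mul_add, hx, hy]
  | hmul x y hx hy => simp only [map_mul, mul_assoc, hy]; simp only [← mul_assoc, hx]

theorem incl_incl_comm_E (x : BT u m) :
    incl u (m + 1) (incl u m x) * E u (Fin.last (m + 1)) =
      E u (Fin.last (m + 1)) * incl u (m + 1) (incl u m x) := by
  induction x using BT_induction with
  | hs c => simp only [AlgHom.commutes]; exact Algebra.commutes _ _
  | hT i =>
    rw [incl_T, incl_T]
    exact (ET_comm_of_far u (Or.inr (by simp))).symm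
  | hE i =>
    rw [incl_E, incl_E]
    exact E_comm u _ _
  | hadd x y hx hy => simp only [map_add, add_mul, mul_add, hx, hy]
  | hmul x y hx hy => simp only [map_mul, mul_assoc, hy]; simp only [← mul_assoc, hx]

end Bimodule

/-! ### Products of neighbouring generators -/

section AdjacentPair

variable {L : Type*} [Field L] {R : Type*} [Ring R] [Algebra L R]

/-- Two neighbouring pairs `t, e` and `t', e'` of generators of an algebra of braids and ties.

The lemmas below bring products `x y' z`, with letters `t`, `e` in `x` and `z` and primed letters in
`y'`, to a form in which unprimed letters occur only between primed ones. A name such as `et_t_e`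
stands for the product `e t * t' * e`. -/
structure AdjacentPair (u : L) (t e t' e' : R) : Prop where
  sq : t * t = 1 + (u - 1) • (e * (1 + t))
  sq' : t' * t' = 1 + (u - 1) • (e' * (1 + t'))
  e_sq : e * e = e
  e_sq' : e' * e' = e'
  et : e * t = t * e
  et' : e' * t' = t' * e'
  ee : e * e' = e' * e
  braid : t * t' * t = t' * t * t'
  ett : e * t' * t = t' * t * e'
  ett' : e' * t * t' = t * t' * e
  eet : e * e' * t = t * e * e'
  eet' : e * e' * t' = t' * e * e'
  ete : e * t' * e = t' * e' * e

namespace AdjacentPair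

variable {u : L} {t e t' e' : R}

theorem e_t_et (h : AdjacentPair u t e t' e') : e * t' * (e * t) = t' * e' * (e * t) := by
  rw [← mul_assoc, h.ete, mul_assoc]

theorem tte (h : AdjacentPair u t e t' e') : t * t' * e = e' * t * t' := h.ett'.symm

theorem et_t_e (h : AdjacentPair u t e t' e') : e * t * t' * e = e' * t * (t' * e') :=
  calc e * t * t' * e = t * (e * t' * e) := by rw [h.et]; simp only [mul_assoc]
    _ = t * t' * (e' * e) := by rw [h.ete]; simp only [mul_assoc]
    _ = t * t' * e * e' := by rw [← h.ee]; simp only [mul_assoc]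
    _ = e' * t * (t' * e') := by rw [h.tte]; simp only [mul_assoc]

theorem et_t_t (h : AdjacentPair u t e t' e') : e * t * t' * t = t' * t * (t' * e') :=
  calc e * t * t' * t = t * (e * t' * t) := by rw [h.et]; simp only [mul_assoc]
    _ = t * t' * t * e' := by rw [h.ett]; simp only [mul_assoc]
    _ = t' * t * (t' * e') := by rw [h.braid, mul_assoc]

theorem t_t_et (h : AdjacentPair u t e t' e') : t * t' * (e * t) = e' * t' * t * t' :=
  calc t * t' * (e * t) = e' * (t * t' * t) := by rw [← mul_assoc, h.tte]; simp only [mul_assoc]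
    _ = e' * t' * t * t' := by rw [h.braid]; simp only [mul_assoc]

/-- The two ties together commute with the braid generators. -/
theorem ttt_ee (h : AdjacentPair u t e t' e') :
    t * t' * (e' * e) * t = t' * e' * (e * t) * t' :=
  calc t * t' * (e' * e) * t = t * t' * (e * e' * t) := by rw [h.ee]; simp only [mul_assoc]
    _ = t * t' * t * (e * e') := by rw [h.eet]; simp only [mul_assoc]
    _ = t' * t * (t' * e * e') := by rw [h.braid]; simp only [mul_assoc]
    _ = t' * (t * e * e') * t' := by rw [← h.eet']; simp only [mul_assoc]
    _ = t' * (e' * e) * t * t' := by rw [← h.eet, h.ee]; simp only [mul_assoc]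
    _ = t' * e' * (e * t) * t' := by simp only [mul_assoc]

theorem et_t_et (h : AdjacentPair u t e t' e') :
    e * t * t' * (e * t) = t' * e' * (e * t) * t' :=
  calc e * t * t' * (e * t) = t * (e * t' * e) * t := by
        rw [← mul_assoc, h.et]; simp only [mul_assoc]
    _ = t * t' * (e' * e) * t := by rw [h.ete]; simp only [mul_assoc]
    _ = _ := h.ttt_ee

theorem e_e_t (h : AdjacentPair u t e t' e') : e * e' * t = e' * (e * t) := by
  rw [h.ee, mul_assoc]

theorem e_e_e (h : AdjacentPair u t e t' e') : e * e' * e = e' * e := by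
  rw [h.ee, mul_assoc, h.e_sq]

theorem t_e_e (h : AdjacentPair u t e t' e') : t * e' * e = e * t * e' := by
  rw [mul_assoc, ← h.ee, h.et, mul_assoc]

theorem e_e_et (h : AdjacentPair u t e t' e') : e * e' * (e * t) = e' * (e * t) := by
  rw [← mul_assoc, h.e_e_e, mul_assoc]

theorem et_e_e (h : AdjacentPair u t e t' e') : e * t * e' * e = e * t * e' := by
  rw [mul_assoc, ← h.ee, h.et, mul_assoc, ← mul_assoc e e, h.e_sq, mul_assoc]

theorem et_e_t (h : AdjacentPair u t e t' e') : e * t * e' * t = e' * (e * t * t) :=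
  calc e * t * e' * t = t * e * e' * t := by rw [h.et]
    _ = e' * (e * t * t) := by rw [← h.eet, h.ee]; simp only [mul_assoc]

theorem t_e_et (h : AdjacentPair u t e t' e') : t * e' * (e * t) = e' * (e * t * t) :=
  calc t * e' * (e * t) = e * t * e' * t := by rw [← mul_assoc, h.t_e_e]
    _ = _ := h.et_e_t

theorem et_e_et (h : AdjacentPair u t e t' e') : e * t * e' * (e * t) = e' * (e * t * t) := by
  rw [← mul_assoc, h.et_e_e, h.et_e_t]

theorem ete' (h : AdjacentPair u t e t' e') : e' * t' * e' = e' * t' := by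
  rw [h.et', mul_assoc, h.e_sq']

theorem e_et_e (h : AdjacentPair u t e t' e') : e * (e' * t') * e = e' * t' * e :=
  calc e * (e' * t') * e = e' * (e * t' * e) := by
        rw [← mul_assoc, h.ee]; simp only [mul_assoc]
    _ = e' * t' * e' * e := by rw [h.ete]; simp only [mul_assoc]
    _ = _ := by rw [h.ete']

theorem e_et_t (h : AdjacentPair u t e t' e') : e * (e' * t') * t = e' * t' * t * e' :=
  calc e * (e' * t') * t = e' * (e * t' * t) := by
        rw [← mul_assoc, h.ee]; simp only [mul_assoc]
    _ = _ := by rw [h.ett]; simp only [mul_assoc]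

theorem t_et_e (h : AdjacentPair u t e t' e') : t * (e' * t') * e = e' * t * (t' * e') :=
  calc t * (e' * t') * e = t * t' * (e' * e) := by rw [h.et']; simp only [mul_assoc]
    _ = t * t' * e * e' := by rw [← h.ee]; simp only [mul_assoc]
    _ = _ := by rw [h.tte]; simp only [mul_assoc]

theorem e_et_et (h : AdjacentPair u t e t' e') : e * (e' * t') * (e * t) = e' * t' * (e * t) := by
  rw [← mul_assoc, h.e_et_e, mul_assoc]

theorem et_et_e (h : AdjacentPair u t e t' e') :
    e * t * (e' * t') * e = e' * (e * t) * (t' * e') :=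
  calc e * t * (e' * t') * e = e * (t * (e' * t') * e) := by simp only [mul_assoc]
    _ = e * e' * t * (t' * e') := by rw [h.t_et_e]; simp only [mul_assoc]
    _ = _ := by rw [h.ee]; simp only [mul_assoc]

theorem t_et_et (h : AdjacentPair u t e t' e') :
    t * (e' * t') * (e * t) = t' * e' * (e * t) * t' :=
  calc t * (e' * t') * (e * t) = t * t' * (e' * e) * t := by rw [h.et']; simp only [mul_assoc]
    _ = _ := h.ttt_ee

theorem et_et_t (h : AdjacentPair u t e t' e') :
    e * t * (e' * t') * t = t' * e' * (e * t) * t' :=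
  calc e * t * (e' * t') * t = t * e * e' * t' * t := by rw [h.et]; simp only [mul_assoc]
    _ = e * e' * (t * t' * t) := by rw [← h.eet]; simp only [mul_assoc]
    _ = e * e' * t' * t * t' := by rw [h.braid]; simp only [mul_assoc]
    _ = t' * (e * e') * t * t' := by rw [h.eet']; simp only [mul_assoc]
    _ = _ := by rw [h.ee]; simp only [mul_assoc]

theorem et_et_et (h : AdjacentPair u t e t' e') :
    e * t * (e' * t') * (e * t) = t' * e' * (e * t) * t' :=
  calc e * t * (e' * t') * (e * t) = t * (e * (e' * t') * e) * t := by
        rw [← mul_assoc, h.et]; simp only [mul_assoc]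
    _ = t * (e' * t') * (e * t) := by rw [h.e_et_e]; simp only [mul_assoc]
    _ = _ := h.t_et_et

theorem sq_comm' (h : AdjacentPair u t e t' e') : t' * t' * e = e * (t' * t') := by
  have h1 : e' * t' * e = e * (e' * t') := by
    rw [← mul_assoc, h.eet', h.et', mul_assoc, ← h.ee, mul_assoc]
  rw [h.sq']
  simp only [mul_add, add_mul, mul_one, one_mul, smul_mul_assoc, mul_smul_comm, h1, h.ee]

variable {i : R}

theorem e_t_eq (h : AdjacentPair u t e t' e') (hi : t' * i = 1) : e' * t = t * t' * e * i :=
  calc e' * t = e' * t * t' * i := by rw [mul_assoc _ t', hi, mul_one]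
    _ = _ := by rw [h.ett']

theorem t_e_t (h : AdjacentPair u t e t' e') (hi : t' * i = 1) :
    t * e' * t = t' * e * i + (u - 1) • (t' * e' * e * i + e' * t * e') := by
  have h1 : t' * e' * i = e' := by rw [← h.et', mul_assoc, hi, mul_one]
  calc t * e' * t = t * t * (t' * e * i) := by
        rw [mul_assoc, h.e_t_eq hi]; simp only [mul_assoc]
    _ = t' * e * i + (u - 1) • (e * t' * e * i + e * t * t' * e * i) := by
        rw [h.sq]
        simp only [mul_add, add_mul, mul_one, one_mul, smul_mul_assoc, mul_assoc]
    _ = _ := by rw [h.ete, h.et_t_e, mul_assoc (e' * t), h1]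

theorem t_et_t (h : AdjacentPair u t e t' e') (hi : t' * i = 1) :
    t * (e' * t') * t = t' * (e * t) * t' :=
  calc t * (e' * t') * t = t * t' * (e' * t) := by rw [h.et']; simp only [mul_assoc]
    _ = t * t' * t * (t' * e * i) := by rw [h.e_t_eq hi]; simp only [mul_assoc]
    _ = t' * t * (t' * t' * e) * i := by rw [h.braid]; simp only [mul_assoc]
    _ = t' * (t * e) * t' * (t' * i) := by rw [h.sq_comm']; simp only [mul_assoc]
    _ = _ := by rw [hi, mul_one, h.et]

end AdjacentPair
end AdjacentPair

/-! ### Two relative traces in succession -/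

section Sandwich

variable {L : Type*} [Field L] {u A B : L} {m : ℕ}

namespace IsRelTrace

variable {r : BT u (m + 1) →ₗ[L] BT u m}

theorem apply_mul_mul (hr : IsRelTrace u A B m r) (hu : u ≠ 0) (a b : BT u m)
    (Z : BT u (m + 1)) : r (incl u m a * Z * incl u m b) = a * r Z * b := by
  rw [hr.mul_incl hu, hr.incl_mul hu]

theorem eq_of_E (hr : IsRelTrace u A B m r) (hu : u ≠ 0) {Z : BT u (m + 1)} (a b : BT u m)
    (hZ : Z = incl u m a * E u (Fin.last m) * incl u m b) : r Z = B • (a * b) := by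
  rw [hZ, hr.apply_mul_mul hu, hr.apply_E hu, mul_smul_comm, smul_mul_assoc, mul_one]

theorem eq_of_T (hr : IsRelTrace u A B m r) (hu : u ≠ 0) {Z : BT u (m + 1)} (a b : BT u m)
    (hZ : Z = incl u m a * T u (Fin.last m) * incl u m b) : r Z = A • (a * b) := by
  rw [hZ, hr.apply_mul_mul hu, hr.apply_T hu, mul_smul_comm, smul_mul_assoc, mul_one]

theorem eq_of_ET (hr : IsRelTrace u A B m r) (hu : u ≠ 0) {Z : BT u (m + 1)} (a b : BT u m)
    (hZ : Z = incl u m a * (E u (Fin.last m) * T u (Fin.last m)) * incl u m b) :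
    r Z = A • (a * b) := by
  rw [hZ, hr.apply_mul_mul hu, hr.apply_ET hu, mul_smul_comm, smul_mul_assoc, mul_one]

end IsRelTrace

/-- The values of a relative trace `r` on the products of `x` with the last generators on both
sides: if at least one of the factors is `E`, they are multiples of one element `γ`; and if they
are `T` and `E T`, or both `E T`, the value is one element `η`. -/
structure Sandwich (A B : L) (r : BT u (m + 1) →ₗ[L] BT u m) (x γ η : BT u m) : Prop where
  E_E : r (E u (Fin.last m) * incl u m x * E u (Fin.last m)) = B • γ
  E_T : r (E u (Fin.last m) * incl u m x * T u (Fin.last m)) = A • γ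
  T_E : r (T u (Fin.last m) * incl u m x * E u (Fin.last m)) = A • γ
  E_ET : r (E u (Fin.last m) * incl u m x * (E u (Fin.last m) * T u (Fin.last m))) = A • γ
  ET_E : r (E u (Fin.last m) * T u (Fin.last m) * incl u m x * E u (Fin.last m)) = A • γ
  ET_T : r (E u (Fin.last m) * T u (Fin.last m) * incl u m x * T u (Fin.last m)) = η
  T_ET : r (T u (Fin.last m) * incl u m x * (E u (Fin.last m) * T u (Fin.last m))) = η
  ET_ET : r (E u (Fin.last m) * T u (Fin.last m) * incl u m x *
    (E u (Fin.last m) * T u (Fin.last m))) = η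

theorem E_mul_ET {n : ℕ} (i : Fin n) : E u i * (E u i * T u i) = E u i * T u i := by
  rw [← mul_assoc, E_sq]

theorem ET_mul_T {n : ℕ} (i : Fin n) :
    E u i * T u i * T u i = u • E u i + (u - 1) • (E u i * T u i) := by
  rw [mul_assoc, T_sq]
  simp only [mul_add, mul_one, mul_smul_comm, E_mul_ET, E_sq]
  module

theorem IsRelTrace.apply_ETT {r : BT u (m + 1) →ₗ[L] BT u m} (hr : IsRelTrace u A B m r)
    (hu : u ≠ 0) : r (E u (Fin.last m) * T u (Fin.last m) * T u (Fin.last m)) =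
      (u * B + (u - 1) * A) • 1 := by
  rw [ET_mul_T, map_add, map_smul, map_smul, hr.apply_E hu, hr.apply_ET hu]
  module

namespace Sandwich

variable {r : BT u (m + 1) →ₗ[L] BT u m}

theorem one (hr : IsRelTrace u A B m r) (hu : u ≠ 0) :
    Sandwich A B r 1 1 ((u * B + (u - 1) * A) • 1) := by
  have hTE : ∀ i : Fin (m + 1), T u i * (E u i * T u i) = E u i * T u i * T u i := fun i => by
    rw [← mul_assoc, ET]
  have hETE : ∀ i : Fin (m + 1), E u i * T u i * E u i = E u i * T u i := fun i => by
    rw [mul_assoc, ← ET, E_mul_ET]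
  constructor
  all_goals simp only [map_one, mul_one, E_sq, E_mul_ET, hTE, hETE]
  · exact hr.apply_E hu
  · exact hr.apply_ET hu
  · rw [← ET]; exact hr.apply_ET hu
  · exact hr.apply_ET hu
  · exact hr.apply_ET hu
  · exact hr.apply_ETT hu
  · exact hr.apply_ETT hu
  · rw [← mul_assoc, hETE]; exact hr.apply_ETT hu

theorem add {x y γ γ' η η' : BT u m} (h : Sandwich A B r x γ η) (h' : Sandwich A B r y γ' η') :
    Sandwich A B r (x + y) (γ + γ') (η + η') := by
  constructor
  all_goals simp only [map_add, mul_add, add_mul, smul_add, h.1, h.2, h.3, h.4, h.5, h.6, h.7, h.8,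
    h'.1, h'.2, h'.3, h'.4, h'.5, h'.6, h'.7, h'.8]

theorem smul {x γ η : BT u m} (h : Sandwich A B r x γ η) (c : L) :
    Sandwich A B r (c • x) (c • γ) (c • η) := by
  constructor
  all_goals simp only [map_smul, mul_smul_comm, smul_mul_assoc, h.1, h.2, h.3, h.4, h.5, h.6, h.7,
    h.8, smul_comm c]

theorem conj {r : BT u (m + 2) →ₗ[L] BT u (m + 1)} (hr : IsRelTrace u A B (m + 1) r) (hu : u ≠ 0)
    {x γ η : BT u (m + 1)} (h : Sandwich A B r x γ η) (a b : BT u m) :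
    Sandwich A B r (incl u m a * x * incl u m b) (incl u m a * γ * incl u m b)
      (incl u m a * η * incl u m b) := by
  have key : ∀ y z : BT u (m + 2),
      (∀ a : BT u m, incl u (m + 1) (incl u m a) * y = y * incl u (m + 1) (incl u m a)) →
      (∀ a : BT u m, incl u (m + 1) (incl u m a) * z = z * incl u (m + 1) (incl u m a)) →
      r (y * incl u (m + 1) (incl u m a * x * incl u m b) * z) =
        incl u m a * r (y * incl u (m + 1) x * z) * incl u m b := by
    intro y z hy hz
    rw [← hr.apply_mul_mul hu]
    congr 1
    rw [map_mul, map_mul]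
    simp only [mul_assoc, hz]
    simp only [← mul_assoc, hy]
  have hT := incl_incl_comm_T (u := u) (m := m)
  have hE := incl_incl_comm_E (u := u) (m := m)
  have hET : ∀ a : BT u m, incl u (m + 1) (incl u m a) *
      (E u (Fin.last (m + 1)) * T u (Fin.last (m + 1))) =
      E u (Fin.last (m + 1)) * T u (Fin.last (m + 1)) * incl u (m + 1) (incl u m a) := by
    intro a
    rw [← mul_assoc, hE, mul_assoc, hT, mul_assoc]
  constructor
  · rw [key _ _ hE hE, h.1, mul_smul_comm, smul_mul_assoc]
  · rw [key _ _ hE hT, h.2, mul_smul_comm, smul_mul_assoc]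
  · rw [key _ _ hT hE, h.3, mul_smul_comm, smul_mul_assoc]
  · rw [key _ _ hE hET, h.4, mul_smul_comm, smul_mul_assoc]
  · rw [key _ _ hET hE, h.5, mul_smul_comm, smul_mul_assoc]
  · rw [key _ _ hET hT, h.6]
  · rw [key _ _ hT hET, h.7]
  · rw [key _ _ hET hET, h.8]

end Sandwich

/-- The last generators and those one step below. -/
theorem adjacentPair (u : L) (m : ℕ) :
    AdjacentPair u (T u (Fin.last (m + 1))) (E u (Fin.last (m + 1)))
      (incl u (m + 1) (T u (Fin.last m))) (incl u (m + 1) (E u (Fin.last m))) := by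
  rw [incl_T, incl_E]
  have h1 : ((Fin.last m).castSucc : ℕ) + 1 = (Fin.last (m + 1) : ℕ) := by simp
  exact
    { sq := T_sq u _
      sq' := T_sq u _
      e_sq := E_sq u _
      e_sq' := E_sq u _
      et := ET u _
      et' := ET u _
      ee := E_comm u _ _
      braid := (T_braid u h1).symm
      ett := ETT u (Or.inr h1)
      ett' := ETT u (Or.inl h1)
      eet := EET u (Or.inr h1)
      eet' := by rw [E_comm, EET u (Or.inl h1), mul_assoc, E_comm, ← mul_assoc]
      ete := (TEE u (Or.inl h1)).symm }

/-- The values of the relative trace on the products of `h`, one of `1`, `T`, `E`, `E T` for the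
generators one step below, with the last generators on both sides. The elements `γ` and `η` are
those of `Sandwich`, and `θ` is the value on `T h T`. -/
inductive SandwichTable (A B : L) : (h γ η θ : BT u (m + 1)) → Prop
  | one : SandwichTable A B 1 1 ((u * B + (u - 1) * A) • 1) ((1 + (u - 1) * (A + B)) • 1)
  | ofT : SandwichTable A B (T u (Fin.last m)) (E u (Fin.last m) * T u (Fin.last m))
      (A • (u • E u (Fin.last m) + (u - 1) • (E u (Fin.last m) * T u (Fin.last m))))
      (A • (1 + (u - 1) • (E u (Fin.last m) + E u (Fin.last m) * T u (Fin.last m))))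
  | ofE : SandwichTable A B (E u (Fin.last m)) (E u (Fin.last m))
      ((u * B + (u - 1) * A) • E u (Fin.last m))
      (B • 1 + ((u - 1) * (A + B)) • E u (Fin.last m))
  | ofET : SandwichTable A B (E u (Fin.last m) * T u (Fin.last m))
      (E u (Fin.last m) * T u (Fin.last m))
      (A • (u • E u (Fin.last m) + (u - 1) • (E u (Fin.last m) * T u (Fin.last m))))
      (A • (1 + (u - 1) • (E u (Fin.last m) + E u (Fin.last m) * T u (Fin.last m))))

namespace SandwichTable

variable {h γ η θ : BT u (m + 1)}

theorem sandwich {r : BT u (m + 2) →ₗ[L] BT u (m + 1)} (hr : IsRelTrace u A B (m + 1) r)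
    (hu : u ≠ 0) (hh : SandwichTable A B h γ η θ) : Sandwich A B r h γ η := by
  have hp := adjacentPair u m
  have hTET : T u (Fin.last m) * E u (Fin.last m) * T u (Fin.last m) =
      u • E u (Fin.last m) + (u - 1) • (E u (Fin.last m) * T u (Fin.last m)) := by
    rw [← ET, ET_mul_T]
  have hETE : E u (Fin.last m) * (T u (Fin.last m) * E u (Fin.last m)) =
      E u (Fin.last m) * T u (Fin.last m) := by
    rw [← ET, E_mul_ET]
  cases hh with
  | one => exact Sandwich.one hr hu
  | ofT =>
    constructor
    · rw [hr.eq_of_E hu (T u (Fin.last m) * E u (Fin.last m)) 1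
        (by rw [hp.ete]; simp only [map_mul, map_one, mul_one]), mul_one, ET]
    · rw [hr.eq_of_T hu (T u (Fin.last m)) (E u (Fin.last m)) hp.ett, ET]
    · rw [hr.eq_of_T hu (E u (Fin.last m)) (T u (Fin.last m)) hp.tte]
    · rw [hr.eq_of_ET hu (T u (Fin.last m) * E u (Fin.last m)) 1
        (by rw [hp.e_t_et]; simp only [map_mul, map_one, mul_one]), mul_one, ET]
    · rw [hr.eq_of_T hu (E u (Fin.last m)) (T u (Fin.last m) * E u (Fin.last m))
        (by rw [hp.et_t_e]; simp only [map_mul]), hETE]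
    · rw [hr.eq_of_T hu (T u (Fin.last m)) (T u (Fin.last m) * E u (Fin.last m))
        (by rw [hp.et_t_t]; simp only [map_mul]), ← ET, ← mul_assoc, hTET]
    · rw [hr.eq_of_T hu (E u (Fin.last m) * T u (Fin.last m)) (T u (Fin.last m))
        (by rw [hp.t_t_et]; simp only [map_mul]), ET_mul_T]
    · rw [hr.eq_of_ET hu (T u (Fin.last m) * E u (Fin.last m)) (T u (Fin.last m))
        (by rw [hp.et_t_et]; simp only [map_mul]), hTET]
  | ofE =>
    have hη : r (incl u (m + 1) (E u (Fin.last m)) * (E u (Fin.last (m + 1)) *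
        T u (Fin.last (m + 1)) * T u (Fin.last (m + 1)))) =
        (u * B + (u - 1) * A) • E u (Fin.last m) := by
      rw [hr.incl_mul hu, hr.apply_ETT hu, mul_smul_comm, mul_one]
    constructor
    · rw [hr.eq_of_E hu (E u (Fin.last m)) 1
        (by rw [hp.e_e_e]; simp only [map_one, mul_one]), mul_one]
    · rw [hr.eq_of_ET hu (E u (Fin.last m)) 1
        (by rw [hp.e_e_t]; simp only [map_one, mul_one]), mul_one]
    · rw [hr.eq_of_ET hu 1 (E u (Fin.last m))
        (by rw [hp.t_e_e]; simp only [map_one, one_mul]), one_mul]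
    · rw [hr.eq_of_ET hu (E u (Fin.last m)) 1
        (by rw [hp.e_e_et]; simp only [map_one, mul_one]), mul_one]
    · rw [hr.eq_of_ET hu 1 (E u (Fin.last m))
        (by rw [hp.et_e_e]; simp only [map_one, one_mul]), one_mul]
    · rw [hp.et_e_t, hη]
    · rw [hp.t_e_et, hη]
    · rw [hp.et_e_et, hη]
  | ofET =>
    constructor <;> rw [map_mul (incl u (m + 1))]
    · rw [hr.eq_of_E hu (E u (Fin.last m) * T u (Fin.last m)) 1
        (by rw [hp.e_et_e]; simp only [map_mul, map_one, mul_one]), mul_one]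
    · rw [hr.eq_of_T hu (E u (Fin.last m) * T u (Fin.last m)) (E u (Fin.last m))
        (by rw [hp.e_et_t]; simp only [map_mul]), mul_assoc, hETE]
    · rw [hr.eq_of_T hu (E u (Fin.last m)) (T u (Fin.last m) * E u (Fin.last m))
        (by rw [hp.t_et_e]; simp only [map_mul]), hETE]
    · rw [hr.eq_of_ET hu (E u (Fin.last m) * T u (Fin.last m)) 1
        (by rw [hp.e_et_et]; simp only [map_mul, map_one, mul_one]), mul_one]
    · rw [hr.eq_of_ET hu (E u (Fin.last m)) (T u (Fin.last m) * E u (Fin.last m))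
        (by rw [hp.et_et_e]; simp only [map_mul]), hETE]
    · rw [hr.eq_of_ET hu (T u (Fin.last m) * E u (Fin.last m)) (T u (Fin.last m))
        (by rw [hp.et_et_t]; simp only [map_mul]), hTET]
    · rw [hr.eq_of_ET hu (T u (Fin.last m) * E u (Fin.last m)) (T u (Fin.last m))
        (by rw [hp.t_et_et]; simp only [map_mul]), hTET]
    · rw [hr.eq_of_ET hu (T u (Fin.last m) * E u (Fin.last m)) (T u (Fin.last m))
        (by rw [hp.et_et_et]; simp only [map_mul]), hTET]

theorem T_T {r : BT u (m + 2) →ₗ[L] BT u (m + 1)} (hr : IsRelTrace u A B (m + 1) r)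
    (hu : u ≠ 0) (hh : SandwichTable A B h γ η θ) :
    r (T u (Fin.last (m + 1)) * incl u (m + 1) h * T u (Fin.last (m + 1))) = θ := by
  have hp := adjacentPair u m
  have hi : incl u (m + 1) (T u (Fin.last m)) * incl u (m + 1) (Tinv u (Fin.last m)) = 1 := by
    rw [← map_mul, T_mul_Tinv u hu, map_one]
  have hT2 : T u (Fin.last m) * T u (Fin.last m) =
      1 + (u - 1) • (E u (Fin.last m) + E u (Fin.last m) * T u (Fin.last m)) := by
    rw [T_sq, mul_add, mul_one]
  cases hh with
  | one =>
    rw [map_one, mul_one, T_sq, map_add, map_smul, mul_add, mul_one, map_add, hr.apply_one hu,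
      hr.apply_E hu, hr.apply_ET hu]
    module
  | ofT =>
    rw [hr.eq_of_T hu (T u (Fin.last m)) (T u (Fin.last m)) hp.braid, hT2]
  | ofE =>
    have h1 : T u (Fin.last m) * E u (Fin.last m) * Tinv u (Fin.last m) = E u (Fin.last m) := by
      rw [← ET, mul_assoc, T_mul_Tinv u hu, mul_one]
    rw [hp.t_e_t hi, map_add, map_smul, map_add,
      hr.eq_of_E hu (T u (Fin.last m)) (Tinv u (Fin.last m)) rfl,
      hr.eq_of_E hu (T u (Fin.last m) * E u (Fin.last m)) (Tinv u (Fin.last m))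
        (by simp only [map_mul]),
      hr.eq_of_T hu (E u (Fin.last m)) (E u (Fin.last m)) rfl, h1, T_mul_Tinv u hu, E_sq]
    module
  | ofET =>
    rw [map_mul (incl u (m + 1)), hr.eq_of_ET hu (T u (Fin.last m)) (T u (Fin.last m))
      (hp.t_et_t hi), hT2]

end SandwichTable

theorem eq_algebraMap (x : BT u 0) : ∃ c : L, x = c • 1 := by
  refine ⟨oneStrand u x, (oneStrand u).injective ?_⟩
  rw [map_smul, map_one, smul_eq_mul, mul_one]

theorem exists_sandwich (hu : u ≠ 0) {r : BT u (m + 1) →ₗ[L] BT u m}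
    (hr : IsRelTrace u A B m r) (x : BT u m) : ∃ γ η : BT u m, Sandwich A B r x γ η := by
  rcases m with _ | m
  · obtain ⟨c, rfl⟩ := eq_algebraMap x
    exact ⟨_, _, (Sandwich.one hr hu).smul c⟩
  · induction x using BT_bimodule_induction hu with
    | hp a b y hy =>
      rcases hy with rfl | rfl | rfl | rfl
      · exact ⟨_, _, ((SandwichTable.one (A := A) (B := B)).sandwich hr hu).conj hr hu a b⟩
      · exact ⟨_, _, ((SandwichTable.ofT (A := A) (B := B)).sandwich hr hu).conj hr hu a b⟩
      · exact ⟨_, _, ((SandwichTable.ofE (A := A) (B := B)).sandwich hr hu).conj hr hu a b⟩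
      · exact ⟨_, _, ((SandwichTable.ofET (A := A) (B := B)).sandwich hr hu).conj hr hu a b⟩
    | hadd x y hx hy =>
      obtain ⟨_, _, hx⟩ := hx
      obtain ⟨_, _, hy⟩ := hy
      exact ⟨_, _, hx.add hy⟩
    | hsmul c x hx =>
      obtain ⟨_, _, hx⟩ := hx
      exact ⟨_, _, hx.smul c⟩

variable {r : BT u (m + 1) →ₗ[L] BT u m}

/-- The relative trace one step below does not distinguish on which side of `x` the values of
`SandwichTable` stand. -/
theorem SandwichTable.symm (hu : u ≠ 0) (hr : IsRelTrace u A B m r)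
    {h γ η θ h' γ' η' θ' : BT u (m + 1)} (hh : SandwichTable A B h γ η θ)
    (hh' : SandwichTable A B h' γ' η' θ') (x : BT u m) :
    r (γ * incl u m x * h') = r (h * incl u m x * γ') ∧
    r (η * incl u m x * h') = r (h * incl u m x * η') ∧
    r (θ * incl u m x * h') = r (h * incl u m x * θ') := by
  obtain ⟨δ, ε, hs⟩ := exists_sandwich hu hr x
  have h1 : r (1 * incl u m x * 1) = x := by rw [one_mul, mul_one, hr.apply_incl hu]
  have h2 : r (1 * incl u m x * T u (Fin.last m)) = A • x := by
    rw [one_mul, hr.incl_mul hu, hr.apply_T hu, mul_smul_comm, mul_one]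
  have h3 : r (1 * incl u m x * E u (Fin.last m)) = B • x := by
    rw [one_mul, hr.incl_mul hu, hr.apply_E hu, mul_smul_comm, mul_one]
  have h4 : r (1 * incl u m x * (E u (Fin.last m) * T u (Fin.last m))) = A • x := by
    rw [one_mul, hr.incl_mul hu, hr.apply_ET hu, mul_smul_comm, mul_one]
  have h5 : r (T u (Fin.last m) * incl u m x * 1) = A • x := by
    rw [mul_one, hr.mul_incl hu, hr.apply_T hu, smul_mul_assoc, one_mul]
  have h6 : r (E u (Fin.last m) * incl u m x * 1) = B • x := by
    rw [mul_one, hr.mul_incl hu, hr.apply_E hu, smul_mul_assoc, one_mul]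
  have h7 : r (E u (Fin.last m) * T u (Fin.last m) * incl u m x * 1) = A • x := by
    rw [mul_one, hr.mul_incl hu, hr.apply_ET hu, smul_mul_assoc, one_mul]
  cases hh <;> cases hh' <;> refine ⟨?_, ?_, ?_⟩ <;>
    simp only [smul_add, mul_add, add_mul, smul_mul_assoc, mul_smul_comm, map_add, map_smul, h1,
      h2, h3, h4, h5, h6, h7, hs.1, hs.2, hs.3, hs.4, hs.5, hs.6, hs.7, hs.8] <;> module

theorem IsRelTrace.comm_of_table {r' : BT u (m + 2) →ₗ[L] BT u (m + 1)} (hu : u ≠ 0)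
    (hr : IsRelTrace u A B m r) (hr' : IsRelTrace u A B (m + 1) r')
    {h γ η θ h' γ' η' θ' : BT u (m + 1)} (hh : SandwichTable A B h γ η θ)
    (hh' : SandwichTable A B h' γ' η' θ') (x : BT u m) {g y : BT u (m + 2)}
    (hg : g = T u (Fin.last (m + 1)) ∨ g = E u (Fin.last (m + 1)))
    (hy : y = 1 ∨ y = T u (Fin.last (m + 1)) ∨ y = E u (Fin.last (m + 1)) ∨
      y = E u (Fin.last (m + 1)) * T u (Fin.last (m + 1))) :
    r (r' (g * incl u (m + 1) h * y) * incl u m x * h') =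
      r (h * incl u m x * r' (y * incl u (m + 1) h' * g)) := by
  obtain ⟨k1, k2, k3⟩ := hh.symm hu hr hh' x
  have s := hh.sandwich hr' hu
  have s' := hh'.sandwich hr' hu
  have t := hh.T_T hr' hu
  have t' := hh'.T_T hr' hu
  rcases hg with rfl | rfl <;> rcases hy with rfl | rfl | rfl | rfl
  · rw [mul_one, one_mul, hr'.mul_incl hu, hr'.incl_mul hu, hr'.apply_T hu]
    simp only [smul_mul_assoc, mul_smul_comm, map_smul, one_mul, mul_one]
  · rw [t, t', k3]
  · rw [s.T_E, s'.E_T]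
    simp only [smul_mul_assoc, mul_smul_comm, map_smul, k1]
  · rw [s.T_ET, s'.ET_T, k2]
  · rw [mul_one, one_mul, hr'.mul_incl hu, hr'.incl_mul hu, hr'.apply_E hu]
    simp only [smul_mul_assoc, mul_smul_comm, map_smul, one_mul, mul_one]
  · rw [s.E_T, s'.T_E]
    simp only [smul_mul_assoc, mul_smul_comm, map_smul, k1]
  · rw [s.E_E, s'.E_E]
    simp only [smul_mul_assoc, mul_smul_comm, map_smul, k1]
  · rw [s.E_ET, s'.ET_E]
    simp only [smul_mul_assoc, mul_smul_comm, map_smul, k1]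

theorem exists_table {y : BT u (m + 1)} (A B : L)
    (hy : y = 1 ∨ y = T u (Fin.last m) ∨ y = E u (Fin.last m) ∨
      y = E u (Fin.last m) * T u (Fin.last m)) : ∃ γ η θ, SandwichTable A B y γ η θ := by
  rcases hy with rfl | rfl | rfl | rfl
  exacts [⟨_, _, _, .one⟩, ⟨_, _, _, .ofT⟩, ⟨_, _, _, .ofE⟩, ⟨_, _, _, .ofET⟩]

/-- Two relative traces in succession do not distinguish `g Z` from `Z g` for the last
generators `g`. -/
theorem IsRelTrace.comm_last {r' : BT u (m + 2) →ₗ[L] BT u (m + 1)} (hu : u ≠ 0)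
    (hr : IsRelTrace u A B m r) (hr' : IsRelTrace u A B (m + 1) r') {g : BT u (m + 2)}
    (hg : g = T u (Fin.last (m + 1)) ∨ g = E u (Fin.last (m + 1))) (Z : BT u (m + 2)) :
    r (r' (g * Z)) = r (r' (Z * g)) := by
  have hcg : ∀ x : BT u m, incl u (m + 1) (incl u m x) * g = g * incl u (m + 1) (incl u m x) := by
    rcases hg with rfl | rfl
    exacts [incl_incl_comm_T, incl_incl_comm_E]
  have hcg' : ∀ (x : BT u m) (Z : BT u (m + 2)), incl u (m + 1) (incl u m x) * (g * Z) =
      g * (incl u (m + 1) (incl u m x) * Z) := fun x Z => by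
    rw [← mul_assoc, hcg, mul_assoc]
  induction Z using BT_bimodule_induction hu with
  | hadd x y hx hy => simp only [mul_add, add_mul, map_add, hx, hy]
  | hsmul c x hx => simp only [mul_smul_comm, smul_mul_assoc, map_smul, hx]
  | hp a b y hy =>
    have hcy : ∀ x : BT u m,
        incl u (m + 1) (incl u m x) * y = y * incl u (m + 1) (incl u m x) := by
      intro x
      rcases hy with rfl | rfl | rfl | rfl
      · rw [mul_one, one_mul]
      · exact incl_incl_comm_T x
      · exact incl_incl_comm_E x
      · rw [← mul_assoc, incl_incl_comm_E, mul_assoc, incl_incl_comm_T, mul_assoc]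
    have hcy' : ∀ (x : BT u m) (Z : BT u (m + 2)), incl u (m + 1) (incl u m x) * (y * Z) =
        y * (incl u (m + 1) (incl u m x) * Z) := fun x Z => by
      rw [← mul_assoc, hcy, mul_assoc]
    induction a using BT_bimodule_induction hu with
    | hadd x y hx hy => simp only [mul_add, add_mul, map_add, hx, hy]
    | hsmul c x hx => simp only [mul_smul_comm, smul_mul_assoc, map_smul, hx]
    | hp a₁ a₂ h hh =>
      induction b using BT_bimodule_induction hu with
      | hadd x y hx hy => simp only [mul_add, add_mul, map_add, hx, hy]
      | hsmul c x hx => simp only [mul_smul_comm, smul_mul_assoc, map_smul, hx]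
      | hp b₁ b₂ h' hh' =>
        obtain ⟨γ, η, θ, ht⟩ := exists_table A B hh
        obtain ⟨γ', η', θ', ht'⟩ := exists_table A B hh'
        -- elements two steps below commute with `g` and `y`, so `a₂` and `b₁` meet in the middle
        -- and `a₁`, `b₂` can be taken out of both traces
        have key := hr.comm_of_table hu hr' ht ht' (a₂ * b₁) hg hy
        have e1 : g * (incl u (m + 1) (incl u m a₁ * h * incl u m a₂) * y *
            incl u (m + 1) (incl u m b₁ * h' * incl u m b₂)) =
            incl u (m + 1) (incl u m a₁) * (g * incl u (m + 1) h * y) *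
              incl u (m + 1) (incl u m (a₂ * b₁) * h' * incl u m b₂) := by
          simp only [map_mul, mul_assoc, hcy', hcg']
        have e2 : incl u (m + 1) (incl u m a₁ * h * incl u m a₂) * y *
            incl u (m + 1) (incl u m b₁ * h' * incl u m b₂) * g =
            incl u (m + 1) (incl u m a₁ * h * incl u m (a₂ * b₁)) *
              (y * incl u (m + 1) h' * g) * incl u (m + 1) (incl u m b₂) := by
          simp only [map_mul, mul_assoc, hcg, hcy']
        rw [e1, e2, hr'.apply_mul_mul hu, hr'.apply_mul_mul hu]
        have e3 : ∀ z : BT u (m + 1), incl u m a₁ * z * (incl u m (a₂ * b₁) * h' * incl u m b₂) =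
            incl u m a₁ * (z * incl u m (a₂ * b₁) * h') * incl u m b₂ := fun z => by
          simp only [mul_assoc]
        have e4 : ∀ z : BT u (m + 1), incl u m a₁ * h * incl u m (a₂ * b₁) * z * incl u m b₂ =
            incl u m a₁ * (h * incl u m (a₂ * b₁) * z) * incl u m b₂ := fun z => by
          simp only [mul_assoc]
        rw [e3, e4, hr.apply_mul_mul hu, hr.apply_mul_mul hu, key]

end Sandwich

/-! ### The trace property -/

section Trace

variable {L : Type*} [Field L] {u A B : L} {m : ℕ}

/-- On two strands there is one braid and one tie generator, and they commute. -/
theorem two_strands_comm (x y : BT u 1) : x * y = y * x := by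
  have key : ∀ z : BT u 1, (∀ i, z * T u i = T u i * z) → (∀ i, z * E u i = E u i * z) →
      ∀ y, z * y = y * z := by
    intro z hT hE y
    induction y using BT_induction with
    | hs c => exact (Algebra.commutes c z).symm
    | hT i => exact hT i
    | hE i => exact hE i
    | hadd x y hx hy => rw [mul_add, add_mul, hx, hy]
    | hmul x y hx hy => rw [← mul_assoc, hx, mul_assoc, hy, mul_assoc]
  refine key x (fun i => ?_) (fun i => ?_) y
  · refine (key _ (fun j => ?_) (fun j => ?_) x).symm
    · rw [Subsingleton.elim i j]
    · rw [Subsingleton.elim i j, ET]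
  · refine (key _ (fun j => ?_) (fun j => ?_) x).symm
    · rw [Subsingleton.elim i j, ET]
    · rw [Subsingleton.elim i j]

variable {r : (m : ℕ) → BT u (m + 1) →ₗ[L] BT u m}

theorem composite_succ (X : BT u (m + 1)) :
    composite r (m + 1) X = composite r m (r m X) := rfl

theorem composite_mul_comm (hu : u ≠ 0) (hr : ∀ m, IsRelTrace u A B m (r m)) :
    ∀ (m : ℕ) (X Y : BT u m), composite r m (X * Y) = composite r m (Y * X)
  | 0, X, Y => by
    change oneStrand u (X * Y) = oneStrand u (Y * X)
    rw [map_mul, map_mul, mul_comm]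
  | 1, X, Y => by rw [two_strands_comm]
  | m + 2, X, Y => by
    have hincl : ∀ (x : BT u (m + 1)) (X : BT u (m + 2)),
        composite r (m + 2) (X * incl u (m + 1) x) =
          composite r (m + 2) (incl u (m + 1) x * X) := by
      intro x X
      rw [composite_succ, (hr _).mul_incl hu, composite_mul_comm hu hr (m + 1),
        ← (hr _).incl_mul hu, ← composite_succ]
    have hlast : ∀ (g X : BT u (m + 2)),
        (g = T u (Fin.last (m + 1)) ∨ g = E u (Fin.last (m + 1))) →
        composite r (m + 2) (X * g) = composite r (m + 2) (g * X) := by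
      intro g X hg
      simp only [composite_succ]
      rw [(hr m).comm_last hu (hr (m + 1)) hg]
    induction Y using BT_induction generalizing X with
    | hs c => rw [← Algebra.commutes]
    | hT i =>
      refine Fin.lastCases ?_ (fun i => ?_) i
      · exact hlast _ X (Or.inl rfl)
      · rw [← incl_T]; exact hincl _ X
    | hE i =>
      refine Fin.lastCases ?_ (fun i => ?_) i
      · exact hlast _ X (Or.inr rfl)
      · rw [← incl_E]; exact hincl _ X
    | hadd x y hx hy => rw [mul_add, add_mul, map_add, map_add, hx, hy]
    | hmul x y hx hy => rw [← mul_assoc, hy, ← mul_assoc, hx, ← mul_assoc]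

theorem composite_one (hu : u ≠ 0) (hr : ∀ m, IsRelTrace u A B m (r m)) (m : ℕ) :
    composite r m 1 = 1 := by
  induction m with
  | zero => exact map_one (oneStrand u)
  | succ m ih => rw [composite_succ, (hr m).apply_one hu, ih]

end Trace

end BraidsTies

open BraidsTies in
theorem theorem4p6 {L : Type*} [Field L] [Algebra (RatFunc ℂ) L] (A B u : L)
    (hu : u = algebraMap (RatFunc ℂ) L RatFunc.X) :
    (∀ m, Function.Injective (incl u m)) ∧
    (∀ m, ∃! r : BT u (m + 1) →ₗ[L] BT u m, IsRelTrace u A B m r) ∧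
    ∀ r : (m : ℕ) → BT u (m + 1) →ₗ[L] BT u m, (∀ m, IsRelTrace u A B m (r m)) →
      ∀ m : ℕ,
        composite r m 1 = 1 ∧
        (∀ X Y : BT u m, composite r m (X * Y) = composite r m (Y * X)) ∧
        (∀ X : BT u m,
          composite r (m + 1) (incl u m X * T u (Fin.last m)) = A * composite r m X ∧
          composite r (m + 1) (incl u m X * E u (Fin.last m) * T u (Fin.last m)) =
            A * composite r m X) ∧
        (∀ X : BT u m,
          composite r (m + 1) (incl u m X * E u (Fin.last m)) = B * composite r m X) := by
  have hu0 : u ≠ 0 := by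
    rw [hu]
    exact (map_ne_zero_iff _ (algebraMap (RatFunc ℂ) L).injective).2 RatFunc.X_ne_zero
  refine ⟨fun m => ?_, existsUnique_isRelTrace hu0 A B, fun r hr m => ?_⟩
  · obtain ⟨r, hr, -⟩ := existsUnique_isRelTrace hu0 A B m
    exact Function.LeftInverse.injective (g := r) (hr.apply_incl hu0)
  · refine ⟨composite_one hu0 hr m, composite_mul_comm hu0 hr m, fun X => ⟨?_, ?_⟩, fun X => ?_⟩
    · rw [composite_succ, (hr m).incl_mul hu0, (hr m).apply_T hu0, mul_smul_comm, mul_one,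
        map_smul, smul_eq_mul]
    · rw [composite_succ, mul_assoc, (hr m).incl_mul hu0, (hr m).apply_ET hu0, mul_smul_comm,
        mul_one, map_smul, smul_eq_mul]
    · rw [composite_succ, (hr m).incl_mul hu0, (hr m).apply_E hu0, mul_smul_comm, mul_one,
        map_smul, smul_eq_mul]
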